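/- Let $n\ge 3$, $\mathcal A=\mathbb Z[v,v^{-1}]$, $\mathcal A^-=\mathbb Z[v^{-1}]$ and $[2]=v+v^{-1}$. **The algebra.** An affine $n$-diagram (up to isotopy) is a perfect matching of the nodes $\mathbb Z\times\{0,1\}$, invariant under the translation by $n$, by edges that lie in the strip $\mathbb R\times[0,1]$ and do not intersect, together with finitely many infinite horizontal lines ("bands", which can occur only if no edge joins the top row $\mathbb Z\times\{1\}$ to the bottom row $\mathbb Z\times\{0\}$). It is regarded as a diagram on a cylinder. The product of two diagrams is $AB=[2]^xE$, where $A$ is put on top of $B$, $x$ is the number of contractible loops formed, and $E$ is the diagram left after their removal. $\mathcal D(\widehat A_{n-1})$ is the free $\mathcal A$-module on the diagrams with this product. **Tabular algebras with trace.** A normalized table algebra over $\mathbb Z$ is a ring with a $\mathbb Z$-basis $B\ni 1$ with nonnegative integer structure constants and an involutory anti-automorphism $\bar{\ }$ permuting $B$ such that $\kappa(b'',bb')=\kappa(b,b''\overline{b'})$ for $b,b',b''\in B$, where $\kappa(b,a)$ is the coefficient of $b$ in $a$. A tabular algebra is an associative $\mathcal A$-algebra $A$ with a datum $(\Lambda,\Gamma,B,M,C,*)$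 such that: (A1) $\Lambda$ is a finite poset; for $\lambda\in\Lambda$, $(\Gamma(\lambda),B(\lambda))$ is a normalized table algebra over $\mathbb Z$ and $M(\lambda)$ is a finite set; $C:\coprod_\lambda M(\lambda)\times B(\lambda)\times M(\lambda)\to A$, $(S,b,T)\mapsto C^b_{S,T}$, is injective with image an $\mathcal A$-basis of $A$; and $\operatorname{Im}C$ contains mutually orthogonal idempotents $1_\varepsilon$ with $A=\sum_{\varepsilon,\varepsilon'}1_\varepsilon A1_{\varepsilon'}$ such that each $X\in\operatorname{Im}C$ satisfies $X=1_\varepsilon X1_{\varepsilon'}$ for some $\varepsilon,\varepsilon'$. (A2) $*$ is an $\mathcal A$-linear involutory anti-automorphism of $A$ with $(C^b_{S,T})^*=C^{\bar b}_{T,S}$. Extend $C^g_{S,T}$ linearly to $g\in\mathcal A\otimes_{\mathbb Z}\Gamma(\lambda)$. (A3) For $\lambda\in\Lambda$ and $a\in A$ there are $r_a(S',S)\in\mathcal A\otimes_{\mathbb Z}\Gamma(\lambda)$ with $a\,C^g_{S,T}\equiv\sum_{S'\in M(\lambda)}C^{r_a(S',S)g}_{S',T}$ modulo the span of the $C^b_{U,V}$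 from cells $\mu<\lambda$, for all $S,T\in M(\lambda)$ and $g\in\Gamma(\lambda)$. It is a tabular algebra with trace $\tau$ if moreover, writing $XY=\sum_Zg_{X,Y,Z}Z$ for $X,Y\in\operatorname{Im}C$, the maximum $\mathbf a(Z)=\max_{X,Y}\deg_vg_{X,Y,Z}$ exists for every $Z \in \operatorname{Im} C$, and: (A4) for $K=C^b_{S,T}$, $K'=C^{b'}_{U,V}$, $K''=C^{b''}_{X,Y}$, one has $\deg g_{K,K',K''}=\mathbf a(K'')$ if and only if $X=S$, $T=U$, $Y=V$ (so that all three lie in the same cell) and $b''$ occurs in $bb'$ with nonzero coefficient; if these conditions hold and $b=b'=b''=1$, then the coefficient of $v^{\mathbf a(K'')}$ in $g_{K,K',K''}$ is $1$; (A5) $\tau:A\to\mathcal A$ is $\mathcal A$-linear, $\tau(x)=\tau(x^*)$ and $\tau(xy)=\tau(yx)$ for all $x,y$, and for $X=C^b_{S,T}$ the element $\tau(v^{\mathbf a(X)}X)$ is $1$ modulo $v^{-1}\mathcal A^-$ if $S=T$ and $b=1$, and $0$ modulo $v^{-1}\mathcal A^-$ otherwise. **The table datum.** $\Lambda$ is the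 set of integers $0\le\lambda\le n$ with $n-\lambda$ even, in the usual order. For $\lambda>0$, $\Gamma(\lambda)=\mathbb Z[v,v^{-1}]$ with basis $\{v^k:k\in\mathbb Z\}$ and involution $v\mapsto v^{-1}$; $M(\lambda)$ is the set of involutions $S$ of $\{1,\dots,n\}$ with $\lambda$ fixed points that are annular: whenever $S$ exchanges $i<j$, then $S[i,j]=[i,j]$, and $[i,j]$ contains no fixed point or all fixed points of $S$. Then $C(S_1,v^k,S_2)=[S_1,S_2,k]$ is the unique diagram in which distinct $i,j \in \{1, \dots, n\}$ are joined in the top (bottom) circle if and only if $S_1$ ($S_2$) exchanges them, and whose winding number is $k$; the winding number is the number of edges crossing the seam $x=1/2$ of the strip from a bottom node on its left to a top node on its right, minus the number of those from a bottom node on its right to a top node on its left. For $\lambda=0$, $\Gamma(0)=\mathbb Z[x]$ with trivial involution and basis $\{U_k:k\ge0\}$, $U_0=1$, $U_1=x$, $U_{k+1}=xU_k-U_{k-1}$; $M(0)$ is the set of involutions $S$ of $\mathbb Z$ without fixed points such that $S(k+n)=S(k)+n$ for all $k$, and $S[i,j]=[i,j]$ whenever $S$ exchanges $i<j$; and $C(S_1,U_k,S_2)$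 is obtained from $U_k(x)$ by replacing each $x^m$ by the unique diagram $[S_1,S_2,m]$ with top edges given by $S_1$, bottom edges given by $S_2$, and $m$ bands. The map $*$ is top-bottom reflection of diagrams. **The trace.** For a diagram $D$, identify the top and bottom circles of its cylinder to get a family of closed curves on a torus. Let $x$ be the number of contractible ones and $t$ the number of non-contractible ones (which are parallel). Put $\tau(D)=[2]^xf$, where $f=v^{t-n}$ if $t=0$ or the non-contractible curves can be isotoped off the seam (the image of $x=1/2$); $f=v^{-n}\kappa(1,x^t)$ if $t>0$ and the curves are exceptional, that is, parallel to the circle of the cylinder, with $\kappa(1,\cdot)$ the coefficient of $U_0=1$ in the basis $\{U_k\}$ of $\mathbb Z[x]$; and $f=0$ otherwise. Extend $\tau$ linearly. **Theorem.** The product of diagrams and the diagrams $[S_1,S_2,k]$ are well defined, and $\mathcal D(\widehat A_{n-1})$ with this table datum and the trace $\tau$ is a tabular algebra with trace. It is infinite-dimensional: it is not finitely generated as an $\mathcal A$-module. -/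

import Mathlib

open Polynomial LaurentPolynomial
open scoped TensorProduct

noncomputable section

/-! ### Normalized table algebras over `ℤ` -/

/-- A ring `Γ`, free over `ℤ`, with a distinguished basis and a linear endomorphism `bar`. -/
structure BasedRing where
  Γ : Type
  [ring : Ring Γ]
  ι : Type
  basis : Module.Basis ι ℤ Γ
  bar : Γ →ₗ[ℤ] Γ

attribute [instance] BasedRing.ring

/-- A based ring is a normalized table algebra over `ℤ`: the basis contains `1`, the structure
constants are nonnegative integers, `bar` is an involutory anti-automorphism permuting the basis,
and `κ(b_m, b_i b_j) = κ(b_i, b_m (bar b_j))`, where `κ(b, x)` is the coefficient of `b` in `x`. -/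
structure BasedRing.IsNormalizedTableAlgebra (R : BasedRing) : Prop where
  one_mem : ∃ i, R.basis i = 1
  structure_nonneg : ∀ i j k, 0 ≤ R.basis.repr (R.basis i * R.basis j) k
  bar_mul : ∀ x y, R.bar (x * y) = R.bar y * R.bar x
  bar_bar : ∀ x, R.bar (R.bar x) = x
  bar_basis : ∀ i, ∃ j, R.bar (R.basis i) = R.basis j
  coeff_symm : ∀ i j m, R.basis.repr (R.basis i * R.basis j) m
    = R.basis.repr (R.basis m * R.bar (R.basis j)) i

/-! ### Tabular algebras over `ℤ[v, v⁻¹]`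

The ring `ℤ[T;T⁻¹]` of Laurent polynomials is `ℤ[v, v⁻¹]`, and `T k` is `v ^ k`. -/

/-- The data `(Λ, Γ, B, M, C, *)` (no axioms yet). -/
structure TableDatum (A : Type) [NonUnitalNonAssocRing A] [Module ℤ[T;T⁻¹] A] where
  Λ : Type
  [poset : PartialOrder Λ]
  table : Λ → BasedRing
  M : Λ → Type
  C : (l : Λ) → M l → (table l).ι → M l → A
  star : A →ₗ[ℤ[T;T⁻¹]] A

attribute [instance] TableDatum.poset

namespace TableDatum

variable {A : Type} [NonUnitalNonAssocRing A] [Module ℤ[T;T⁻¹] A] (D : TableDatum A)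

/-- The disjoint union of the sets `M(λ) × B(λ) × M(λ)`. -/
def Index : Type := (l : D.Λ) × D.M l × (D.table l).ι × D.M l

/-- The map `C` on the disjoint union. -/
def elt (X : D.Index) : A := D.C X.1 X.2.1 X.2.2.1 X.2.2.2

/-- The linear extension `g ↦ C_{S,T}^g` to `g ∈ ℤ[v, v⁻¹] ⊗ Γ(λ)`. -/
def CExt (l : D.Λ) (S U : D.M l) : (ℤ[T;T⁻¹] ⊗[ℤ] (D.table l).Γ) →ₗ[ℤ[T;T⁻¹]] A :=
  (Algebra.TensorProduct.basis ℤ[T;T⁻¹] (D.table l).basis).constr ℤ[T;T⁻¹]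
    (fun b => D.C l S b U)

/-- The submodule `A(< λ)`. -/
def lower (l : D.Λ) : Submodule ℤ[T;T⁻¹] A :=
  Submodule.span ℤ[T;T⁻¹] {x | ∃ X : D.Index, X.1 < l ∧ x = D.elt X}

/-- `A` is an associative `ℤ[v, v⁻¹]`-algebra, and `D` satisfies the axioms (A1), (A2), (A3) of a
table datum. -/
structure IsTabular : Prop where
  -- `A` is an associative algebra over `ℤ[v, v⁻¹]`
  mul_assoc : ∀ x y z : A, x * y * z = x * (y * z)
  smul_mul : ∀ (c : ℤ[T;T⁻¹]) (x y : A), (c • x) * y = c • (x * y)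
  mul_smul : ∀ (c : ℤ[T;T⁻¹]) (x y : A), x * (c • y) = c • (x * y)
  -- (A1)
  finite_poset : Finite D.Λ
  table_normalized : ∀ l, (D.table l).IsNormalizedTableAlgebra
  finite_tableaux : ∀ l, Finite (D.M l)
  elt_injective : Function.Injective D.elt
  elt_linearIndependent : LinearIndependent ℤ[T;T⁻¹] D.elt
  elt_span : ⊤ ≤ Submodule.span ℤ[T;T⁻¹] (Set.range D.elt)
  idempotents : ∃ E : Set A, E ⊆ Set.range D.elt ∧ (∀ e ∈ E, e * e = e) ∧
    (∀ e ∈ E, ∀ f ∈ E, e ≠ f → e * f = 0) ∧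
    Submodule.span ℤ[T;T⁻¹] {x | ∃ e ∈ E, ∃ f ∈ E, ∃ y, x = e * y * f} = ⊤ ∧
    ∀ X, ∃ e ∈ E, ∃ f ∈ E, D.elt X = e * D.elt X * f
  -- (A2)
  star_mul : ∀ x y, D.star (x * y) = D.star y * D.star x
  star_star : ∀ x, D.star (D.star x) = x
  star_elt : ∀ (l : D.Λ) (S U : D.M l) (b : (D.table l).ι),
    D.star (D.C l S b U) = D.CExt l U S (1 ⊗ₜ (D.table l).bar ((D.table l).basis b))
  -- (A3)
  mul_elt : ∀ (l : D.Λ) (a : A), ∃ r : D.M l → D.M l → ℤ[T;T⁻¹] ⊗[ℤ] (D.table l).Γ,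
    ∀ (g : (D.table l).Γ) (S U : D.M l),
      a * D.CExt l S U (1 ⊗ₜ g) - ∑ᶠ S' : D.M l, D.CExt l S' U (r S' S * (1 ⊗ₜ g)) ∈ D.lower l

variable {D}

/-- The tabular basis. -/
def IsTabular.basis (h : D.IsTabular) : Module.Basis D.Index ℤ[T;T⁻¹] A :=
  Module.Basis.mk h.elt_linearIndependent h.elt_span

/-- The structure constants `g_{X,Y,Z}` of the tabular basis. -/
def IsTabular.structureConst (h : D.IsTabular) (X Y Z : D.Index) : ℤ[T;T⁻¹] :=
  h.basis.repr (D.elt X * D.elt Y) Z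

variable (D)

/-- The table datum `D` and the linear map `τ` make `A` a tabular algebra with trace:
axioms (A1) to (A5), with `τ` as the tabular trace. The function `a` is the **a**-function, which
is unique, since `a Z` is the maximum of the degrees of the `g_{X,Y,Z}`. A Laurent polynomial lies
in `v⁻¹ ℤ[v⁻¹]` if and only if its degree is negative. -/
structure IsTabularWithTrace (τ : A →ₗ[ℤ[T;T⁻¹]] ℤ[T;T⁻¹]) : Prop where
  isTabular : D.IsTabular
  trace_star : ∀ x, τ (D.star x) = τ x
  trace_mul_comm : ∀ x y, τ (x * y) = τ (y * x)
  exists_aFunction : ∃ a : D.Index → ℤ,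
    (∀ Z, IsGreatest {d : WithBot ℤ | ∃ X Y, d = (isTabular.structureConst X Y Z).degree}
      (a Z : WithBot ℤ)) ∧
    -- (A4)
    (∀ K K' K'' : D.Index, (isTabular.structureConst K K' K'').degree = (a K'' : WithBot ℤ) ↔
      ∃ (l : D.Λ) (S U V : D.M l) (b b' b'' : (D.table l).ι),
        K = ⟨l, S, b, U⟩ ∧ K' = ⟨l, U, b', V⟩ ∧ K'' = ⟨l, S, b'', V⟩ ∧
        (D.table l).basis.repr ((D.table l).basis b * (D.table l).basis b') b'' ≠ 0) ∧
    (∀ (l : D.Λ) (S U V : D.M l) (e : (D.table l).ι), (D.table l).basis e = 1 →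
      (isTabular.structureConst ⟨l, S, e, U⟩ ⟨l, U, e, V⟩ ⟨l, S, e, V⟩).coeff
        (a ⟨l, S, e, V⟩) = 1) ∧
    -- (A5)
    (∀ (l : D.Λ) (S : D.M l) (b : (D.table l).ι) (U : D.M l),
      ((S = U ∧ (D.table l).basis b = 1) →
        (τ ((T (a ⟨l, S, b, U⟩) : ℤ[T;T⁻¹]) • D.elt ⟨l, S, b, U⟩) - 1).degree < 0) ∧
      (¬ (S = U ∧ (D.table l).basis b = 1) →
        (τ ((T (a ⟨l, S, b, U⟩) : ℤ[T;T⁻¹]) • D.elt ⟨l, S, b, U⟩)).degree < 0))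

end TableDatum

/-! ### Affine diagrams -/

/-- The nodes `ℤ × {0, 1}` of the strip: `top i = (i, 1)` and `bot i = (i, 0)`. -/
inductive Node where
  | top (i : ℤ) : Node
  | bot (i : ℤ) : Node

namespace Node

/-- Horizontal translation. -/
def shift (k : ℤ) : Node → Node
  | top i => top (i + k)
  | bot i => bot (i + k)

/-- The order in which one meets the nodes when walking along the boundary of the strip, first
along the top row from left to right, then along the bottom row from right to left. -/
def Before : Node → Node → Prop
  | top i, top j => i < j
  | top _, bot _ => True
  | bot _, top _ => False
  | bot i, bot j => j < i

/-- Top-bottom reflection. -/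
def flip : Node → Node
  | top i => bot i
  | bot i => top i

end Node

/-- An affine `n`-diagram up to isotopy. The edges between nodes form a shift-invariant perfect
matching `pair` of the nodes such that no two edges are interlaced on the boundary of the strip
(equivalently, such that the edges can be drawn in the strip without intersections); `bands` is the
number of infinite horizontal lines, which can be present only if no edge joins the two rows. -/
@[ext]
structure AffineDiagram (n : ℕ) where
  pair : Node → Node
  pair_pair : ∀ x, pair (pair x) = x
  pair_ne : ∀ x, pair x ≠ x
  pair_shift : ∀ x, pair (x.shift n) = (pair x).shift n
  noncrossing : ∀ x y, ¬ (x.Before y ∧ y.Before (pair x) ∧ (pair x).Before (pair y))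
  bands : ℕ
  bands_eq_zero : ∀ i j, pair (Node.top i) = Node.bot j → bands = 0

namespace AffineDiagram

variable {n : ℕ}

/-- Top-bottom reflection of a diagram. -/
def flip (D : AffineDiagram n) : AffineDiagram n where
  pair x := (D.pair x.flip).flip
  pair_pair x := by
    have h : ∀ y : Node, y.flip.flip = y := by rintro (_ | _) <;> rfl
    rw [h, D.pair_pair, h]
  pair_ne x hx := by
    have h : ∀ y : Node, y.flip.flip = y := by rintro (_ | _) <;> rfl
    apply D.pair_ne x.flip
    rw [← h (D.pair x.flip), hx]
  pair_shift x := by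
    have h : ∀ (k : ℤ) (y : Node), (y.shift k).flip = y.flip.shift k := by
      rintro k (_ | _) <;> rfl
    rw [h, D.pair_shift, h]
  noncrossing x y := by
    have h : ∀ y : Node, y.flip.flip = y := by rintro (_ | _) <;> rfl
    have hb : ∀ u v : Node, u.Before v → v.flip.Before u.flip := by
      rintro (_ | _) (_ | _) huv <;> simp_all [Node.Before, Node.flip]
    rintro ⟨h1, h2, h3⟩
    have h1' := hb _ _ h1
    have h2' := hb _ _ h2
    have h3' := hb _ _ h3
    rw [h] at h2' h3'
    rw [h] at h3'
    refine D.noncrossing (D.pair y.flip) (D.pair x.flip) ⟨h3', ?_, ?_⟩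
    · rwa [D.pair_pair]
    · rwa [D.pair_pair, D.pair_pair]
  bands := D.bands
  bands_eq_zero i j hij := by
    have h : D.pair (Node.bot i) = Node.top j := by
      have h2 : ∀ y : Node, y.flip.flip = y := by rintro (_ | _) <;> rfl
      have h3 : (D.pair (Node.bot i)).flip = Node.bot j := hij
      rw [← h2 (D.pair (Node.bot i)), h3]
      rfl
    apply D.bands_eq_zero j i
    rw [← h, D.pair_pair]

/-! #### Stacking diagrams -/

/-- The position of a node when the strip is placed between the heights `m` and `m + 1`. -/
def place (m : ℤ) : Node → ℤ × ℤ
  | Node.top i => (i, m + 1)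
  | Node.bot i => (i, m)

/-- `P` and `Q` are joined by an edge of `A` or of `B`, when `A` is placed on top of `B`. The rows
of nodes have heights `2` (top of `A`), `1` (bottom of `A` and top of `B`), `0` (bottom of `B`). -/
def StackStep (A B : AffineDiagram n) (P Q : ℤ × ℤ) : Prop :=
  (∃ x, P = place 1 x ∧ Q = place 1 (A.pair x)) ∨ (∃ x, P = place 0 x ∧ Q = place 0 (B.pair x))

/-- `P` and `Q` lie on the same curve of the stacked diagram. -/
def StackConn (A B : AffineDiagram n) : ℤ × ℤ → ℤ × ℤ → Prop :=
  Relation.ReflTransGen (StackStep A B)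

/-- The outer nodes of the stacked diagram. -/
def outer : Node → ℤ × ℤ
  | Node.top i => (i, 2)
  | Node.bot i => (i, 0)

/-- The node `i` of the middle row lies on a closed curve of the cylinder. -/
def InnerLoop (A B : AffineDiagram n) (i : ℤ) : Prop := ∀ x, ¬ StackConn A B (i, 1) (outer x)

/-- All nodes of the middle row that lie on the same curve of the cylinder as the node `i`. -/
def innerCurve (A B : AffineDiagram n) (i : ℤ) : Set ℤ :=
  {j | ∃ p : ℤ, StackConn A B (i, 1) (j + p * n, 1)}

/-- The closed curve through the middle node `i` is contractible in the cylinder. -/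
def InnerContractible (A B : AffineDiagram n) (i : ℤ) : Prop :=
  ∀ p : ℤ, StackConn A B (i, 1) (i + p * n, 1) → p = 0

/-- The number of contractible loops formed when `A` is placed on top of `B`. -/
def stackLoops (A B : AffineDiagram n) : ℕ :=
  Set.ncard {L : Set ℤ | ∃ i, L = innerCurve A B i ∧ InnerLoop A B i ∧ InnerContractible A B i}

/-- The number of non-contractible loops (infinite bands) formed when `A` is placed on top of `B`,
apart from those already present in `A` and `B`. -/
def stackBands (A B : AffineDiagram n) : ℕ :=
  Set.ncard {L : Set ℤ | ∃ i, L = innerCurve A B i ∧ InnerLoop A B i ∧ ¬ InnerContractible A B i}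

/-- `E` is the diagram that results from placing `A` on top of `B` and removing the contractible
loops. -/
def IsComposite (A B E : AffineDiagram n) : Prop :=
  (∀ x, StackConn A B (outer x) (outer (E.pair x))) ∧
    E.bands = A.bands + B.bands + stackBands A B

end AffineDiagram

/-! ### The diagram algebra -/

/-- The free `ℤ[v, v⁻¹]`-module on the affine `n`-diagrams. -/
def DiagramAlgebra (n : ℕ) : Type := AffineDiagram n →₀ ℤ[T;T⁻¹]

namespace DiagramAlgebra

open AffineDiagram

variable {n : ℕ}

instance : AddCommGroup (DiagramAlgebra n) :=
  inferInstanceAs (AddCommGroup (AffineDiagram n →₀ ℤ[T;T⁻¹]))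

instance : Module ℤ[T;T⁻¹] (DiagramAlgebra n) :=
  inferInstanceAs (Module ℤ[T;T⁻¹] (AffineDiagram n →₀ ℤ[T;T⁻¹]))

/-- A diagram as an element of the algebra. -/
def of (D : AffineDiagram n) : DiagramAlgebra n :=
  (Finsupp.single D 1 : AffineDiagram n →₀ ℤ[T;T⁻¹])

/-- The linear map defined on the algebra by its values on the diagrams. -/
def lift {N : Type} [AddCommGroup N] [Module ℤ[T;T⁻¹] N] (f : AffineDiagram n → N) :
    DiagramAlgebra n →ₗ[ℤ[T;T⁻¹]] N :=
  (Finsupp.linearCombination ℤ[T;T⁻¹] f : (AffineDiagram n →₀ ℤ[T;T⁻¹]) →ₗ[ℤ[T;T⁻¹]] N)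

/-- The quantum integer `[2] = v + v⁻¹`. -/
def quantumTwo : ℤ[T;T⁻¹] := T 1 + T (-1)

open Classical in
/-- The product `[2]^x E` of two diagrams `A` and `B`, where `x` is the number of contractible loops
formed and `E` is the diagram that remains. -/
def diagramMul (A B : AffineDiagram n) : DiagramAlgebra n :=
  if h : ∃ E, IsComposite A B E then quantumTwo ^ stackLoops A B • of h.choose else 0

/-- The bilinear extension of the product of diagrams. -/
def mulMap : DiagramAlgebra n →ₗ[ℤ[T;T⁻¹]] DiagramAlgebra n →ₗ[ℤ[T;T⁻¹]] DiagramAlgebra n :=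
  lift fun A => lift fun B => diagramMul A B

instance : NonUnitalNonAssocRing (DiagramAlgebra n) where
  mul x y := mulMap x y
  left_distrib x y z := map_add (mulMap x) y z
  right_distrib x y z := by
    change mulMap (x + y) z = mulMap x z + mulMap y z
    rw [map_add, LinearMap.add_apply]
  zero_mul x := by
    change mulMap 0 x = 0
    rw [map_zero, LinearMap.zero_apply]
  mul_zero x := map_zero (mulMap x)

end DiagramAlgebra

/-! ### Annular involutions, winding numbers and triples -/

/-- The integer in `{1, …, n}` labelled by `i`. -/
def label {n : ℕ} (i : Fin n) : ℤ := (i : ℤ) + 1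

/-- Annular involutions of `{1, …, n}`. -/
def IsAnnular {n : ℕ} (S : Equiv.Perm (Fin n)) : Prop :=
  (∀ i, S (S i) = i) ∧
    ∀ i j, i < j → S i = j →
      S '' Set.Icc i j = Set.Icc i j ∧
        (Set.Icc i j ∩ {k | S k = k} = ∅ ∨ {k | S k = k} ⊆ Set.Icc i j)

/-- Annular involutions of `{1, …, n}` with `t` fixed points (used for `t > 0`). -/
def AnnularInvolution (n t : ℕ) : Type :=
  {S : Equiv.Perm (Fin n) // IsAnnular S ∧ {k | S k = k}.ncard = t}

/-- The set `I(0)`: involutions of `ℤ` without fixed points that commute with the translation by `n`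
and preserve the interval between any two points that they exchange. -/
def AffineInvolution (n : ℕ) : Type :=
  {S : Equiv.Perm ℤ // (∀ k, S (S k) = k) ∧ (∀ k, S k ≠ k) ∧ (∀ k, S (k + n) = S k + n) ∧
    ∀ i j, i < j → S i = j → S '' Set.Icc i j = Set.Icc i j}

namespace AffineDiagram

variable {n : ℕ}

/-- `S` exchanges `i ≠ j` if and only if `i` and `j` are joined in the top circle. -/
def TopIs (D : AffineDiagram n) (S : Equiv.Perm (Fin n)) : Prop :=
  ∀ i j, i ≠ j →
    (S i = j ↔ ∃ p : ℤ, D.pair (Node.top (label i)) = Node.top (label j + p * n))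

/-- `S` exchanges `i ≠ j` if and only if `i` and `j` are joined in the bottom circle. -/
def BotIs (D : AffineDiagram n) (S : Equiv.Perm (Fin n)) : Prop :=
  ∀ i j, i ≠ j →
    (S i = j ↔ ∃ p : ℤ, D.pair (Node.bot (label i)) = Node.bot (label j + p * n))

/-- The winding number: the number of edges that cross the seam `x = 1/2` of the strip from a bottom
node `j` on its left to a top node `i` on its right, minus the number of those that cross it from
a bottom node `j` on its right to a top node `i` on its left. -/
def winding (D : AffineDiagram n) : ℤ :=
  ({w : ℤ × ℤ | w.2 ≤ 0 ∧ 1 ≤ w.1 ∧ D.pair (Node.bot w.2) = Node.top w.1}.ncard : ℤ)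
    - ({w : ℤ × ℤ | w.1 ≤ 0 ∧ 1 ≤ w.2 ∧ D.pair (Node.bot w.2) = Node.top w.1}.ncard : ℤ)

/-- `D` is the diagram `[S₁, S₂, w]` with `t > 0` propagating edges. -/
def IsTriple {t : ℕ} (S₁ S₂ : AnnularInvolution n t) (w : ℤ) (D : AffineDiagram n) : Prop :=
  D.TopIs S₁.1 ∧ D.BotIs S₂.1 ∧ D.winding = w

/-- `D` is the diagram `[S₁, S₂, k]` without propagating edges and with `k` infinite bands. -/
def IsTripleZero (S₁ S₂ : AffineInvolution n) (k : ℕ) (D : AffineDiagram n) : Prop :=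
  (∀ i, D.pair (Node.top i) = Node.top (S₁.1 i)) ∧
    (∀ i, D.pair (Node.bot i) = Node.bot (S₂.1 i)) ∧ D.bands = k

end AffineDiagram

namespace DiagramAlgebra

open AffineDiagram

variable {n : ℕ}

open Classical in
/-- The basis element `[S₁, S₂, w]` for `t > 0`. -/
def triple {t : ℕ} (S₁ S₂ : AnnularInvolution n t) (w : ℤ) : DiagramAlgebra n :=
  if h : ∃ D, IsTriple S₁ S₂ w D then of h.choose else 0

open Classical in
/-- The basis element `[S₁, S₂, k]` without propagating edges. -/
def tripleZero (S₁ S₂ : AffineInvolution n) (k : ℕ) : DiagramAlgebra n :=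
  if h : ∃ D, IsTripleZero S₁ S₂ k D then of h.choose else 0

/-- `f(S₁, S₂)` for a Laurent polynomial `f`: substitute `[S₁, S₂, k]` for `v ^ k`. -/
def substLaurent {t : ℕ} (S₁ S₂ : AnnularInvolution n t) (f : ℤ[T;T⁻¹]) : DiagramAlgebra n :=
  f.coeff.sum fun k c => c • triple S₁ S₂ k

/-- `f(S₁, S₂)` for a polynomial `f`: substitute `[S₁, S₂, k]` for `x ^ k`. -/
def substPoly (S₁ S₂ : AffineInvolution n) (f : ℤ[X]) : DiagramAlgebra n :=
  f.sum fun k c => c • tripleZero S₁ S₂ k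

end DiagramAlgebra

/-! ### The two table algebras -/

/-- The polynomials `U_0 = 1`, `U_1 = x`, `U_{k+1} = x U_k - U_{k-1}`. -/
def chebyshevU : ℕ → ℤ[X]
  | 0 => 1
  | 1 => X
  | k + 2 => X * chebyshevU (k + 1) - chebyshevU k

theorem chebyshevU_monic (k : ℕ) : (chebyshevU k).Monic ∧ (chebyshevU k).natDegree = k := by
  induction k using Nat.twoStepInduction with
  | zero => exact ⟨monic_one, natDegree_one⟩
  | one => exact ⟨monic_X, natDegree_X⟩
  | more k ih0 ih1 =>
    have hm : (X * chebyshevU (k + 1)).Monic := monic_X.mul ih1.1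
    have hd : (X * chebyshevU (k + 1)).natDegree = k + 2 := by
      rw [monic_X.natDegree_mul ih1.1, natDegree_X, ih1.2]
      ring
    have hlt : (chebyshevU k).degree < (X * chebyshevU (k + 1)).degree := by
      rw [degree_eq_natDegree ih0.1.ne_zero, degree_eq_natDegree hm.ne_zero, ih0.2, hd]
      exact_mod_cast (by omega : k < k + 2)
    refine ⟨hm.sub_of_left hlt, ?_⟩
    change (X * chebyshevU (k + 1) - chebyshevU k).natDegree = k + 2
    rw [natDegree_eq_of_degree_eq (degree_sub_eq_left_of_degree_lt hlt), hd]

/-- The polynomials `U_k` as a sequence with `deg U_k = k`. -/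
def chebyshevSequence : Polynomial.Sequence ℤ where
  elems' := chebyshevU
  degree_eq' k := by
    rw [degree_eq_natDegree (chebyshevU_monic k).1.ne_zero, (chebyshevU_monic k).2]

/-- The basis `{U_k : k ≥ 0}` of `ℤ[x]`. -/
def chebyshevBasis : Module.Basis ℕ ℤ ℤ[X] :=
  chebyshevSequence.basis fun k => by
    rw [show chebyshevSequence k = chebyshevU k from rfl, (chebyshevU_monic k).1.leadingCoeff]
    exact isUnit_one

/-- `ℤ[x]` with the basis `{U_k}` and the trivial involution. -/
def chebyshevTable : BasedRing where
  Γ := ℤ[X]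
  ι := ℕ
  basis := chebyshevBasis
  bar := LinearMap.id

/-- `ℤ[v, v⁻¹]` with the basis `{v ^ k}` and the involution `v ↦ v⁻¹`. -/
def laurentTable : BasedRing where
  Γ := ℤ[T;T⁻¹]
  ι := ℤ
  basis := AddMonoidAlgebra.basis ℤ ℤ
  bar := (LaurentPolynomial.invert (R := ℤ)).toLinearMap

/-! ### The table datum -/

/-- The table algebra of the cell `i`. -/
def cellTable : ℕ → BasedRing
  | 0 => chebyshevTable
  | _ + 1 => laurentTable

/-- The tableaux of the cell `i`. -/
def cellTableaux (n : ℕ) : ℕ → Type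
  | 0 => AffineInvolution n
  | t + 1 => AnnularInvolution n (t + 1)

/-- The map `C` on the cell `i`. -/
def cellMap (n : ℕ) : (i : ℕ) → cellTableaux n i → (cellTable i).ι → cellTableaux n i →
    DiagramAlgebra n
  | 0, S₁, k, S₂ => DiagramAlgebra.substPoly (n := n) S₁ S₂ (chebyshevTable.basis k)
  | t + 1, S₁, k, S₂ =>
    DiagramAlgebra.substLaurent (n := n) (t := t + 1) S₁ S₂ (laurentTable.basis k)

/-- The table datum of the diagram algebra. -/
def diagramTableDatum (n : ℕ) : TableDatum (DiagramAlgebra n) where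
  Λ := {i : ℕ // ∃ r : ℕ, i + 2 * r = n}
  table l := cellTable l.1
  M l := cellTableaux n l.1
  C l := cellMap n l.1
  star := DiagramAlgebra.lift fun D => DiagramAlgebra.of D.flip

/-! ### The torus trace -/

/-- The isotopy class of a family of `loops` disjoint non-contractible simple closed curves on the
torus. Such curves are parallel, and the class is determined by their number and by the subgroup
`homology` of `ℤ × ℤ = H₁(torus)` that they generate; `(1, 0)` is the class of the circle of the
cylinder, and `(0, 1)` is the class of the seam. -/
structure TorusTraceDiagram where
  loops : ℕ
  homology : AddSubgroup (ℤ × ℤ)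

namespace AffineDiagram

variable {n : ℕ}

/-- The diagram obtained from `D` on the torus, lifted to the universal cover: one copy of the strip
lies between any two heights `m` and `m + 1`. The points `P` and `Q` are joined by an edge. -/
def TorusStep (D : AffineDiagram n) (P Q : ℤ × ℤ) : Prop :=
  ∃ (m : ℤ) (x : Node), P = place m x ∧ Q = place m (D.pair x)

/-- `P` and `Q` lie on the same curve of the universal cover. -/
def TorusConn (D : AffineDiagram n) : ℤ × ℤ → ℤ × ℤ → Prop :=
  Relation.ReflTransGen (TorusStep D)

/-- All nodes that lie on the same curve of the torus as the node `i`. -/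
def torusCurve (D : AffineDiagram n) (i : ℤ) : Set ℤ :=
  {j | ∃ p q : ℤ, TorusConn D (i, 0) (j + p * n, q)}

/-- The homology classes of the closed paths along the curve of the torus through the node `i`. -/
def torusPeriods (D : AffineDiagram n) (i : ℤ) : Set (ℤ × ℤ) :=
  {w | TorusConn D (i, 0) (i + w.1 * n, w.2)}

/-- The number of contractible loops on the torus. -/
def torusContractible (D : AffineDiagram n) : ℕ :=
  Set.ncard {L : Set ℤ | ∃ i, L = torusCurve D i ∧ torusPeriods D i ⊆ {0}}

/-- The number of non-contractible loops on the torus, including the bands of `D`. -/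
def torusNoncontractible (D : AffineDiagram n) : ℕ :=
  Set.ncard {L : Set ℤ | ∃ i, L = torusCurve D i ∧ ¬ torusPeriods D i ⊆ {0}} + D.bands

/-- The trace diagram that remains on the torus after the removal of the contractible loops. -/
def torusDiagram (D : AffineDiagram n) : TorusTraceDiagram where
  loops := torusNoncontractible D
  homology := AddSubgroup.closure
    ({w | ∃ i, w ∈ torusPeriods D i} ∪ {w | 0 < D.bands ∧ w = (1, 0)})

end AffineDiagram

open Classical in
/-- The function `f` on trace diagrams. If the loops can be moved off the seam (in particular, if
there are none), the value is `v ^ (t - n)`, where `t` is the number of loops. If there are `k > 0`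
exceptional loops, which are those parallel to the circle of the cylinder, it is
`v ^ (-n) κ(1, x ^ k)`, where `κ(1, ·)` is the coefficient of `U_0 = 1` in the basis `{U_k}`.
Otherwise all isotopic families cross the seam, and the value is `0`. -/
def traceWeight (n : ℕ) (E : TorusTraceDiagram) : ℤ[T;T⁻¹] :=
  if E.homology ≤ AddSubgroup.zmultiples (0, 1) then T ((E.loops : ℤ) - n)
  else if E.homology ≤ AddSubgroup.zmultiples (1, 0) then
    T (-(n : ℤ)) * LaurentPolynomial.C (chebyshevBasis.repr (X ^ E.loops) 0)
  else 0

/-- The trace `τ` on the diagram algebra: `τ(D) = [2]^x f(E)`, where `x` is the number of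
contractible loops removed on the torus and `E` is the trace diagram that remains. -/
def torusTrace (n : ℕ) : DiagramAlgebra n →ₗ[ℤ[T;T⁻¹]] ℤ[T;T⁻¹] :=
  DiagramAlgebra.lift fun D =>
    DiagramAlgebra.quantumTwo ^ D.torusContractible * traceWeight n D.torusDiagram

end

/-! Every notion in the theorem is a count of curves in a stack of diagrams. A curve in a stack of
two is an orbit of two involutions of the plane, given by the edges of the upper and of the lower
diagram. An orbit that reaches the boundary is therefore finite and has exactly two ends
(`stackConn_outer`). The parity of the points of such a curve, counted along the rows, takes the
place of the Jordan curve theorem. It shows that the composite is again planar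
(`compPair_noncrossing`) and that a curve from top to bottom excludes essential loops
(`innerContractible_of_through`).

Associativity and the symmetry of the trace follow from one principle: replacing two adjacent layers
by their composite keeps the connectivity of the remaining rows and removes exactly the closed
curves inside the pair (`Refines.conn_iff`, `PlaneStack.ncard_curves_of_refines`). Three layers on a
cylinder, contracted in two ways, give associativity. Two layers on a torus, cut open at either row,
give the trace identity.

A row of a diagram is a periodic noncrossing involution of `ℤ`, whose fixed points are the ends of
the through edges. If there are fixed points, they decide on which side of the cylinder each arc
runs, so the involution is the same as an annular involution of `{1, …, n}`; if there are none, the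
involution of the line itself is the tableau. When the fixed points are numbered consecutively, the
through edges become a translation of `ℤ`, and its amount is the winding number. A diagram is thus
determined by two tableaux and an index (`existsUnique_isCell`). When the facing tableaux agree, the
product within a cell with `l` through edges is that of the table algebra times `[2]^((n-l)/2)`
(`cellHom_mul`).

The degree statements are counting arguments. A contractible loop passes through at least two
residues of the middle row, and none of them is the end of a through edge. Hence a factor with `l`
through edges allows at most `(n-l)/2` loops, and if the bound is attained for both factors, their
facing rows agree (`botMap_eq_topMap_of_stackLoops`). So the **a**-function is `(n-l)/2`, and (A4)
reduces to the table algebra. On the torus, `c` contractible and `w` essential curves through nodes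
satisfy `2c + w ≤ n`, and `w ≤ l` if the curves can be moved off the seam. Both bounds are sharp
only for a symmetric diagram with vertical through edges (`eq_of_le_two_mul_torus`). This gives
(A5); in the cell 0 the bands enter through a polynomial factor, and the coefficient of `U_0`
detects the unit. The algebra is infinite because winding numbers are unbounded. -/

noncomputable section

/-! ### The Chebyshev and Laurent bases. -/

section

/-! ### The two table algebras are normalized -/

theorem chebyshevBasis_apply (k : ℕ) : chebyshevBasis k = chebyshevU k := by
  simp only [chebyshevBasis, Polynomial.Sequence.basis_eq_self]; rfl

/-- The Clebsch–Gordan recursion: the top term splits off and both indices drop by one. Iterating it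
writes a product as a sum of distinct `U_k`, which is the source of the nonnegativity and of the
orthonormality below. -/
theorem chebyshevU_mul (i j : ℕ) :
    chebyshevU (i + 1) * chebyshevU (j + 1) =
      chebyshevU (i + j + 2) + chebyshevU i * chebyshevU j := by
  induction j using Nat.twoStepInduction with
  | zero => simp [chebyshevU]; ring
  | one =>
    simp only [chebyshevU]; ring
  | more j h0 h1 =>
    have e : ∀ k, chebyshevU (k + 2) = X * chebyshevU (k + 1) - chebyshevU k := fun k => rfl
    rw [show i + (j + 2) + 2 = (i + j + 2) + 2 by ring, e (i + j + 2), e (j + 1), mul_sub,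
      show i + j + 2 + 1 = i + (j + 1) + 2 by ring, mul_left_comm, h1, h0, e j]
    ring

theorem chebyshevBasis_repr_chebyshevU (k m : ℕ) :
    chebyshevBasis.repr (chebyshevU k) m = if k = m then 1 else 0 := by
  rw [← chebyshevBasis_apply, Module.Basis.repr_self, Finsupp.single_apply]

theorem chebyshevBasis_repr_mul_nonneg (i j m : ℕ) :
    0 ≤ chebyshevBasis.repr (chebyshevU i * chebyshevU j) m := by
  induction i generalizing j with
  | zero =>
    rw [show chebyshevU 0 = 1 from rfl, one_mul, chebyshevBasis_repr_chebyshevU]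
    split_ifs <;> simp
  | succ i ih =>
    cases j with
    | zero =>
      rw [show chebyshevU 0 = 1 from rfl, mul_one, chebyshevBasis_repr_chebyshevU]
      split_ifs <;> simp
    | succ j =>
      rw [chebyshevU_mul, map_add, Finsupp.add_apply, chebyshevBasis_repr_chebyshevU]
      have := ih j
      split_ifs <;> linarith

/-- Orthonormality for the form that sends `f, g` to the coefficient of `U_0` in `f g`. It expresses
every coefficient through this form, so the axiom `coeff_symm` becomes a matter of commutativity. -/
theorem chebyshevBasis_repr_mul_zero (i j : ℕ) :
    chebyshevBasis.repr (chebyshevU i * chebyshevU j) 0 = if i = j then 1 else 0 := by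
  induction i generalizing j with
  | zero =>
    rw [show chebyshevU 0 = 1 from rfl, one_mul, chebyshevBasis_repr_chebyshevU]
    simp [eq_comm]
  | succ i ih =>
    cases j with
    | zero =>
      rw [show chebyshevU 0 = 1 from rfl, mul_one, chebyshevBasis_repr_chebyshevU]
    | succ j =>
      rw [chebyshevU_mul, map_add, Finsupp.add_apply, chebyshevBasis_repr_chebyshevU, ih]
      simp

/-- The coefficient of `U_m` in `f` is the coefficient of `U_0` in `f U_m`. -/
theorem chebyshevBasis_repr_eq (f : ℤ[X]) (m : ℕ) :
    chebyshevBasis.repr f m = chebyshevBasis.repr (f * chebyshevU m) 0 := by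
  have h : chebyshevBasis.coord m =
      (chebyshevBasis.coord 0) ∘ₗ (LinearMap.mulRight ℤ (chebyshevU m)) := by
    refine chebyshevBasis.ext fun i => ?_
    simp only [Module.Basis.coord_apply, LinearMap.comp_apply, LinearMap.mulRight_apply,
      chebyshevBasis_apply, chebyshevBasis_repr_mul_zero, chebyshevBasis_repr_chebyshevU]
  exact LinearMap.congr_fun h f

/-- Both sides are the coefficient of `U_0` in the product of all three basis elements. -/
theorem chebyshevBasis_coeff_symm (i j m : ℕ) :
    chebyshevBasis.repr (chebyshevBasis i * chebyshevBasis j) m =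
      chebyshevBasis.repr (chebyshevBasis m * chebyshevBasis j) i := by
  rw [chebyshevBasis_repr_eq, chebyshevBasis_repr_eq _ i]
  simp only [chebyshevBasis_apply]
  congr 2
  ring

theorem chebyshevTable_isNormalized : chebyshevTable.IsNormalizedTableAlgebra where
  one_mem := ⟨(0 : ℕ), chebyshevBasis_apply 0⟩
  structure_nonneg := by
    have h (i j m : ℕ) : 0 ≤ chebyshevBasis.repr (chebyshevBasis i * chebyshevBasis j) m := by
      rw [chebyshevBasis_apply, chebyshevBasis_apply]
      exact chebyshevBasis_repr_mul_nonneg i j m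
    exact h
  bar_mul := fun (x y : ℤ[X]) => mul_comm x y
  bar_bar x := rfl
  bar_basis i := ⟨i, rfl⟩
  coeff_symm := chebyshevBasis_coeff_symm

/-- The basis of powers of `v`. -/
def laurentBasis : Module.Basis ℤ ℤ ℤ[T;T⁻¹] := AddMonoidAlgebra.basis ℤ ℤ

theorem laurentBasis_apply (k : ℤ) : laurentBasis k = T k := by
  simp [laurentBasis, AddMonoidAlgebra.basis]

theorem laurentBasis_repr_T (k m : ℤ) : laurentBasis.repr (T k) m = if k = m then 1 else 0 := by
  rw [← laurentBasis_apply, Module.Basis.repr_self, Finsupp.single_apply]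

theorem invert_laurentBasis (i : ℤ) : LaurentPolynomial.invert (laurentBasis i) =
    laurentBasis (-i) := by
  rw [laurentBasis_apply, laurentBasis_apply, LaurentPolynomial.invert_T]

theorem laurentTable_isNormalized : laurentTable.IsNormalizedTableAlgebra where
  one_mem := ⟨(0 : ℤ), (laurentBasis_apply 0).trans T_zero⟩
  structure_nonneg := by
    have h (i j m : ℤ) : 0 ≤ laurentBasis.repr (laurentBasis i * laurentBasis j) m := by
      rw [laurentBasis_apply, laurentBasis_apply, ← T_add, laurentBasis_repr_T]
      split_ifs <;> simp
    exact h
  bar_mul := fun (x y : ℤ[T;T⁻¹]) =>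
    (map_mul LaurentPolynomial.invert x y).trans (mul_comm _ _)
  bar_bar := fun (x : ℤ[T;T⁻¹]) => LaurentPolynomial.involutive_invert x
  bar_basis := fun (i : ℤ) => ⟨(-i : ℤ), invert_laurentBasis i⟩
  coeff_symm := by
    have h (i j m : ℤ) : laurentBasis.repr (laurentBasis i * laurentBasis j) m =
        laurentBasis.repr (laurentBasis m * LaurentPolynomial.invert (laurentBasis j)) i := by
      rw [invert_laurentBasis]
      simp only [laurentBasis_apply, ← T_add, laurentBasis_repr_T]
      exact if_congr (by omega) rfl rfl
    exact h

theorem cellTable_isNormalized (i : ℕ) : (cellTable i).IsNormalizedTableAlgebra := by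
  cases i with
  | zero => exact chebyshevTable_isNormalized
  | succ i => exact laurentTable_isNormalized

end

/-! ### Finite orbits of a dihedral action. -/

section

/-! ### Orbits of two involutions -/

section Dihedral

variable {V : Type} {α β : Equiv.Perm V}

/-- Connectivity under two involutions. -/
abbrev InvConn (α β : Equiv.Perm V) : V → V → Prop :=
  Relation.ReflTransGen fun P Q => Q = α P ∨ Q = β P

/-- The dihedral relation: conjugation by either involution inverts `α * β`. -/
theorem involution_zpow (hα : α * α = 1) (hβ : β * β = 1) (k : ℤ) :
    α * (α * β) ^ k = (α * β) ^ (-k) * α := by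
  have e1 : α⁻¹ = α := inv_eq_of_mul_eq_one_left hα
  have e2 : β⁻¹ = β := inv_eq_of_mul_eq_one_left hβ
  have h : α * (α * β) * α⁻¹ = (α * β)⁻¹ := by
    rw [mul_inv_rev, e1, e2, ← mul_assoc, hα, one_mul]
  rw [zpow_neg, ← inv_zpow, ← h, conj_zpow, inv_mul_cancel_right]

theorem involution_zpow' (hα : α * α = 1) (hβ : β * β = 1) (k : ℤ) :
    β * (α * β) ^ k = (α * β) ^ (-k) * β := by
  have e1 : α⁻¹ = α := inv_eq_of_mul_eq_one_left hα
  have e2 : β⁻¹ = β := inv_eq_of_mul_eq_one_left hβ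
  have h : β * (α * β) * β⁻¹ = (α * β)⁻¹ := by
    rw [mul_inv_rev, e1, e2, mul_assoc, mul_assoc α, hβ, mul_one]
  rw [zpow_neg, ← inv_zpow, ← h, conj_zpow, inv_mul_cancel_right]

variable (hα : α * α = 1) (hβ : β * β = 1) {x : V} (hx : β x = x)
include hα hβ hx

/-- Since `β` fixes `x`, both involutions act on the points `(α β)^k x` by reflecting the exponent,
`k ↦ 1 - k` and `k ↦ -k`. The orbit of `x` is therefore the orbit of the single permutation `α * β`,
and fixed points are found by solving congruences. -/
theorem involution_apply_zpow (k : ℤ) : α (((α * β) ^ k) x) = ((α * β) ^ (1 - k)) x := by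
  rw [← Equiv.Perm.mul_apply, involution_zpow hα hβ, Equiv.Perm.mul_apply,
    show α x = (α * β) x by rw [Equiv.Perm.mul_apply, hx], ← Equiv.Perm.mul_apply,
    ← zpow_add_one]
  congr 2
  ring

theorem involution_apply_zpow' (k : ℤ) : β (((α * β) ^ k) x) = ((α * β) ^ (-k)) x := by
  rw [← Equiv.Perm.mul_apply, involution_zpow' hα hβ, Equiv.Perm.mul_apply, hx]

theorem InvConn.exists_zpow {z : V} (h : InvConn α β x z) : ∃ k : ℤ, z = ((α * β) ^ k) x := by
  induction h with
  | refl => exact ⟨0, rfl⟩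
  | tail _ h ih =>
    obtain ⟨k, rfl⟩ := ih
    rcases h with rfl | rfl
    · exact ⟨_, involution_apply_zpow hα hβ hx k⟩
    · exact ⟨_, involution_apply_zpow' hα hβ hx k⟩

omit hα hβ hx in
theorem invConn_pow (k : ℕ) : InvConn α β x (((α * β) ^ k) x) := by
  induction k with
  | zero => exact .refl
  | succ k ih =>
    rw [pow_succ', Equiv.Perm.mul_apply]
    exact (ih.tail (Or.inr rfl)).tail (Or.inl rfl)

theorem InvConn.finite {N : ℕ} (hN : 0 < N) (hper : ((α * β) ^ N) x = x) :
    {z | InvConn α β x z}.Finite := by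
  refine Set.Finite.subset ((Set.finite_Icc (0 : ℤ) N).image fun k => ((α * β) ^ k) x) ?_
  rintro z hz
  obtain ⟨k, rfl⟩ := InvConn.exists_zpow hα hβ hx hz
  refine ⟨k % N, ⟨Int.emod_nonneg _ (by omega), (Int.emod_lt_of_pos _ (by omega)).le⟩, ?_⟩
  have h2 : ((α * β) ^ ((N : ℤ) * (k / N))) x = x := by
    rw [zpow_mul, zpow_natCast]
    exact Equiv.Perm.zpow_apply_eq_self_of_apply_eq_self hper _
  conv_rhs => rw [← Int.emod_add_mul_ediv k N, zpow_add, Equiv.Perm.mul_apply, h2]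

/-- A finite orbit that contains a point fixed by exactly one of the two involutions
contains exactly one other such point. -/
theorem InvConn.exists_end {N : ℕ} (hN : 0 < N) (hper : ((α * β) ^ N) x = x) (hx' : α x ≠ x) :
    ∃ y, InvConn α β x y ∧ y ≠ x ∧ (α y = y ∨ β y = y) ∧
      ∀ z, InvConn α β x z → (α z = z ∨ β z = z) → z = x ∨ z = y := by
  set d := Function.minimalPeriod (fun y => (α * β) • y) x with hd
  have key : ∀ k : ℤ, ((α * β) ^ k) x = x ↔ (d : ℤ) ∣ k := fun k =>
    MulAction.zpow_smul_eq_iff_minimalPeriod_dvd (a := α * β) (b := x) (n := k)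
  have key2 : ∀ k m : ℤ, ((α * β) ^ k) x = ((α * β) ^ m) x ↔ (d : ℤ) ∣ k - m := by
    intro k m
    rw [← key, sub_eq_neg_add, zpow_add, Equiv.Perm.mul_apply, zpow_neg, Equiv.Perm.inv_eq_iff_eq]
  have hd0 : 0 < d := by
    rcases Nat.eq_zero_or_pos d with h0 | h0
    · have := (key N).1 (by rw [zpow_natCast]; exact hper)
      rw [h0] at this
      simp at this
      omega
    · exact h0
  have hd1 : d ≠ 1 := by
    intro h1
    have := (key 1).2 (by rw [h1]; simp)
    rw [zpow_one, Equiv.Perm.mul_apply, hx] at this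
    exact hx' this
  have hαk : ∀ k : ℤ, α (((α * β) ^ k) x) = ((α * β) ^ k) x ↔ (d : ℤ) ∣ 1 - 2 * k := by
    intro k
    rw [involution_apply_zpow hα hβ hx, key2]
    ring_nf
  have hβk : ∀ k : ℤ, β (((α * β) ^ k) x) = ((α * β) ^ k) x ↔ (d : ℤ) ∣ 2 * k := by
    intro k
    rw [involution_apply_zpow' hα hβ hx, key2, ← Int.dvd_neg]
    ring_nf
  -- The exponents of fixed points solve `d ∣ 2k` or `d ∣ 1 - 2k`. Modulo the period `d` there are
  -- two solutions, `0` and `(d + 1) / 2`. The second one is fixed by `β` if `d` is even and by `α`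
  -- if `d` is odd.
  refine ⟨((α * β) ^ ((d + 1) / 2)) x, invConn_pow _, ?_, ?_, ?_⟩
  · intro h
    rw [← zpow_natCast, key] at h
    have := Nat.le_of_dvd (by omega) (Int.natCast_dvd_natCast.1 h)
    omega
  · rw [← zpow_natCast, hαk, hβk]
    rcases Nat.even_or_odd' d with ⟨c, hc | hc⟩
    · right
      rw [hc, show (2 * c + 1) / 2 = c by omega]
      push_cast
      exact dvd_refl _
    · left
      rw [hc, show (2 * c + 1 + 1) / 2 = c + 1 by omega]
      push_cast
      exact ⟨-1, by ring⟩
  · intro z hz hfix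
    obtain ⟨k, rfl⟩ := InvConn.exists_zpow hα hβ hx hz
    rw [hαk, hβk] at hfix
    rw [key, ← zpow_natCast, key2]
    rcases Nat.even_or_odd' d with ⟨c, hc | hc⟩
    · rw [hc, show (2 * c + 1) / 2 = c by omega]
      rw [hc] at hfix
      push_cast at hfix ⊢
      rcases hfix with ⟨e, he⟩ | ⟨e, he⟩
      · have h1 : (2 : ℤ) ∣ 1 := ⟨c * e + k, by linarith⟩
        omega
      · have he' : k = c * e := by linarith
        rcases Int.even_or_odd' e with ⟨f, hf | hf⟩
        · left; exact ⟨f, by rw [he', hf]; ring⟩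
        · right; exact ⟨f, by rw [he', hf]; ring⟩
    · rw [hc, show (2 * c + 1 + 1) / 2 = c + 1 by omega]
      rw [hc] at hfix
      push_cast at hfix ⊢
      rcases hfix with ⟨e, he⟩ | ⟨e, he⟩
      · right
        rcases Int.even_or_odd' e with ⟨f, hf | hf⟩
        · exfalso
          rw [hf] at he
          have h1 : (2 : ℤ) ∣ 1 := ⟨(2 * c + 1) * f + k, by linarith⟩
          omega
        · refine ⟨-(f + 1), ?_⟩
          rw [hf] at he
          linarith
      · left
        rcases Int.even_or_odd' e with ⟨f, hf | hf⟩
        · exact ⟨f, by rw [hf] at he; linarith⟩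
        · exfalso
          rw [hf] at he
          have h1 : (2 : ℤ) ∣ 1 := ⟨k - (2 * c + 1) * f - c, by linarith⟩
          omega

/-- If the orbit of `x` is finite modulo a free translation commuting with both involutions,
then it is finite. -/
theorem InvConn.exists_period {τ : Equiv.Perm V} (hατ : Commute α τ) (hβτ : Commute β τ)
    (hfree : ∀ p : ℤ, (τ ^ p) x = x → p = 0) {N : ℕ} {p : ℤ}
    (h : ((α * β) ^ N) x = (τ ^ p) x) : ((α * β) ^ N) x = x := by
  -- Applying `β` to the hypothesis reverses the exponent but not the translation. Going `N` steps
  -- back and `N` steps forward thus moves `x` by `τ ^ (2p)`, and freeness gives `p = 0`.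
  have h1 : ((α * β) ^ (-(N : ℤ))) x = (τ ^ p) x := by
    rw [← involution_apply_zpow' hα hβ hx, zpow_natCast, h, ← Equiv.Perm.mul_apply,
      (hβτ.zpow_right p).eq, Equiv.Perm.mul_apply, hx]
  have hc : Commute ((α * β) ^ N) (τ ^ p) := ((hατ.mul_left hβτ).pow_left N).zpow_right p
  have h2 : (τ ^ (p + p)) x = x := by
    rw [zpow_add, Equiv.Perm.mul_apply, ← h, ← Equiv.Perm.mul_apply, ← hc.eq,
      Equiv.Perm.mul_apply, ← h1, ← zpow_natCast, ← Equiv.Perm.mul_apply, ← zpow_add]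
    simp
  have h3 : p = 0 := by
    have := hfree _ h2
    omega
  rw [h, h3]
  simp

end Dihedral

end

/-! ### Stacks of diagrams, and the ends of their curves. -/

section

namespace AffineDiagram

variable {n : ℕ}

/-! ### Stacks of layers -/

theorem pair_injective (D : AffineDiagram n) : Function.Injective D.pair :=
  Function.LeftInverse.injective D.pair_pair

theorem _root_.Node.shift_shift (a b : ℤ) (x : Node) : (x.shift a).shift b = x.shift (a + b) := by
  cases x <;> simp [Node.shift, add_assoc]

theorem _root_.Node.shift_zero (x : Node) : x.shift 0 = x := by
  cases x <;> simp [Node.shift]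

theorem pair_shift_mul (D : AffineDiagram n) (p : ℤ) (x : Node) :
    D.pair (x.shift (p * n)) = (D.pair x).shift (p * n) := by
  induction p using Int.induction_on with
  | zero => simp [Node.shift_zero]
  | succ p ih => rw [add_mul, one_mul, ← Node.shift_shift, pair_shift, ih, Node.shift_shift]
  | pred p ih =>
    have h : ∀ y : Node, y.shift (-(p : ℤ) * n) = (y.shift ((-(p : ℤ) - 1) * n)).shift n := by
      intro y
      rw [Node.shift_shift]
      congr 1
      ring
    rw [h, pair_shift, h] at ih
    have h3 : ∀ y z : Node, y.shift n = z.shift n → y = z := by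
      rintro (_ | _) (_ | _) h <;> simp [Node.shift] at h ⊢ <;> exact h
    exact h3 _ _ ih

theorem place_shift (m k : ℤ) (x : Node) :
    place m (x.shift k) = ((place m x).1 + k, (place m x).2) := by
  cases x <;> rfl

theorem place_injective (m : ℤ) : Function.Injective (place m) := by
  rintro (i | i) (j | j) h <;> simp [place] at h ⊢ <;> exact h

/-- The point `P` and a point of height between `m` and `m + 1` are joined by an edge of one of
the layers `F`. -/
def LStep (F : ℤ → Option (AffineDiagram n)) (P Q : ℤ × ℤ) : Prop :=
  ∃ m D x, F m = some D ∧ P = place m x ∧ Q = place m (D.pair x)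

/-- Connectivity in a stack of layers. -/
def LConn (F : ℤ → Option (AffineDiagram n)) : ℤ × ℤ → ℤ × ℤ → Prop :=
  Relation.ReflTransGen (LStep F)

/-- The layers of the stack of `A` on top of `B`. -/
def stackLayers (A B : AffineDiagram n) (m : ℤ) : Option (AffineDiagram n) :=
  if m = 1 then some A else if m = 0 then some B else none

theorem stackStep_eq (A B : AffineDiagram n) : StackStep A B = LStep (stackLayers A B) := by
  ext P Q
  constructor
  · rintro (⟨x, rfl, rfl⟩ | ⟨x, rfl, rfl⟩)
    · exact ⟨1, A, x, by simp [stackLayers], rfl, rfl⟩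
    · exact ⟨0, B, x, by simp [stackLayers], rfl, rfl⟩
  · rintro ⟨m, D, x, hF, rfl, rfl⟩
    unfold stackLayers at hF
    split_ifs at hF with h1 h0
    · cases hF
      subst h1
      exact Or.inl ⟨x, rfl, rfl⟩
    · cases hF
      subst h0
      exact Or.inr ⟨x, rfl, rfl⟩

theorem stackConn_eq (A B : AffineDiagram n) : StackConn A B = LConn (stackLayers A B) := by
  rw [StackConn, stackStep_eq, LConn]

theorem torusConn_eq (D : AffineDiagram n) : TorusConn D = LConn fun _ => some D := by
  rw [TorusConn, LConn]
  congr 1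
  ext P Q
  constructor
  · rintro ⟨m, x, rfl, rfl⟩
    exact ⟨m, D, x, rfl, rfl, rfl⟩
  · rintro ⟨m, D', x, h, rfl, rfl⟩
    cases h
    exact ⟨m, x, rfl, rfl⟩

theorem LStep.symm {F : ℤ → Option (AffineDiagram n)} {P Q : ℤ × ℤ} (h : LStep F P Q) :
    LStep F Q P := by
  obtain ⟨m, D, x, hF, rfl, rfl⟩ := h
  exact ⟨m, D, D.pair x, hF, rfl, by rw [D.pair_pair]⟩

theorem LConn.symm {F : ℤ → Option (AffineDiagram n)} {P Q : ℤ × ℤ} (h : LConn F P Q) :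
    LConn F Q P := by
  induction h with
  | refl => exact .refl
  | tail _ h ih => exact Relation.ReflTransGen.head h.symm ih

theorem LConn.trans {F : ℤ → Option (AffineDiagram n)} {P Q R : ℤ × ℤ} (h : LConn F P Q)
    (h' : LConn F Q R) : LConn F P R := Relation.ReflTransGen.trans h h'

theorem LConn.shift {F : ℤ → Option (AffineDiagram n)} {P Q : ℤ × ℤ} (h : LConn F P Q) (p : ℤ) :
    LConn F (P.1 + p * n, P.2) (Q.1 + p * n, Q.2) := by
  induction h with
  | refl => exact .refl
  | tail _ h ih =>
    refine ih.tail ?_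
    obtain ⟨m, D, x, hF, rfl, rfl⟩ := h
    refine ⟨m, D, x.shift (p * n), hF, (place_shift _ _ _).symm, ?_⟩
    rw [pair_shift_mul, place_shift]

theorem StackConn.symm {A B : AffineDiagram n} {P Q : ℤ × ℤ} (h : StackConn A B P Q) :
    StackConn A B Q P := by
  rw [stackConn_eq] at h ⊢
  exact LConn.symm h

theorem StackConn.trans {A B : AffineDiagram n} {P Q R : ℤ × ℤ} (h : StackConn A B P Q)
    (h' : StackConn A B Q R) : StackConn A B P R := Relation.ReflTransGen.trans h h'

theorem StackConn.shift {A B : AffineDiagram n} {P Q : ℤ × ℤ} (h : StackConn A B P Q) (p : ℤ) :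
    StackConn A B (P.1 + p * n, P.2) (Q.1 + p * n, Q.2) := by
  rw [stackConn_eq] at h ⊢
  exact LConn.shift h p

theorem stackConn_upper (A B : AffineDiagram n) (x : Node) :
    StackConn A B (place 1 x) (place 1 (A.pair x)) := .single (Or.inl ⟨x, rfl, rfl⟩)

theorem stackConn_lower (A B : AffineDiagram n) (x : Node) :
    StackConn A B (place 0 x) (place 0 (B.pair x)) := .single (Or.inr ⟨x, rfl, rfl⟩)

theorem outer_injective : Function.Injective outer := by
  rintro (i | i) (j | j) h <;> simp [outer] at h ⊢ <;> exact h

theorem outer_shift (k : ℤ) (x : Node) :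
    outer (x.shift k) = ((outer x).1 + k, (outer x).2) := by
  cases x <;> rfl

/-! ### The ends of the curves in a stack of two diagrams -/

/-- The involution of the plane given by the edges of `D` between the heights `m` and `m + 1`. -/
def layerMap (D : AffineDiagram n) (m : ℤ) (P : ℤ × ℤ) : ℤ × ℤ :=
  if P.2 = m + 1 then place m (D.pair (Node.top P.1))
  else if P.2 = m then place m (D.pair (Node.bot P.1)) else P

theorem layerMap_place (D : AffineDiagram n) (m : ℤ) (x : Node) :
    layerMap D m (place m x) = place m (D.pair x) := by
  cases x <;> simp [layerMap, place]

theorem layerMap_of_ne (D : AffineDiagram n) {m : ℤ} {P : ℤ × ℤ} (h1 : P.2 ≠ m + 1)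
    (h2 : P.2 ≠ m) : layerMap D m P = P := by
  simp [layerMap, h1, h2]

theorem eq_place_or (m : ℤ) (P : ℤ × ℤ) :
    (∃ x, P = place m x) ∨ (P.2 ≠ m + 1 ∧ P.2 ≠ m) := by
  by_cases h1 : P.2 = m + 1
  · exact Or.inl ⟨Node.top P.1, by simp [place, ← h1]⟩
  by_cases h2 : P.2 = m
  · exact Or.inl ⟨Node.bot P.1, by simp [place, ← h2]⟩
  exact Or.inr ⟨h1, h2⟩

theorem layerMap_layerMap (D : AffineDiagram n) (m : ℤ) (P : ℤ × ℤ) :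
    layerMap D m (layerMap D m P) = P := by
  rcases eq_place_or m P with ⟨x, rfl⟩ | ⟨h1, h2⟩
  · rw [layerMap_place, layerMap_place, D.pair_pair]
  · rw [layerMap_of_ne D h1 h2, layerMap_of_ne D h1 h2]

theorem layerMap_ne (D : AffineDiagram n) (m : ℤ) (x : Node) :
    layerMap D m (place m x) ≠ place m x := by
  rw [layerMap_place]
  exact fun h => D.pair_ne x (place_injective m h)

/-- The involution `layerMap` as a permutation. -/
def layerPerm (D : AffineDiagram n) (m : ℤ) : Equiv.Perm (ℤ × ℤ) :=
  ⟨layerMap D m, layerMap D m, layerMap_layerMap D m, layerMap_layerMap D m⟩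

theorem layerPerm_apply (D : AffineDiagram n) (m : ℤ) (P : ℤ × ℤ) :
    layerPerm D m P = layerMap D m P := rfl

theorem layerPerm_mul_self (D : AffineDiagram n) (m : ℤ) : layerPerm D m * layerPerm D m = 1 :=
  Equiv.ext (layerMap_layerMap D m)

/-- Translation by `n` as a permutation. -/
def translate (n : ℕ) : Equiv.Perm (ℤ × ℤ) :=
  (Equiv.addRight (n : ℤ)).prodCongr (Equiv.refl ℤ)

theorem translate_zpow (p : ℤ) (P : ℤ × ℤ) :
    ((translate n) ^ p) P = (P.1 + p * n, P.2) := by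
  have h : ∀ (k : ℕ) (P : ℤ × ℤ), ((translate n) ^ k) P = (P.1 + k * n, P.2) := by
    intro k
    induction k with
    | zero => simp
    | succ k ih =>
      intro P
      rw [pow_succ, Equiv.Perm.mul_apply, ih]
      simp [translate]
      ring
  rcases Int.eq_nat_or_neg p with ⟨k, rfl | rfl⟩
  · rw [zpow_natCast, h]
  · rw [zpow_neg, Equiv.Perm.inv_eq_iff_eq, zpow_natCast, h]
    simp

theorem layerPerm_commute (D : AffineDiagram n) (m : ℤ) :
    Commute (layerPerm D m) (translate n) := by
  refine Equiv.ext fun P => ?_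
  rw [Equiv.Perm.mul_apply, Equiv.Perm.mul_apply]
  have h := fun P => translate_zpow (n := n) 1 P
  simp only [zpow_one, one_mul] at h
  rw [h, h, layerPerm_apply, layerPerm_apply]
  rcases eq_place_or m P with ⟨x, rfl⟩ | ⟨h1, h2⟩
  · rw [← place_shift, layerMap_place, layerMap_place, D.pair_shift, place_shift]
  · rw [layerMap_of_ne D h1 h2]
    exact layerMap_of_ne D h1 h2

/-- Each matching, extended by the identity outside its layer, is an involution of the plane. In the
heights 0 to 2 the points fixed by one of the two are exactly the outer nodes, so the results on
dihedral orbits describe the ends of curves. -/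
theorem stackConn_iff_invConn (A B : AffineDiagram n) (P Q : ℤ × ℤ) :
    StackConn A B P Q ↔ InvConn (layerPerm A 1) (layerPerm B 0) P Q := by
  constructor
  · refine fun h => Relation.ReflTransGen.mono ?_ _ _ h
    rintro _ _ (⟨x, rfl, rfl⟩ | ⟨x, rfl, rfl⟩)
    · exact Or.inl (layerMap_place A 1 x).symm
    · exact Or.inr (layerMap_place B 0 x).symm
  · intro h
    induction h with
    | refl => exact .refl
    | @tail b c _ h ih =>
      refine ih.trans ?_
      rcases h with rfl | rfl
      · rcases eq_place_or 1 b with ⟨x, rfl⟩ | ⟨h1, h2⟩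
        · rw [layerPerm_apply, layerMap_place]
          exact stackConn_upper A B x
        · rw [layerPerm_apply, layerMap_of_ne A h1 h2]
          exact .refl
      · rcases eq_place_or 0 b with ⟨x, rfl⟩ | ⟨h1, h2⟩
        · rw [layerPerm_apply, layerMap_place]
          exact stackConn_lower A B x
        · rw [layerPerm_apply, layerMap_of_ne B h1 h2]
          exact .refl

theorem StackConn.height {A B : AffineDiagram n} {P Q : ℤ × ℤ} (h : StackConn A B P Q)
    (hP : 0 ≤ P.2 ∧ P.2 ≤ 2) : 0 ≤ Q.2 ∧ Q.2 ≤ 2 := by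
  induction h with
  | refl => exact hP
  | tail _ h _ =>
    rcases h with ⟨x, -, rfl⟩ | ⟨x, -, rfl⟩
    · cases A.pair x <;> simp [place]
    · cases B.pair x <;> simp [place]

theorem outer_height (x : Node) : 0 ≤ (outer x).2 ∧ (outer x).2 ≤ 2 := by
  cases x <;> simp [outer]

/-- The curve through an outer node is finite and has exactly one other end. -/
theorem stackConn_outer (hn : 0 < n) (A B : AffineDiagram n) (x : Node) :
    {P | StackConn A B (outer x) P}.Finite ∧
      ∃ y, StackConn A B (outer x) (outer y) ∧ y ≠ x ∧
        ∀ z, StackConn A B (outer x) (outer z) → z = x ∨ z = y := by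
  -- Stated for abstract involutions because the roles alternate: `β` fixes the starting node, so it
  -- is the lower layer for a top node and the upper layer for a bottom node.
  have main : ∀ (α β : Equiv.Perm (ℤ × ℤ)), α * α = 1 → β * β = 1 → Commute α (translate n) →
      Commute β (translate n) → (∀ P Q, StackConn A B P Q ↔ InvConn α β P Q) →
      β (outer x) = outer x → α (outer x) ≠ outer x →
      (∀ P : ℤ × ℤ, 0 ≤ P.2 ∧ P.2 ≤ 2 → ((α P = P ∨ β P = P) ↔ ∃ y, P = outer y)) →
      {P | StackConn A B (outer x) P}.Finite ∧
      ∃ y, StackConn A B (outer x) (outer y) ∧ y ≠ x ∧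
        ∀ z, StackConn A B (outer x) (outer z) → z = x ∨ z = y := by
    intro α β hα hβ hατ hβτ hconn hβx hαx hfix
    -- Up to translation there are only finitely many positions, so two powers agree up to a
    -- translation; `InvConn.exists_period` shows that this translation is trivial.
    have hper : ∃ N : ℕ, 0 < N ∧ ((α * β) ^ N) (outer x) = outer x := by
      have hfin : (Set.Ico (0 : ℤ) n ×ˢ Set.Icc (0 : ℤ) 2).Finite :=
        (Set.finite_Ico _ _).prod (Set.finite_Icc _ _)
      obtain ⟨a, -, b, -, hab, he⟩ := Set.infinite_univ.exists_ne_map_eq_of_mapsTo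
        (f := fun k : ℕ => (((((α * β) ^ k) (outer x)).1 % n,
          (((α * β) ^ k) (outer x)).2) : ℤ × ℤ)) (t := Set.Ico (0 : ℤ) n ×ˢ Set.Icc (0 : ℤ) 2)
        (fun k _ => by
          have h := ((hconn _ _).2 (invConn_pow (α := α) (β := β) (x := outer x) k)).height
            (outer_height x)
          exact ⟨⟨Int.emod_nonneg _ (by omega), Int.emod_lt_of_pos _ (by omega)⟩, h⟩) hfin
      have gen : ∀ a b : ℕ, a < b →
          ((((α * β) ^ a) (outer x)).1 % n = (((α * β) ^ b) (outer x)).1 % n ∧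
          (((α * β) ^ a) (outer x)).2 = (((α * β) ^ b) (outer x)).2) →
          ∃ N : ℕ, 0 < N ∧ ((α * β) ^ N) (outer x) = outer x := by
        rintro a b hab ⟨h1, h2⟩
        refine ⟨b - a, by omega, ?_⟩
        obtain ⟨p, hp⟩ := Int.ModEq.dvd h1
        have hc : Commute ((α * β) ^ a) (translate n ^ p) :=
          ((hατ.mul_left hβτ).pow_left a).zpow_right p
        refine InvConn.exists_period (p := p) hα hβ hβx hατ hβτ ?_ ?_
        · intro p hp
          rw [translate_zpow] at hp
          have := (Prod.ext_iff.1 hp).1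
          simp only [add_eq_left, mul_eq_zero] at this
          omega
        · apply ((α * β) ^ a).injective
          rw [← Equiv.Perm.mul_apply, ← pow_add, ← Equiv.Perm.mul_apply, hc.eq,
            Equiv.Perm.mul_apply, translate_zpow, show a + (b - a) = b by omega]
          refine Prod.ext ?_ h2.symm
          rw [mul_comm] at hp
          linarith
      have he' := Prod.ext_iff.1 he
      rcases lt_or_gt_of_ne hab with h | h
      · exact gen a b h he'
      · exact gen b a h ⟨he'.1.symm, he'.2.symm⟩
    obtain ⟨N, hN, hNx⟩ := hper
    constructor
    · simp only [hconn]
      exact InvConn.finite hα hβ hβx hN hNx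
    · obtain ⟨y, hy, hyx, hyfix, hu⟩ := InvConn.exists_end hα hβ hβx hN hNx hαx
      obtain ⟨y, rfl⟩ := (hfix y (((hconn _ _).2 hy).height (outer_height x))).1 hyfix
      refine ⟨y, (hconn _ _).2 hy, fun h => hyx (by rw [h]), fun z hz => ?_⟩
      rcases hu (outer z) ((hconn _ _).1 hz) ((hfix _ (outer_height z)).2 ⟨z, rfl⟩) with h | h
      · exact Or.inl (outer_injective h)
      · exact Or.inr (outer_injective h)
  have hA : ∀ P : ℤ × ℤ, 0 ≤ P.2 ∧ P.2 ≤ 2 → (layerPerm A 1 P = P ↔ P.2 = 0) := by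
    intro P hP
    rw [layerPerm_apply]
    rcases eq_place_or 1 P with ⟨x, rfl⟩ | ⟨h1, h2⟩
    · refine iff_of_false (layerMap_ne A 1 x) ?_
      cases x <;> simp [place]
    · exact iff_of_true (layerMap_of_ne A h1 h2) (by omega)
  have hB : ∀ P : ℤ × ℤ, 0 ≤ P.2 ∧ P.2 ≤ 2 → (layerPerm B 0 P = P ↔ P.2 = 2) := by
    intro P hP
    rw [layerPerm_apply]
    rcases eq_place_or 0 P with ⟨x, rfl⟩ | ⟨h1, h2⟩
    · refine iff_of_false (layerMap_ne B 0 x) ?_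
      cases x <;> simp [place]
    · exact iff_of_true (layerMap_of_ne B h1 h2) (by omega)
  have hO : ∀ P : ℤ × ℤ, (P.2 = 0 ∨ P.2 = 2) ↔ ∃ y, P = outer y := by
    rintro ⟨i, h⟩
    constructor
    · rintro (h | h)
      · exact ⟨Node.bot i, Prod.ext rfl h⟩
      · exact ⟨Node.top i, Prod.ext rfl h⟩
    · rintro ⟨_ | _, h⟩ <;> rw [h] <;> simp [outer]
  cases hx : x with
  | top i =>
    rw [← hx]
    refine main (layerPerm A 1) (layerPerm B 0) (layerPerm_mul_self _ _) (layerPerm_mul_self _ _)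
      (layerPerm_commute _ _) (layerPerm_commute _ _) (stackConn_iff_invConn A B) ?_ ?_ ?_
    · rw [hB _ (outer_height x), hx]; rfl
    · rw [Ne, hA _ (outer_height x), hx]; simp [outer]
    · intro P hP
      rw [hA P hP, hB P hP, hO]
  | bot i =>
    rw [← hx]
    refine main (layerPerm B 0) (layerPerm A 1) (layerPerm_mul_self _ _) (layerPerm_mul_self _ _)
      (layerPerm_commute _ _) (layerPerm_commute _ _) ?_ ?_ ?_ ?_
    · intro P Q
      rw [stackConn_iff_invConn]
      simp only [InvConn, or_comm]
    · rw [hA _ (outer_height x), hx]; rfl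
    · rw [Ne, hB _ (outer_height x), hx]; simp [outer]
    · intro P hP
      rw [hA P hP, hB P hP, or_comm, hO]

end AffineDiagram

end

/-! ### Parity, planarity and the existence of composites. -/

section

namespace Node

theorem Before.trans {x y z : Node} (h : x.Before y) (h' : y.Before z) : x.Before z := by
  cases x <;> cases y <;> cases z <;> simp_all [Before] <;> omega

theorem not_before_self (x : Node) : ¬ x.Before x := by
  cases x <;> simp [Before]

theorem before_trichotomy (x y : Node) : x.Before y ∨ x = y ∨ y.Before x := by
  cases x <;> cases y <;> simp [Before] <;> omega

end Node

namespace AffineDiagram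

variable {n : ℕ}

/-! ### Planarity of stacked diagrams -/

theorem even_card_of_involution {V : Type} [DecidableEq V] (S : Finset V) (f : V → V)
    (hf : ∀ x ∈ S, f (f x) = x) (hS : ∀ x ∈ S, f x ∈ S) (hne : ∀ x ∈ S, f x ≠ x) :
    Even S.card := by
  have h : ∑ _x ∈ S, (1 : ZMod 2) = 0 :=
    Finset.sum_involution (fun x _ => f x) (fun x _ => by decide) (fun x hx _ => hne x hx)
      (fun x hx => hS x hx) (fun x hx => hf x hx)
  rw [Finset.sum_const, nsmul_one] at h
  rwa [← ZMod.natCast_eq_zero_iff_even]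

open Classical in
/-- The number of points of `P` that precede `z` on the boundary of the layer at height `m`. -/
def countBefore (P : Finset (ℤ × ℤ)) (m : ℤ) (z : Node) : ℕ :=
  {Q ∈ P | ∃ u, Q = place m u ∧ u.Before z}.card

open Classical in
theorem countBefore_top (P : Finset (ℤ × ℤ)) {m m' : ℤ} (hm : m' = m + 1) (i : ℤ) :
    countBefore P m (Node.top i) = {Q ∈ P | Q.2 = m' ∧ Q.1 < i}.card := by
  subst hm
  unfold countBefore
  congr 1
  ext ⟨a, b⟩
  simp only [Finset.mem_filter, and_congr_right_iff]
  intro _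
  constructor
  · rintro ⟨_ | _, h, h'⟩
    · cases h; exact ⟨rfl, h'⟩
    · exact h'.elim
  · rintro ⟨rfl, h⟩
    exact ⟨Node.top a, rfl, h⟩

open Classical in
theorem countBefore_bot (P : Finset (ℤ × ℤ)) {m m' : ℤ} (hm : m' = m + 1) (i : ℤ) :
    countBefore P m (Node.bot i) =
      {Q ∈ P | Q.2 = m'}.card + {Q ∈ P | Q.2 = m ∧ i < Q.1}.card := by
  subst hm
  unfold countBefore
  rw [← Finset.card_union_of_disjoint, ← Finset.filter_or]
  · congr 1
    ext ⟨a, b⟩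
    simp only [Finset.mem_filter, and_congr_right_iff]
    intro _
    constructor
    · rintro ⟨_ | _, h, h'⟩
      · cases h; exact Or.inl rfl
      · cases h; exact Or.inr ⟨rfl, h'⟩
    · rintro (rfl | ⟨rfl, h⟩)
      · exact ⟨Node.top a, rfl, trivial⟩
      · exact ⟨Node.bot a, rfl, h⟩
  · rw [Finset.disjoint_filter]
    rintro ⟨a, b⟩ _ h1 ⟨h2, _⟩
    simp only at h1 h2
    omega

/-- No edge separates the points of a closed set, up to parity. -/
theorem countBefore_pair (D : AffineDiagram n) (m : ℤ) (P : Finset (ℤ × ℤ))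
    (hP : ∀ u, place m u ∈ P → place m (D.pair u) ∈ P) (z : Node) (hz : place m z ∉ P) :
    countBefore P m z % 2 = countBefore P m (D.pair z) % 2 := by
  classical
  have key : ∀ z, place m z ∉ P → z.Before (D.pair z) →
      countBefore P m z % 2 = countBefore P m (D.pair z) % 2 := by
    intro z hz hlt
    -- By noncrossing, the partner of a point strictly between `z` and `D.pair z` lies there as
    -- well. The points of `P` in this range are therefore paired off.
    have hev : Even {Q ∈ P | ∃ u, Q = place m u ∧ z.Before u ∧ u.Before (D.pair z)}.card := by
      refine even_card_of_involution _ (layerMap D m) (fun x _ => layerMap_layerMap D m x) ?_ ?_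
      · intro Q hQ
        obtain ⟨hQ, u, rfl, h1, h2⟩ := Finset.mem_filter.1 hQ
        rw [layerMap_place]
        refine Finset.mem_filter.2 ⟨hP u hQ, _, rfl, ?_, ?_⟩
        · rcases Node.before_trichotomy z (D.pair u) with h | h | h
          · exact h
          · rw [h, D.pair_pair] at h2
            exact (Node.not_before_self _ h2).elim
          · exact (D.noncrossing _ _ ⟨h, by rwa [D.pair_pair], by rwa [D.pair_pair]⟩).elim
        · rcases Node.before_trichotomy (D.pair u) (D.pair z) with h | h | h
          · exact h
          · rw [D.pair_injective h] at h1
            exact (Node.not_before_self _ h1).elim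
          · exact (D.noncrossing _ _ ⟨h1, h2, h⟩).elim
      · intro Q hQ
        obtain ⟨hQ, u, rfl, h1, h2⟩ := Finset.mem_filter.1 hQ
        exact layerMap_ne D m u
    have hsum : countBefore P m (D.pair z) = countBefore P m z +
        {Q ∈ P | ∃ u, Q = place m u ∧ z.Before u ∧ u.Before (D.pair z)}.card := by
      unfold countBefore
      rw [← Finset.card_union_of_disjoint, ← Finset.filter_or]
      · congr 1
        apply Finset.filter_congr
        intro Q hQ
        constructor
        · rintro ⟨u, rfl, h⟩
          rcases Node.before_trichotomy u z with h' | rfl | h'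
          · exact Or.inl ⟨u, rfl, h'⟩
          · exact (hz hQ).elim
          · exact Or.inr ⟨u, rfl, h', h⟩
        · rintro (⟨u, rfl, h⟩ | ⟨u, rfl, _, h⟩)
          · exact ⟨u, rfl, h.trans hlt⟩
          · exact ⟨u, rfl, h⟩
      · rw [Finset.disjoint_filter]
        rintro Q _ ⟨u, rfl, h⟩ ⟨u', he, h', -⟩
        rw [place_injective m he] at h
        exact Node.not_before_self _ (h.trans h')
    rw [hsum]
    obtain ⟨c, hc⟩ := hev
    omega
  rcases Node.before_trichotomy z (D.pair z) with h | h | h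
  · exact key z hz h
  · rw [← h]
  · have := key (D.pair z) (fun h => hz (by have := hP _ h; rwa [D.pair_pair] at this))
      (by rwa [D.pair_pair])
    rw [D.pair_pair] at this
    exact this.symm

open Classical in
/-- A colouring of the points of a stack of two diagrams. -/
def colour (P : Finset (ℤ × ℤ)) (Q : ℤ × ℤ) : ℕ :=
  if Q.2 = 2 then {R ∈ P | R.2 = 2 ∧ R.1 < Q.1}.card
  else {R ∈ P | R.2 = 2}.card + {R ∈ P | R.2 = Q.2 ∧ Q.1 < R.1}.card

open Classical in
theorem colour_two (P : Finset (ℤ × ℤ)) (i : ℤ) :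
    colour P (i, 2) = {R ∈ P | R.2 = 2 ∧ R.1 < i}.card := if_pos rfl

open Classical in
theorem colour_of_ne (P : Finset (ℤ × ℤ)) (i : ℤ) {h : ℤ} (hh : h ≠ 2) :
    colour P (i, h) = {R ∈ P | R.2 = 2}.card + {R ∈ P | R.2 = h ∧ i < R.1}.card := if_neg hh

/-- The two sides of a closed set `P` of curves. -/
theorem StackConn.colour_eq {A B : AffineDiagram n} (P : Finset (ℤ × ℤ))
    (hP : ∀ Q ∈ P, ∀ R, StackConn A B Q R → R ∈ P) {Q R : ℤ × ℤ} (hQ : Q ∉ P)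
    (h : StackConn A B Q R) : colour P Q % 2 = colour P R % 2 := by
  classical
  induction h with
  | refl => rfl
  | @tail b c hb h ih =>
    rw [ih]
    have hbP : b ∉ P := fun h' => hQ (hP b h' Q (StackConn.symm hb))
    have hcP : c ∉ P := fun h' => hbP (hP c h' b (StackConn.symm (.single h)))
    rcases h with ⟨x, rfl, rfl⟩ | ⟨x, rfl, rfl⟩
    · have hk := countBefore_pair A 1 P (fun u hu => hP _ hu _ (stackConn_upper A B u)) x hbP
      have hc : ∀ x, colour P (place 1 x) = countBefore P 1 x := by
        rintro (i | i)
        · rw [countBefore_top P (m' := 2) rfl]; exact colour_two P i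
        · rw [countBefore_bot P (m' := 2) rfl]; exact colour_of_ne P i (by decide)
      rwa [hc, hc]
    · have hk := countBefore_pair B 0 P (fun u hu => hP _ hu _ (stackConn_lower A B u)) x hbP
      -- For the lower layer the boundary count begins with the middle row to the left of the point,
      -- whereas the colour uses the top row and the points to the right. As the point is not in
      -- `P`, the two parts of the middle row add up to the whole row, so the counts differ by a
      -- constant modulo 2.
      have hc : ∀ x, place 0 x ∉ P → colour P (place 0 x) % 2 = (countBefore P 0 x +
          {R ∈ P | R.2 = 2}.card + {R ∈ P | R.2 = 1}.card) % 2 := by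
        rintro (i | i) hx
        · rw [countBefore_top P (m' := 1) rfl]
          have : {R ∈ P | R.2 = 1}.card = {Q ∈ P | Q.2 = 1 ∧ Q.1 < i}.card +
              {Q ∈ P | Q.2 = 1 ∧ i < Q.1}.card := by
            rw [← Finset.card_union_of_disjoint, ← Finset.filter_or]
            · congr 1
              apply Finset.filter_congr
              rintro ⟨a, b⟩ hab
              constructor
              · rintro (rfl : b = 1)
                rcases lt_trichotomy a i with h | rfl | h
                · exact Or.inl ⟨rfl, h⟩
                · exact (hx hab).elim
                · exact Or.inr ⟨rfl, h⟩
              · rintro (⟨h, -⟩ | ⟨h, -⟩) <;> simpa using h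
            · rw [Finset.disjoint_filter]
              rintro Q _ ⟨_, h⟩ ⟨_, h'⟩
              omega
          have e : colour P (place 0 (Node.top i)) = _ := colour_of_ne P i (h := 1) (by decide)
          rw [e]
          omega
        · rw [countBefore_bot P (m' := 1) rfl]
          have e : colour P (place 0 (Node.bot i)) = _ := colour_of_ne P i (h := 0) (by decide)
          rw [e]
          omega
      have h1 := hc _ hbP
      have h2 := hc _ hcP
      omega

theorem exists_finset_curve (hn : 0 < n) (A B : AffineDiagram n) (x : Node) :
    ∃ P : Finset (ℤ × ℤ), (∀ Q, Q ∈ P ↔ StackConn A B (outer x) Q) ∧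
      ∀ Q ∈ P, ∀ R, StackConn A B Q R → R ∈ P := by
  obtain ⟨P, hP⟩ := (stackConn_outer hn A B x).1.exists_finset
  exact ⟨P, hP, fun Q hQ R h => (hP R).2 (StackConn.trans ((hP Q).1 hQ) h)⟩

open Classical in
/-- A curve that joins the top to the bottom has an odd number of points in the middle. -/
theorem odd_card_middle (hn : 0 < n) (A B : AffineDiagram n) {i j : ℤ} (P : Finset (ℤ × ℤ))
    (hP : ∀ Q, Q ∈ P ↔ StackConn A B (outer (Node.top i)) Q)
    (hij : StackConn A B (outer (Node.top i)) (outer (Node.bot j))) :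
    {R ∈ P | R.2 = 2}.card = 1 ∧ Odd {R ∈ P | R.2 = 1}.card := by
  obtain ⟨y, -, -, hy⟩ := (stackConn_outer hn A B (Node.top i)).2
  have h2 : {R ∈ P | R.2 = 2} = {(i, 2)} := by
    ext ⟨a, b⟩
    simp only [Finset.mem_filter, Finset.mem_singleton, Prod.mk.injEq]
    constructor
    · rintro ⟨ha, rfl⟩
      rcases hy (Node.top a) ((hP _).1 ha) with h | h
      · cases h; exact ⟨rfl, rfl⟩
      · rcases hy _ hij with h' | h'
        · cases h'
        · rw [← h'] at h; cases h
    · rintro ⟨rfl, rfl⟩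
      exact ⟨(hP _).2 .refl, rfl⟩
  -- The edges of `A` pair off the points of the curve in the two upper rows. Only one of these
  -- points is in the top row, so the middle row contains an odd number.
  have hev : Even ({R ∈ P | R.2 = 2} ∪ {R ∈ P | R.2 = 1}).card := by
    rw [← Finset.filter_or]
    have hx : ∀ Q : ℤ × ℤ, (Q.2 = 2 ∨ Q.2 = 1) → ∃ x, Q = place 1 x := by
      rintro ⟨a, b⟩ (rfl | rfl)
      · exact ⟨Node.top a, rfl⟩
      · exact ⟨Node.bot a, rfl⟩
    refine even_card_of_involution _ (layerMap A 1) (fun x _ => layerMap_layerMap A 1 x) ?_ ?_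
    · intro Q hQ
      obtain ⟨hQ, h⟩ := Finset.mem_filter.1 hQ
      obtain ⟨x, rfl⟩ := hx Q h
      rw [layerMap_place]
      refine Finset.mem_filter.2 ⟨(hP _).2 (((hP _).1 hQ).trans (stackConn_upper A B x)), ?_⟩
      cases A.pair x <;> simp [place]
    · intro Q hQ
      obtain ⟨x, rfl⟩ := hx Q (Finset.mem_filter.1 hQ).2
      exact layerMap_ne A 1 x
  rw [Finset.card_union_of_disjoint, h2, Finset.card_singleton] at hev
  · refine ⟨by rw [h2, Finset.card_singleton], ?_⟩
    rw [← Nat.not_even_iff_odd]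
    rintro ⟨c, hc⟩
    obtain ⟨d, hd⟩ := hev
    omega
  · rw [Finset.disjoint_filter]
    intro Q _ h h'
    omega

/-- If a curve joins the top to the bottom, then all closed curves are contractible. -/
theorem innerContractible_of_through (hn : 0 < n) {A B : AffineDiagram n} {i j : ℤ}
    (hij : StackConn A B (outer (Node.top i)) (outer (Node.bot j))) {k : ℤ}
    (hk : InnerLoop A B k) : InnerContractible A B k := by
  classical
  obtain ⟨P, hP, hcl⟩ := exists_finset_curve hn A B (Node.top i)
  obtain ⟨hP2, hP1⟩ := odd_card_middle hn A B P hP hij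
  have hnP : ∀ a, StackConn A B (k, 1) (a, 1) → (a, 1) ∉ P := fun a ha h =>
    hk _ (ha.trans ((hP _).1 h).symm)
  -- A closed curve with a nonzero period visits translates of `k` on both sides of the finite
  -- through curve `P`. Far to the right the colour is 1, far to the left it is 1 plus the odd
  -- number of middle points. The parity would thus change along a curve that avoids `P`.
  have main : ∀ p : ℤ, 0 < p → ¬ StackConn A B (k, 1) (k + p * n, 1) := by
    intro p hp h
    have hm : ∀ m : ℕ, StackConn A B (k, 1) (k + m * p * n, 1) ∧
        StackConn A B (k, 1) (k - m * p * n, 1) := by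
      intro m
      induction m with
      | zero => simp; exact .refl
      | succ m ih =>
        constructor
        · have := h.shift (m * p)
          refine ih.1.trans ?_
          convert this using 2
          push_cast
          ring
        · have := (h.shift (-(m + 1 : ℤ) * p)).symm
          refine ih.2.trans ?_
          convert this using 2
          · ring
          · push_cast
            ring
    obtain ⟨b, hb⟩ : ∃ b : ℕ, ∀ Q ∈ P, |Q.1| < b := by
      refine ⟨(P.sup fun Q => Q.1.natAbs) + 1, fun Q hQ => ?_⟩
      have := Finset.le_sup (f := fun Q : ℤ × ℤ => Q.1.natAbs) hQ
      push_cast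
      rw [Int.abs_eq_natAbs]
      omega
    have hpn : 1 ≤ p * n := by
      have : (1 : ℤ) ≤ n := by omega
      nlinarith
    -- Since `p * n ≥ 1`, this many periods carry `k` past the bound `b` in either direction.
    set m := b + k.natAbs with hm'
    have hb1 : k + m * p * n ≥ b := by
      have : (m : ℤ) * 1 ≤ m * (p * n) := by gcongr
      rw [hm'] at this ⊢
      push_cast at this ⊢
      nlinarith [abs_nonneg k, neg_abs_le k, Int.natCast_natAbs k]
    have hb2 : k - m * p * n ≤ -b := by
      have : (m : ℤ) * 1 ≤ m * (p * n) := by gcongr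
      rw [hm'] at this ⊢
      push_cast at this ⊢
      nlinarith [abs_nonneg k, le_abs_self k, Int.natCast_natAbs k]
    have hcol := StackConn.colour_eq P hcl (hnP _ (hm m).1) (((hm m).1.symm).trans (hm m).2)
    have e1 : {R ∈ P | R.2 = 1 ∧ k + m * p * n < R.1} = ∅ := by
      refine Finset.filter_eq_empty_iff.2 fun Q hQ h => ?_
      have := hb Q hQ
      rw [abs_lt] at this
      omega
    have e2 : {R ∈ P | R.2 = 1 ∧ k - m * p * n < R.1} = {R ∈ P | R.2 = 1} := by
      refine Finset.filter_congr fun Q hQ => ?_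
      have := hb Q hQ
      rw [abs_lt] at this
      constructor
      · exact fun h => h.1
      · intro h
        refine ⟨h, by omega⟩
    rw [colour_of_ne _ _ (by decide), colour_of_ne _ _ (by decide), e1, e2, hP2,
      Finset.card_empty] at hcol
    obtain ⟨c, hc⟩ := hP1
    omega
  intro p hp
  rcases lt_trichotomy p 0 with h | h | h
  · exfalso
    apply main (-p) (by omega)
    have := (hp.shift (-p)).symm
    convert this using 2
    simp
  · exact h
  · exact (main p h hp).elim

/-! ### The composite of two diagrams -/

/-- The edges of the composite of two diagrams. -/
def compPair (hn : 0 < n) (A B : AffineDiagram n) (x : Node) : Node :=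
  (stackConn_outer hn A B x).2.choose

section

variable (hn : 0 < n) (A B : AffineDiagram n)

theorem compPair_conn (x : Node) : StackConn A B (outer x) (outer (compPair hn A B x)) :=
  (stackConn_outer hn A B x).2.choose_spec.1

theorem compPair_ne (x : Node) : compPair hn A B x ≠ x :=
  (stackConn_outer hn A B x).2.choose_spec.2.1

theorem compPair_unique {x z : Node} (h : StackConn A B (outer x) (outer z)) :
    z = x ∨ z = compPair hn A B x :=
  (stackConn_outer hn A B x).2.choose_spec.2.2 z h

theorem compPair_eq {x z : Node} (h : StackConn A B (outer x) (outer z)) (hz : z ≠ x) :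
    compPair hn A B x = z :=
  ((compPair_unique hn A B h).resolve_left hz).symm

/-- On outer nodes, the colour defined by the curve through `x` counts those of its two ends that
come earlier on the boundary. It is constant modulo 2 along the disjoint curve through `y`, while
interlaced ends would give the values 1 and 2. -/
theorem compPair_noncrossing (x y : Node) : ¬ (x.Before y ∧ y.Before (compPair hn A B x) ∧
    (compPair hn A B x).Before (compPair hn A B y)) := by
  classical
  rintro ⟨h1, h2, h3⟩
  obtain ⟨P, hP, hcl⟩ := exists_finset_curve hn A B x
  have hout : ∀ z, outer z ∈ P ↔ z = x ∨ z = compPair hn A B x := by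
    intro z
    rw [hP]
    constructor
    · exact fun h => compPair_unique hn A B h
    · rintro (rfl | rfl)
      · exact .refl
      · exact compPair_conn hn A B _
  have hyP : outer y ∉ P := by
    rw [hout]
    rintro (rfl | rfl)
    · exact Node.not_before_self _ h1
    · exact Node.not_before_self _ h2
  have hcol := StackConn.colour_eq P hcl hyP (compPair_conn hn A B y)
  have hc : ∀ z, colour P (outer z) =
      ({u ∈ {x, compPair hn A B x} | u.Before z} : Finset Node).card := by
    intro z
    have himg : ∀ z, ({u ∈ {x, compPair hn A B x} | u.Before z} : Finset Node).card =
        {R ∈ P | ∃ u, R = outer u ∧ u.Before z}.card := by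
      intro z
      rw [← Finset.card_image_of_injective _ outer_injective]
      congr 1
      ext R
      simp only [Finset.mem_image, Finset.mem_filter, Finset.mem_insert, Finset.mem_singleton]
      constructor
      · rintro ⟨u, ⟨hu, h⟩, rfl⟩
        exact ⟨(hout u).2 hu, u, rfl, h⟩
      · rintro ⟨hR, u, rfl, h⟩
        exact ⟨u, ⟨(hout u).1 hR, h⟩, rfl⟩
    rw [himg]
    cases z with
    | top i =>
      refine (colour_two P i).trans ?_
      congr 1
      ext ⟨a, b⟩
      simp only [Finset.mem_filter, and_congr_right_iff]
      intro _
      constructor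
      · rintro ⟨rfl, h⟩
        exact ⟨Node.top a, rfl, h⟩
      · rintro ⟨_ | _, h, h'⟩
        · cases h; exact ⟨rfl, h'⟩
        · exact h'.elim
    | bot i =>
      refine (colour_of_ne P i (by decide)).trans ?_
      rw [← Finset.card_union_of_disjoint, ← Finset.filter_or]
      · congr 1
        ext ⟨a, b⟩
        simp only [Finset.mem_filter, and_congr_right_iff]
        intro _
        constructor
        · rintro (rfl | ⟨rfl, h⟩)
          · exact ⟨Node.top a, rfl, trivial⟩
          · exact ⟨Node.bot a, rfl, h⟩
        · rintro ⟨_ | _, h, h'⟩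
          · cases h; exact Or.inl rfl
          · cases h; exact Or.inr ⟨rfl, h'⟩
      · rw [Finset.disjoint_filter]
        rintro Q _ h ⟨h', _⟩
        omega
  rw [hc, hc] at hcol
  have e1 : ({u ∈ {x, compPair hn A B x} | u.Before y} : Finset Node) = {x} := by
    ext u
    simp only [Finset.mem_filter, Finset.mem_insert, Finset.mem_singleton]
    constructor
    · rintro ⟨rfl | rfl, h⟩
      · rfl
      · exact (Node.not_before_self _ (h.trans h2)).elim
    · rintro rfl
      exact ⟨Or.inl rfl, h1⟩
  have e2 : ({u ∈ {x, compPair hn A B x} | u.Before (compPair hn A B y)} : Finset Node) =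
      {x, compPair hn A B x} := by
    refine Finset.filter_true_of_mem ?_
    simp only [Finset.mem_insert, Finset.mem_singleton]
    rintro u (rfl | rfl)
    · exact (h1.trans h2).trans h3
    · exact h3
  rw [e1, e2, Finset.card_singleton, Finset.card_pair (compPair_ne hn A B x).symm] at hcol
  omega

theorem StackConn.eq_top {A B : AffineDiagram n} (hA : ∀ i j, A.pair (Node.top i) ≠ Node.bot j)
    {i : ℤ} {P : ℤ × ℤ} (h : StackConn A B (i, 2) P) : P.2 = 2 := by
  induction h with
  | refl => rfl
  | tail _ h ih =>
    rcases h with ⟨x | x, rfl, rfl⟩ | ⟨x | x, rfl, rfl⟩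
    · rcases hx : A.pair (Node.top x) with j | j
      · rfl
      · exact (hA _ _ hx).elim
    all_goals simp [place] at ih

theorem StackConn.eq_bot {A B : AffineDiagram n} (hB : ∀ i j, B.pair (Node.top i) ≠ Node.bot j)
    {i : ℤ} {P : ℤ × ℤ} (h : StackConn A B (i, 0) P) : P.2 = 0 := by
  induction h with
  | refl => rfl
  | tail _ h ih =>
    rcases h with ⟨x | x, rfl, rfl⟩ | ⟨x | x, rfl, rfl⟩
    case inr.bot =>
      rcases hx : B.pair (Node.bot x) with j | j
      · exact (hB j x (by rw [← hx, B.pair_pair])).elim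
      · rfl
    all_goals simp [place] at ih

/-- The composite of two diagrams. -/
def comp : AffineDiagram n where
  pair := compPair hn A B
  pair_pair x := compPair_eq hn A B (compPair_conn hn A B x).symm (compPair_ne hn A B x).symm
  pair_ne := compPair_ne hn A B
  pair_shift x := by
    refine compPair_eq hn A B ?_ ?_
    · have := (compPair_conn hn A B x).shift 1
      rw [one_mul] at this
      rwa [outer_shift, outer_shift]
    · have h3 : ∀ y z : Node, y.shift n = z.shift n → y = z := by
        rintro (_ | _) (_ | _) h <;> simp [Node.shift] at h ⊢ <;> exact h
      exact fun h => compPair_ne hn A B x (h3 _ _ h)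
  noncrossing := compPair_noncrossing hn A B
  bands := A.bands + B.bands + stackBands A B
  bands_eq_zero i j hij := by
    have hc := compPair_conn hn A B (Node.top i)
    rw [hij] at hc
    -- Bands in `A` exclude through edges of `A`, and then the curve from the top node could never
    -- leave height 2.
    have h1 : A.bands = 0 := by
      by_contra h
      have : (0 : ℤ) = 2 := StackConn.eq_top (A := A) (B := B)
        (fun i j hij => h (A.bands_eq_zero i j hij)) hc
      omega
    have h2 : B.bands = 0 := by
      by_contra h
      have : (2 : ℤ) = 0 := StackConn.eq_bot (A := A) (B := B)
        (fun i j hij => h (B.bands_eq_zero i j hij)) hc.symm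
      omega
    have h3 : stackBands A B = 0 := by
      rw [stackBands, show {L : Set ℤ | ∃ i, L = innerCurve A B i ∧ InnerLoop A B i ∧
        ¬ InnerContractible A B i} = ∅ from ?_, Set.ncard_empty]
      refine Set.eq_empty_of_forall_notMem ?_
      rintro _ ⟨k, -, hk, hk'⟩
      exact hk' (innerContractible_of_through hn hc hk)
    rw [h1, h2, h3]

theorem isComposite_comp : IsComposite A B (comp hn A B) :=
  ⟨compPair_conn hn A B, rfl⟩

variable {A B}

theorem IsComposite.eq_comp {E : AffineDiagram n} (h : IsComposite A B E) : E = comp hn A B := by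
  ext x
  · exact (compPair_eq hn A B (h.1 x) (E.pair_ne x)).symm ▸ rfl
  · exact h.2

theorem IsComposite.eq_or_of_conn {E : AffineDiagram n} (hn : 0 < n) (h : IsComposite A B E)
    {x z : Node} (hz : StackConn A B (outer x) (outer z)) : z = x ∨ z = E.pair x := by
  rw [h.eq_comp hn]
  exact compPair_unique hn A B hz

end

theorem existsUnique_isComposite (hn : 0 < n) (A B : AffineDiagram n) :
    ∃! E : AffineDiagram n, IsComposite A B E :=
  ⟨comp hn A B, isComposite_comp hn A B, fun _ h => h.eq_comp hn⟩

end AffineDiagram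

end

/-! ### Contraction of layers and the bookkeeping of closed curves. -/

section

namespace AffineDiagram

variable {n : ℕ}

/-! ### Contracting layers of a stack -/

/-- `F'` is obtained from the stack `F` by replacing some pairs of adjacent layers by their
composites; `e` embeds the rows of `F'` into the rows of `F`. -/
structure Refines (F F' : ℤ → Option (AffineDiagram n)) (e : ℤ → ℤ) : Prop where
  strictMono : StrictMono e
  step : ∀ m, e (m + 1) = e m + 1 ∧ F (e m) = F' m ∨ e (m + 1) = e m + 2 ∧
    ∃ A B E, F (e m) = some B ∧ F (e m + 1) = some A ∧ F' m = some E ∧ IsComposite A B E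
  cover : ∀ h, ∃ m, h = e m ∨ h = e m + 1 ∧ e (m + 1) = e m + 2

theorem stackStep_height {A B : AffineDiagram n} {P Q : ℤ × ℤ} (h : StackStep A B P Q) :
    0 ≤ P.2 ∧ P.2 ≤ 2 := by
  rcases h with ⟨_ | _, rfl, -⟩ | ⟨_ | _, rfl, -⟩ <;> simp [place]

theorem eq_outer_or {P : ℤ × ℤ} (h : 0 ≤ P.2 ∧ P.2 ≤ 2) : (∃ x, P = outer x) ∨ P.2 = 1 := by
  obtain ⟨i, k⟩ := P
  simp only at h ⊢
  obtain rfl | rfl | rfl : k = 0 ∨ k = 1 ∨ k = 2 := by omega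
  · exact Or.inl ⟨Node.bot i, rfl⟩
  · exact Or.inr rfl
  · exact Or.inl ⟨Node.top i, rfl⟩

namespace Refines

variable {F F' : ℤ → Option (AffineDiagram n)} {e : ℤ → ℤ} (hR : Refines F F' e)
include hR

/-- The middle row of a contracted pair lies strictly between two consecutive values of `e`. All
later case distinctions rest on this separation of surviving rows from interior ones. -/
theorem ne_succ {m : ℤ} (hm : e (m + 1) = e m + 2) (m' : ℤ) : e m' ≠ e m + 1 := by
  intro h
  have h1 := hR.strictMono.lt_iff_lt.1 (show e m < e m' by omega)
  have h2 := hR.strictMono.lt_iff_lt.1 (show e m' < e (m + 1) by omega)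
  omega

/-- Inside a contracted pair, heights are measured from the lower row of the pair, so that the step
becomes one of a stack of two diagrams. -/
theorem lstep_cases {P Q : ℤ × ℤ} (h : LStep F P Q) :
    (∃ P' Q', LStep F' P' Q' ∧ P = (P'.1, e P'.2) ∧ Q = (Q'.1, e Q'.2)) ∨
    ∃ m A B E, e (m + 1) = e m + 2 ∧ F (e m) = some B ∧ F (e m + 1) = some A ∧ F' m = some E ∧
      IsComposite A B E ∧ ∃ P' Q', StackStep A B P' Q' ∧ P = (P'.1, e m + P'.2) ∧
        Q = (Q'.1, e m + Q'.2) := by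
  obtain ⟨k, D, x, hF, rfl, rfl⟩ := h
  obtain ⟨m, rfl | ⟨rfl, hm⟩⟩ := hR.cover k
  · rcases hR.step m with ⟨hm, hFm⟩ | ⟨hm, A, B, E, hB, hA, hE, hc⟩
    · left
      refine ⟨place m x, place m (D.pair x), ⟨m, D, x, by rw [← hFm, hF], rfl, rfl⟩, ?_⟩
      have : ∀ y, place (e m) y = ((place m y).1, e (place m y).2) := by
        rintro (_ | _) <;> simp [place, hm]
      exact ⟨this _, this _⟩
    · right
      rw [hB] at hF
      obtain rfl : B = D := Option.some.inj hF
      refine ⟨m, A, B, E, hm, hB, hA, hE, hc, place 0 x, place 0 (B.pair x),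
        Or.inr ⟨x, rfl, rfl⟩, ?_⟩
      have : ∀ y, place (e m) y = ((place 0 y).1, e m + (place 0 y).2) := by
        rintro (_ | _) <;> simp [place]
      exact ⟨this _, this _⟩
  · rcases hR.step m with ⟨hm', _⟩ | ⟨_, A, B, E, hB, hA, hE, hc⟩
    · omega
    · right
      rw [hA] at hF
      obtain rfl : A = D := Option.some.inj hF
      refine ⟨m, A, B, E, hm, hB, hA, hE, hc, place 1 x, place 1 (A.pair x),
        Or.inl ⟨x, rfl, rfl⟩, ?_⟩
      have : ∀ y, place (e m + 1) y = ((place 1 y).1, e m + (place 1 y).2) := by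
        rintro (_ | _) <;> simp [place, add_assoc]
      exact ⟨this _, this _⟩

omit hR in
theorem outer_eq {m : ℤ} (hm : e (m + 1) = e m + 2) (x : Node) :
    ((outer x).1, e m + (outer x).2) = ((place m x).1, e (place m x).2) := by
  cases x <;> simp [place, outer, hm]

omit hR in
theorem conn_of_stackConn {m : ℤ} {A B : AffineDiagram n} (hB : F (e m) = some B)
    (hA : F (e m + 1) = some A) {P Q : ℤ × ℤ} (h : StackConn A B P Q) :
    LConn F (P.1, e m + P.2) (Q.1, e m + Q.2) := by
  induction h with
  | refl => exact .refl
  | tail _ h ih =>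
    refine ih.tail ?_
    rcases h with ⟨x, rfl, rfl⟩ | ⟨x, rfl, rfl⟩
    · refine ⟨e m + 1, A, x, hA, ?_, ?_⟩
      · cases x <;> simp [place, add_assoc]
      · cases A.pair x <;> simp [place, add_assoc]
    · refine ⟨e m, B, x, hB, ?_, ?_⟩
      · cases x <;> simp [place]
      · cases B.pair x <;> simp [place]

theorem conn_lift {P Q : ℤ × ℤ} (h : LConn F' P Q) : LConn F (P.1, e P.2) (Q.1, e Q.2) := by
  induction h with
  | refl => exact .refl
  | tail _ h ih =>
    refine ih.trans ?_
    obtain ⟨m, D, x, hF, rfl, rfl⟩ := h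
    rcases hR.step m with ⟨hm, hFm⟩ | ⟨hm, A, B, E, hB, hA, hE, hc⟩
    · refine .single ⟨e m, D, x, by rw [hFm, hF], ?_, ?_⟩
      · cases x <;> simp [place, hm]
      · cases D.pair x <;> simp [place, hm]
    · rw [hE] at hF
      cases hF
      have := conn_of_stackConn hB hA (hc.1 x)
      rwa [outer_eq hm, outer_eq hm] at this

/-- Where a curve that starts at a row of `F'` can go. -/
theorem conn_cases (hn : 0 < n) {P Q : ℤ × ℤ} (h : LConn F (P.1, e P.2) Q) :
    (∃ Q', LConn F' P Q' ∧ Q = (Q'.1, e Q'.2)) ∨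
    ∃ m A B E, e (m + 1) = e m + 2 ∧ F (e m) = some B ∧ F (e m + 1) = some A ∧ F' m = some E ∧
      IsComposite A B E ∧ ∃ x i, LConn F' P (place m x) ∧ StackConn A B (outer x) (i, 1) ∧
        Q = (i, e m + 1) := by
  -- An excursion into a contracted pair: on reaching an outer node it has either returned to its
  -- entry or followed an edge of the composite `E`. In the middle row the entry node `x` is
  -- recorded, so that the walk can be continued.
  have absorb : ∀ m A B E, e (m + 1) = e m + 2 → F (e m) = some B → F (e m + 1) = some A →
      F' m = some E → IsComposite A B E → ∀ x Q, LConn F' P (place m x) →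
      StackConn A B (outer x) Q →
      (∃ Q', LConn F' P Q' ∧ (Q.1, e m + Q.2) = (Q'.1, e Q'.2)) ∨
      ∃ m' A B E, e (m' + 1) = e m' + 2 ∧ F (e m') = some B ∧ F (e m' + 1) = some A ∧
        F' m' = some E ∧ IsComposite A B E ∧ ∃ x i, LConn F' P (place m' x) ∧
        StackConn A B (outer x) (i, 1) ∧ (Q.1, e m + Q.2) = (i, e m' + 1) := by
    intro m A B E hm hB hA hE hc x Q hx hQ
    rcases eq_outer_or (hQ.height (outer_height x)) with ⟨z, rfl⟩ | h1
    · left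
      refine ⟨place m z, hx.trans ?_, outer_eq hm z⟩
      rcases hc.eq_or_of_conn hn hQ with rfl | rfl
      · exact .refl
      · exact .single ⟨m, E, x, hE, rfl, rfl⟩
    · right
      refine ⟨m, A, B, E, hm, hB, hA, hE, hc, x, Q.1, hx, ?_, by rw [h1]⟩
      rwa [← h1]
  induction h with
  | refl => exact Or.inl ⟨P, .refl, rfl⟩
  | tail _ h ih =>
    rcases ih with ⟨Q', hQ', rfl⟩ | ⟨m, A, B, E, hm, hB, hA, hE, hc, x, i, hx, hxi, rfl⟩
    · rcases hR.lstep_cases h with ⟨P₁, Q₁, hs, h1, rfl⟩ |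
        ⟨m, A, B, E, hm, hB, hA, hE, hc, P₁, Q₁, hs, h1, rfl⟩
      · left
        have : Q' = P₁ := Prod.ext (Prod.ext_iff.1 h1).1
          (hR.strictMono.injective (Prod.ext_iff.1 h1).2)
        exact ⟨Q₁, hQ'.tail (this ▸ hs), rfl⟩
      · rcases eq_outer_or (stackStep_height hs) with ⟨z, rfl⟩ | h2
        · refine absorb m A B E hm hB hA hE hc z Q₁ ?_ (.single hs)
          rw [outer_eq hm] at h1
          have : Q' = place m z := Prod.ext (Prod.ext_iff.1 h1).1
            (hR.strictMono.injective (Prod.ext_iff.1 h1).2)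
          rwa [← this]
        · exact (hR.ne_succ hm Q'.2 ((Prod.ext_iff.1 h1).2.trans (by rw [h2]))).elim
    · rcases hR.lstep_cases h with ⟨P₁, Q₁, hs, h1, rfl⟩ |
        ⟨m', A', B', E', hm', hB', hA', hE', hc', P₁, Q₁, hs, h1, rfl⟩
      · exact (hR.ne_succ hm P₁.2 (Prod.ext_iff.1 h1).2.symm).elim
      · rcases eq_outer_or (stackStep_height hs) with ⟨z, rfl⟩ | h2
        · rw [outer_eq hm'] at h1
          exact (hR.ne_succ hm _ (Prod.ext_iff.1 h1).2.symm).elim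
        · have h3 := (Prod.ext_iff.1 h1).2
          rw [h2] at h3
          obtain rfl : m = m' := hR.strictMono.injective (add_right_cancel h3)
          rw [hA] at hA'
          rw [hB] at hB'
          cases hA'
          cases hB'
          have h4 : P₁ = (i, 1) := Prod.ext (Prod.ext_iff.1 h1).1.symm h2
          rw [h4] at hs
          exact absorb m A B E hm hB hA hE hc x Q₁ hx (hxi.trans (.single hs))

/-- Excursions of a curve into contracted pairs either come back or amount to edges of the
composite. The interior alternative of `conn_cases` cannot occur for the end point, because `e`
misses the middle rows. -/
theorem conn_iff (hn : 0 < n) (P Q : ℤ × ℤ) :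
    LConn F (P.1, e P.2) (Q.1, e Q.2) ↔ LConn F' P Q := by
  refine ⟨fun h => ?_, hR.conn_lift⟩
  rcases hR.conn_cases hn h with ⟨Q', h', hQ⟩ | ⟨m, A, B, E, hm, -, -, -, -, x, i, -, -, hQ⟩
  · have : Q = Q' := Prod.ext (Prod.ext_iff.1 hQ).1
      (hR.strictMono.injective (Prod.ext_iff.1 hQ).2)
    rwa [this]
  · exact (hR.ne_succ hm _ (Prod.ext_iff.1 hQ).2).elim

/-- A closed curve inside a contracted pair of layers stays there. -/
theorem conn_inner {m : ℤ} {A B : AffineDiagram n} (hm : e (m + 1) = e m + 2)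
    (hB : F (e m) = some B) (hA : F (e m + 1) = some A) {i : ℤ} (hi : InnerLoop A B i)
    {Q : ℤ × ℤ} (h : LConn F (i, e m + 1) Q) : ∃ j, Q = (j, e m + 1) ∧
      StackConn A B (i, 1) (j, 1) := by
  induction h with
  | refl => exact ⟨i, rfl, .refl⟩
  | tail _ h ih =>
    obtain ⟨j, rfl, hj⟩ := ih
    rcases hR.lstep_cases h with ⟨P₁, Q₁, hs, h1, rfl⟩ |
      ⟨m', A', B', E', hm', hB', hA', hE', hc', P₁, Q₁, hs, h1, rfl⟩
    · exact (hR.ne_succ hm P₁.2 (Prod.ext_iff.1 h1).2.symm).elim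
    · rcases eq_outer_or (stackStep_height hs) with ⟨z, rfl⟩ | h2
      · rw [outer_eq hm'] at h1
        exact (hR.ne_succ hm _ (Prod.ext_iff.1 h1).2.symm).elim
      · have h3 := (Prod.ext_iff.1 h1).2
        rw [h2] at h3
        obtain rfl : m = m' := hR.strictMono.injective (add_right_cancel h3)
        rw [hA] at hA'
        rw [hB] at hB'
        cases hA'
        cases hB'
        have h4 : P₁ = (j, 1) := Prod.ext (Prod.ext_iff.1 h1).1.symm h2
        rw [h4] at hs
        have hc := hj.tail hs
        rcases eq_outer_or (StackConn.height hc ⟨by simp, by simp⟩) with ⟨z, rfl⟩ | h5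
        · exact (hi z hc).elim
        · exact ⟨Q₁.1, by rw [h5], by rwa [show Q₁ = (Q₁.1, 1) from Prod.ext rfl h5] at hc⟩

theorem conn_inner_iff {m : ℤ} {A B : AffineDiagram n} (hm : e (m + 1) = e m + 2)
    (hB : F (e m) = some B) (hA : F (e m + 1) = some A) {i : ℤ} (hi : InnerLoop A B i)
    (j : ℤ) : LConn F (i, e m + 1) (j, e m + 1) ↔ StackConn A B (i, 1) (j, 1) := by
  constructor
  · intro h
    obtain ⟨j', h1, h2⟩ := hR.conn_inner hm hB hA hi h
    obtain rfl : j = j' := (Prod.ext_iff.1 h1).1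
    exact h2
  · exact fun h => conn_of_stackConn hB hA h

end Refines

/-! ### Counting closed curves -/

/-- A stack of layers on a cylinder (`period = 0`) or a torus, in which the rows `forbidden`
count as the boundary. -/
structure PlaneStack (n : ℕ) where
  layers : ℤ → Option (AffineDiagram n)
  period : ℤ
  forbidden : ℤ → Prop
  layers_add : ∀ m, layers (m + period) = layers m
  forbidden_add : ∀ h, forbidden (h + period) ↔ forbidden h
  finite : ∃ H : Set ℤ, H.Finite ∧ ∀ h, ¬ forbidden h → ∃ q, h + q * period ∈ H

namespace PlaneStack

variable (S : PlaneStack n)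

/-- The points of the curve through `P`, up to translation. -/
def curve (P : ℤ × ℤ) : Set (ℤ × ℤ) :=
  {Q | ∃ p q : ℤ, LConn S.layers P (Q.1 + p * n, Q.2 + q * S.period)}

/-- The curve through `P` is contractible. -/
def Contractible (P : ℤ × ℤ) : Prop :=
  ∀ p q : ℤ, LConn S.layers P (P.1 + p * n, P.2 + q * S.period) → p = 0 ∧ q * S.period = 0

/-- The curve through `P` avoids the boundary. -/
def Closed (P : ℤ × ℤ) : Prop := ∀ Q, LConn S.layers P Q → ¬ S.forbidden Q.2

/-- The closed curves that are contractible (`c = True`) or not (`c = False`). -/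
def curves (c : Prop) : Set (Set (ℤ × ℤ)) :=
  {L | ∃ P, L = S.curve P ∧ S.Closed P ∧ (S.Contractible P ↔ c)}

variable {S}

theorem layers_add_mul (m q : ℤ) : S.layers (m + q * S.period) = S.layers m := by
  induction q using Int.induction_on with
  | zero => simp
  | succ q ih => rw [← ih, ← S.layers_add (m + q * S.period)]; congr 1; ring
  | pred q ih => rw [← ih, ← S.layers_add (m + _)]; congr 1; ring

theorem forbidden_add_mul (m q : ℤ) : S.forbidden (m + q * S.period) ↔ S.forbidden m := by
  induction q using Int.induction_on with
  | zero => simp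
  | succ q ih =>
    rw [← ih, ← S.forbidden_add (m + q * S.period)]
    exact iff_of_eq (congrArg _ (by ring))
  | pred q ih =>
    rw [← ih, ← S.forbidden_add (m + _)]
    exact iff_of_eq (congrArg _ (by ring))

theorem conn_shift {P Q : ℤ × ℤ} (h : LConn S.layers P Q) (p q : ℤ) :
    LConn S.layers (P.1 + p * n, P.2 + q * S.period) (Q.1 + p * n, Q.2 + q * S.period) := by
  have h2 : LConn S.layers (P.1, P.2 + q * S.period) (Q.1, Q.2 + q * S.period) := by
    induction h with
    | refl => exact .refl
    | tail _ h ih =>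
      refine ih.tail ?_
      obtain ⟨m, D, x, hF, rfl, rfl⟩ := h
      refine ⟨m + q * S.period, D, x, by rw [layers_add_mul, hF], ?_, ?_⟩
      · cases x <;> simp [place, add_right_comm]
      · cases D.pair x <;> simp [place, add_right_comm]
  exact h2.shift p

theorem mem_curve_self (P : ℤ × ℤ) : P ∈ S.curve P := ⟨0, 0, by simp; exact .refl⟩

theorem curve_eq_of_conn {P Q : ℤ × ℤ} (h : LConn S.layers P Q) : S.curve P = S.curve Q := by
  ext R
  exact ⟨fun ⟨p, q, hR⟩ => ⟨p, q, h.symm.trans hR⟩, fun ⟨p, q, hR⟩ => ⟨p, q, h.trans hR⟩⟩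

theorem curve_shift (P : ℤ × ℤ) (p q : ℤ) :
    S.curve (P.1 + p * n, P.2 + q * S.period) = S.curve P := by
  ext R
  constructor
  · rintro ⟨p', q', h⟩
    refine ⟨p' - p, q' - q, ?_⟩
    convert conn_shift h (-p) (-q) using 2 <;> ring
  · rintro ⟨p', q', h⟩
    refine ⟨p' + p, q' + q, ?_⟩
    convert conn_shift h p q using 2 <;> ring

theorem curve_eq_iff (P Q : ℤ × ℤ) : S.curve P = S.curve Q ↔
    ∃ p q : ℤ, LConn S.layers P (Q.1 + p * n, Q.2 + q * S.period) := by
  constructor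
  · intro h
    have := mem_curve_self (S := S) Q
    rwa [← h] at this
  · rintro ⟨p, q, h⟩
    rw [curve_eq_of_conn h, curve_shift]

theorem Contractible.of_conn {P Q : ℤ × ℤ} (h : LConn S.layers P Q) (hP : S.Contractible P) :
    S.Contractible Q := fun p q hQ => hP p q ((h.trans hQ).trans (conn_shift h.symm p q))

theorem contractible_iff_of_conn {P Q : ℤ × ℤ} (h : LConn S.layers P Q) :
    S.Contractible P ↔ S.Contractible Q := ⟨.of_conn h, .of_conn h.symm⟩

theorem Contractible.shift {P : ℤ × ℤ} (hP : S.Contractible P) (p q : ℤ) :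
    S.Contractible (P.1 + p * n, P.2 + q * S.period) := by
  intro p' q' h
  refine hP p' q' ?_
  convert conn_shift h (-p) (-q) using 2 <;> ring

theorem contractible_shift_iff (P : ℤ × ℤ) (p q : ℤ) :
    S.Contractible (P.1 + p * n, P.2 + q * S.period) ↔ S.Contractible P := by
  refine ⟨fun h => ?_, fun h => h.shift p q⟩
  convert h.shift (-p) (-q) using 1
  ext <;> simp

theorem closed_iff_of_conn {P Q : ℤ × ℤ} (h : LConn S.layers P Q) :
    S.Closed P ↔ S.Closed Q :=
  ⟨fun hP R hR => hP R (h.trans hR), fun hP R hR => hP R (h.symm.trans hR)⟩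

/-- Translations move every admissible point into the finite domain `[0, n) × H`. Finiteness matters
because `Set.ncard` vanishes on infinite sets and is additive only for finite ones. -/
theorem finite_curves (hn : 0 < n) (c : Prop) : (S.curves c).Finite := by
  obtain ⟨H, hH, hcov⟩ := S.finite
  refine (((Set.finite_Ico (0 : ℤ) n).prod hH).image S.curve).subset ?_
  rintro _ ⟨P, rfl, hP, -⟩
  obtain ⟨q, hq⟩ := hcov P.2 (hP P .refl)
  refine ⟨(P.1 % n, P.2 + q * S.period), ⟨⟨Int.emod_nonneg _ (by omega),
    Int.emod_lt_of_pos _ (by omega)⟩, hq⟩, ?_⟩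
  rw [← curve_shift P (-(P.1 / n)) q]
  congr 2
  have := Int.emod_add_mul_ediv P.1 n
  linarith

end PlaneStack

/-- Curves are sets indexed redundantly by their points. Two such families are compared through a
map of base points that respects and reflects equality of curves and reaches every curve. -/
theorem ncard_classes {α β X Y : Type} (f : α → X) (g : β → Y) (Q : α → Prop) (R : β → Prop)
    (φ : α → β) (hQ : ∀ a, Q a → R (φ a))
    (hfg : ∀ a b, Q a → Q b → (f a = f b ↔ g (φ a) = g (φ b)))
    (hsurj : ∀ b, R b → ∃ a, Q a ∧ g (φ a) = g b) :
    {L | ∃ a, L = f a ∧ Q a}.ncard = {L | ∃ b, L = g b ∧ R b}.ncard := by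
  classical
  refine Set.ncard_congr (fun L hL => g (φ hL.choose)) ?_ ?_ ?_
  · intro L hL
    exact ⟨_, rfl, hQ _ hL.choose_spec.2⟩
  · intro L L' hL hL' h
    rw [hL.choose_spec.1, hL'.choose_spec.1]
    exact (hfg _ _ hL.choose_spec.2 hL'.choose_spec.2).2 h
  · rintro _ ⟨b, rfl, hb⟩
    obtain ⟨a, ha, hab⟩ := hsurj b hb
    have hL : ∃ a', f a = f a' ∧ Q a' := ⟨a, rfl, ha⟩
    refine ⟨f a, hL, ?_⟩
    rw [← hab, ← hfg _ _ hL.choose_spec.2 ha]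
    exact hL.choose_spec.1.symm

/-- The number of closed curves of the middle row that are contractible (`c = True`) or not
(`c = False`). -/
def innerCount (A B : AffineDiagram n) (c : Prop) : ℕ :=
  Set.ncard {L : Set ℤ | ∃ i, L = innerCurve A B i ∧ InnerLoop A B i ∧
    (InnerContractible A B i ↔ c)}

theorem innerCount_true (A B : AffineDiagram n) : innerCount A B True = stackLoops A B := by
  simp only [innerCount, stackLoops, iff_true]

theorem innerCount_false (A B : AffineDiagram n) : innerCount A B False = stackBands A B := by
  simp only [innerCount, stackBands, iff_false]

theorem innerCurve_eq_iff (A B : AffineDiagram n) (i j : ℤ) :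
    innerCurve A B i = innerCurve A B j ↔ ∃ p : ℤ, StackConn A B (i, 1) (j + p * n, 1) := by
  constructor
  · intro h
    have : j ∈ innerCurve A B j := ⟨0, by simp; exact .refl⟩
    rwa [← h] at this
  · rintro ⟨p, h⟩
    ext k
    constructor
    · rintro ⟨q, h'⟩
      refine ⟨q - p, ?_⟩
      convert (h.symm.trans h').shift (-p) using 2 <;> ring
    · rintro ⟨q, h'⟩
      refine ⟨q + p, h.trans ?_⟩
      convert h'.shift p using 2
      ring

/-- Every point lies on a curve that meets a row of the contracted stack, or on a closed curve
inside a contracted pair of layers. -/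
theorem PlaneStack.point_cases {S S' : PlaneStack n} {e : ℤ → ℤ}
    (hR : Refines S.layers S'.layers e)
    (he : ∀ h q, e (h + q * S'.period) = e h + q * S.period) {m₀ : ℤ} {A B : AffineDiagram n}
    (hm₀ : e (m₀ + 1) = e m₀ + 2) (hB : S.layers (e m₀) = some B)
    (hA : S.layers (e m₀ + 1) = some A) (hm : ∀ m, e (m + 1) = e m + 2 → ∃ q, m = m₀ +
      q * S'.period) (P : ℤ × ℤ) :
    (∃ Q : ℤ × ℤ, LConn S.layers P (Q.1, e Q.2)) ∨
      ∃ i q, InnerLoop A B i ∧ P = (i, e m₀ + 1 + q * S.period) := by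
  obtain ⟨m, h | ⟨h, h'⟩⟩ := hR.cover P.2
  · exact Or.inl ⟨(P.1, m), by rw [← h]; exact .refl⟩
  · obtain ⟨q, rfl⟩ := hm m h'
    by_cases hi : InnerLoop A B P.1
    · refine Or.inr ⟨P.1, q, hi, Prod.ext rfl ?_⟩
      simp only
      rw [h, he]
      ring
    · left
      unfold InnerLoop at hi
      push Not at hi
      obtain ⟨x, hx⟩ := hi
      have := Refines.conn_of_stackConn (F := S.layers) (e := e) hB hA hx
      rw [Refines.outer_eq hm₀] at this
      have h2 := PlaneStack.conn_shift this 0 q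
      refine ⟨((place m₀ x).1, (place m₀ x).2 + q * S'.period), ?_⟩
      rw [he]
      convert h2 using 1
      · ext
        · simp
        · simp only
          rw [h, he]
          ring
      · simp

/-- Contracting pairs of layers removes the closed curves inside these pairs. -/
theorem PlaneStack.ncard_curves_of_refines (hn : 0 < n) (S S' : PlaneStack n) {e : ℤ → ℤ}
    (hR : Refines S.layers S'.layers e)
    (he : ∀ h q, e (h + q * S'.period) = e h + q * S.period)
    (hper : ∀ q, q * S'.period = 0 ↔ q * S.period = 0)
    (hforb : ∀ h, S'.forbidden h ↔ S.forbidden (e h)) {m₀ : ℤ} {A B : AffineDiagram n}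
    (hm₀ : e (m₀ + 1) = e m₀ + 2) (hB : S.layers (e m₀) = some B)
    (hA : S.layers (e m₀ + 1) = some A) (hm : ∀ m, e (m + 1) = e m + 2 → ∃ q, m = m₀ +
      q * S'.period) (hforb₀ : ¬ S.forbidden (e m₀ + 1)) (c : Prop) :
    (S.curves c).ncard = (S'.curves c).ncard + innerCount A B c := by
  have hinner : ∀ m, e (m + 1) = e m + 2 → ¬ S.forbidden (e m + 1) := by
    intro m h
    obtain ⟨q, rfl⟩ := hm m h
    rw [he, show e m₀ + q * S.period + 1 = e m₀ + 1 + q * S.period by ring,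
      PlaneStack.forbidden_add_mul]
    exact hforb₀
  have hcon : ∀ P, S.Contractible (P.1, e P.2) ↔ S'.Contractible P := by
    intro P
    unfold PlaneStack.Contractible
    refine forall_congr' fun p => forall_congr' fun q => ?_
    rw [hper, ← hR.conn_iff hn P, he]
  have hclo : ∀ P, S.Closed (P.1, e P.2) ↔ S'.Closed P := by
    intro P
    constructor
    · intro h Q hQ
      rw [hforb]
      exact h _ ((hR.conn_iff hn P Q).2 hQ)
    · intro h Q hQ
      rcases hR.conn_cases hn hQ with ⟨Q', h', rfl⟩ | ⟨m, _, _, _, h', -, -, -, -, x, i, -, -, rfl⟩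
      · have := h Q' h'
        rwa [hforb] at this
      · exact hinner m h'
  have hcur : ∀ P Q, S.curve (P.1, e P.2) = S.curve (Q.1, e Q.2) ↔ S'.curve P = S'.curve Q := by
    intro P Q
    rw [PlaneStack.curve_eq_iff, PlaneStack.curve_eq_iff]
    refine exists_congr fun p => exists_congr fun q => ?_
    rw [← hR.conn_iff hn P, he]
  have hiloop : ∀ i, InnerLoop A B i → S.Closed (i, e m₀ + 1) := by
    intro i hi Q hQ
    obtain ⟨j, rfl, -⟩ := hR.conn_inner hm₀ hB hA hi hQ
    exact hforb₀
  have hicon : ∀ i, InnerLoop A B i → (S.Contractible (i, e m₀ + 1) ↔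
      InnerContractible A B i) := by
    intro i hi
    constructor
    · intro h p hp
      refine (h p 0 ?_).1
      simp only [zero_mul, add_zero]
      exact (hR.conn_inner_iff hm₀ hB hA hi _).2 hp
    · intro h p q hpq
      obtain ⟨j, h1, h2⟩ := hR.conn_inner hm₀ hB hA hi hpq
      obtain ⟨h3, h4⟩ := Prod.ext_iff.1 h1
      simp only at h3 h4
      rw [← h3] at h2
      exact ⟨h p h2, by linarith⟩
  have hicur : ∀ i j, InnerLoop A B i → (S.curve (i, e m₀ + 1) = S.curve (j, e m₀ + 1) ↔
      innerCurve A B i = innerCurve A B j) := by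
    intro i j hi
    rw [PlaneStack.curve_eq_iff, innerCurve_eq_iff]
    constructor
    · rintro ⟨p, q, hpq⟩
      obtain ⟨k, h1, h2⟩ := hR.conn_inner hm₀ hB hA hi hpq
      obtain ⟨h3, h4⟩ := Prod.ext_iff.1 h1
      simp only at h3
      exact ⟨p, by rwa [h3]⟩
    · rintro ⟨p, hp⟩
      refine ⟨p, 0, ?_⟩
      simp only [zero_mul, add_zero]
      exact (hR.conn_inner_iff hm₀ hB hA hi _).2 hp
  -- The closed curves of `S` are of two kinds. Those that meet a surviving row correspond to the
  -- closed curves of `S'`, and those inside a contracted pair correspond to the closed curves of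
  -- `A` on `B`. Only one pair modulo the period is contracted, so the latter are counted once.
  set S₁ := {L | ∃ P : ℤ × ℤ, L = S.curve (P.1, e P.2) ∧ (S'.Closed P ∧ (S'.Contractible P ↔ c))}
  set S₂ := {L | ∃ i, L = S.curve (i, e m₀ + 1) ∧ (InnerLoop A B i ∧
    (InnerContractible A B i ↔ c))}
  have hunion : S.curves c = S₁ ∪ S₂ := by
    ext L
    constructor
    · rintro ⟨P, rfl, hP, hc⟩
      have key : (∃ Q : ℤ × ℤ, LConn S.layers P (Q.1, e Q.2)) → S.curve P ∈ S₁ := by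
        rintro ⟨Q, hQ⟩
        refine ⟨Q, PlaneStack.curve_eq_of_conn hQ, ?_, ?_⟩
        · rwa [← hclo, ← PlaneStack.closed_iff_of_conn hQ]
        · rwa [← hcon, ← PlaneStack.contractible_iff_of_conn hQ]
      rcases PlaneStack.point_cases hR he hm₀ hB hA hm P with h | ⟨i, q, hi, rfl⟩
      · exact Or.inl (key h)
      · right
        have e1 := PlaneStack.curve_shift (S := S) (i, e m₀ + 1) 0 q
        have e2 := PlaneStack.contractible_shift_iff (S := S) (i, e m₀ + 1) 0 q
        simp only [zero_mul, add_zero] at e1 e2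
        refine ⟨i, e1, hi, ?_⟩
        rw [← hicon _ hi, ← e2]
        exact hc
    · rintro (⟨P, rfl, h1, h2⟩ | ⟨i, rfl, h1, h2⟩)
      · exact ⟨_, rfl, (hclo P).2 h1, by rwa [hcon]⟩
      · exact ⟨_, rfl, hiloop i h1, by rwa [hicon i h1]⟩
  have hdisj : Disjoint S₁ S₂ := by
    rw [Set.disjoint_left]
    rintro _ ⟨P, rfl, -⟩ ⟨i, h, hi, -⟩
    obtain ⟨p, q, hpq⟩ := (PlaneStack.curve_eq_iff _ _).1 h.symm
    obtain ⟨j, h1, -⟩ := hR.conn_inner hm₀ hB hA hi hpq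
    have h2 := (Prod.ext_iff.1 h1).2
    simp only [← he] at h2
    exact hR.ne_succ hm₀ _ h2
  have hfin := S.finite_curves hn c
  rw [hunion] at hfin ⊢
  rw [Set.ncard_union_eq hdisj (hfin.subset Set.subset_union_left)
    (hfin.subset Set.subset_union_right)]
  congr 1
  · exact ncard_classes _ _ _ _ id (fun P h => h) (fun P Q _ _ => hcur P Q)
      (fun P h => ⟨P, h, rfl⟩)
  · exact ncard_classes _ _ _ _ id (fun i h => h) (fun i j hi _ => hicur i j hi.1)
      (fun i h => ⟨i, h, rfl⟩)

end AffineDiagram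

end

/-! ### Associativity on the cylinder and cyclic symmetry on the torus. -/

section

namespace AffineDiagram

variable {n : ℕ}

/-! ### Stacks of two and three diagrams on the cylinder -/

/-- Two stacked diagrams on the cylinder. -/
def cylinderStack (A B : AffineDiagram n) : PlaneStack n where
  layers := stackLayers A B
  period := 0
  forbidden h := h ≠ 1
  layers_add m := by rw [add_zero]
  forbidden_add h := by rw [add_zero]
  finite := ⟨{1}, Set.finite_singleton 1, fun h hh => ⟨0, by simpa using hh⟩⟩

theorem innerLoop_iff_closed (A B : AffineDiagram n) (i : ℤ) :
    InnerLoop A B i ↔ (cylinderStack A B).Closed (i, 1) := by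
  unfold InnerLoop PlaneStack.Closed
  simp only [cylinderStack, ← stackConn_eq, ne_eq, not_not]
  constructor
  · intro h Q hQ
    rcases eq_outer_or (hQ.height ⟨by simp, by simp⟩) with ⟨z, rfl⟩ | h1
    · exact (h z hQ).elim
    · exact h1
  · intro h x hx
    have := h _ hx
    cases x <;> simp [outer] at this

/-- On the cylinder the period is 0, so the vertical part of contractibility is void. -/
theorem innerContractible_iff (A B : AffineDiagram n) (i : ℤ) :
    InnerContractible A B i ↔ (cylinderStack A B).Contractible (i, 1) := by
  simp only [InnerContractible, PlaneStack.Contractible, cylinderStack, ← stackConn_eq, mul_zero,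
    add_zero, and_true, forall_const]

theorem ncard_cylinderStack_curves (A B : AffineDiagram n) (c : Prop) :
    ((cylinderStack A B).curves c).ncard = innerCount A B c := by
  symm
  refine ncard_classes _ _ _ _ (fun i => (i, 1)) ?_ ?_ ?_
  · rintro i ⟨h1, h2⟩
    rw [← innerLoop_iff_closed, ← innerContractible_iff]
    exact ⟨h1, h2⟩
  · intro i j _ _
    rw [innerCurve_eq_iff, PlaneStack.curve_eq_iff]
    simp [cylinderStack, ← stackConn_eq]
  · rintro ⟨i, h⟩ ⟨h1, h2⟩
    have h3 := h1 _ .refl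
    simp only [cylinderStack, ne_eq, not_not] at h3
    subst h3
    refine ⟨i, ?_, rfl⟩
    rw [innerLoop_iff_closed, innerContractible_iff]
    exact ⟨h1, h2⟩

/-- Three stacked diagrams on the cylinder. -/
def cylinderStack₃ (A B C : AffineDiagram n) : PlaneStack n where
  layers m := if m = 2 then some A else stackLayers B C m
  period := 0
  forbidden h := h ≠ 1 ∧ h ≠ 2
  layers_add m := by rw [add_zero]
  forbidden_add h := by rw [add_zero]
  finite := ⟨{1, 2}, Set.toFinite _, fun h hh => ⟨0, by
    simp only [zero_mul, add_zero, Set.mem_insert_iff, Set.mem_singleton_iff]; tauto⟩⟩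

/-- Row 2, between `A` and `B`, becomes interior and is skipped by the embedding. `refines_lower`
skips row 1 of the same stack of three, which allows the two bracketings to be compared. -/
theorem refines_upper {A B C E : AffineDiagram n} (hE : IsComposite A B E) :
    Refines (cylinderStack₃ A B C).layers (cylinderStack E C).layers
      (fun h => if h ≤ 1 then h else h + 1) where
  strictMono a b hab := by
    simp only
    split_ifs <;> omega
  step m := by
    rcases lt_trichotomy m 1 with h | rfl | h
    · left
      rw [if_pos (by omega), if_pos (by omega)]
      refine ⟨rfl, ?_⟩
      simp only [cylinderStack₃, cylinderStack, stackLayers]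
      rw [if_neg (show ¬ m = 2 by omega), if_neg (show ¬ m = 1 by omega),
        if_neg (show ¬ m = 1 by omega)]
    · right
      exact ⟨rfl, A, B, E, rfl, rfl, rfl, hE⟩
    · left
      rw [if_neg (by omega), if_neg (by omega)]
      refine ⟨rfl, ?_⟩
      simp only [cylinderStack₃, cylinderStack, stackLayers]
      rw [if_neg (by omega), if_neg (by omega), if_neg (by omega), if_neg (by omega),
        if_neg (by omega)]
  cover h := by
    rcases lt_trichotomy h 2 with h1 | rfl | h1
    · exact ⟨h, Or.inl (by rw [if_pos (by omega)])⟩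
    · exact ⟨1, Or.inr ⟨rfl, rfl⟩⟩
    · exact ⟨h - 1, Or.inl (by rw [if_neg (by omega)]; ring)⟩

theorem refines_lower {A B C E : AffineDiagram n} (hE : IsComposite B C E) :
    Refines (cylinderStack₃ A B C).layers (cylinderStack A E).layers
      (fun h => if h ≤ 0 then h else h + 1) where
  strictMono a b hab := by
    simp only
    split_ifs <;> omega
  step m := by
    rcases lt_trichotomy m 0 with h | rfl | h
    · left
      rw [if_pos (by omega), if_pos (by omega)]
      refine ⟨rfl, ?_⟩
      simp only [cylinderStack₃, cylinderStack, stackLayers]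
      rw [if_neg (by omega), if_neg (by omega), if_neg (by omega), if_neg (by omega),
        if_neg (by omega)]
    · right
      exact ⟨rfl, B, C, E, rfl, rfl, rfl, hE⟩
    · left
      rw [if_neg (by omega), if_neg (by omega)]
      refine ⟨rfl, ?_⟩
      simp only [cylinderStack₃, cylinderStack, stackLayers]
      rcases eq_or_ne m 1 with rfl | h1
      · rfl
      · rw [if_neg (by omega), if_neg (by omega), if_neg (by omega), if_neg (by omega),
          if_neg (by omega)]
  cover h := by
    rcases lt_trichotomy h 1 with h1 | rfl | h1
    · exact ⟨h, Or.inl (by rw [if_pos (by omega)])⟩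
    · exact ⟨0, Or.inr ⟨rfl, rfl⟩⟩
    · exact ⟨h - 1, Or.inl (by rw [if_neg (by omega)]; ring)⟩

/-- Both sides count the closed curves in the stack of three: those that disappear in the first
composition and those that disappear in the second. The case `c = True` compares exponents of `[2]`,
the case `c = False` compares bands. -/
theorem innerCount_assoc (hn : 0 < n) {A B C E E' : AffineDiagram n} (hE : IsComposite A B E)
    (hE' : IsComposite B C E') (c : Prop) :
    innerCount E C c + innerCount A B c = innerCount A E' c + innerCount B C c := by
  have h1 := PlaneStack.ncard_curves_of_refines hn (cylinderStack₃ A B C) (cylinderStack E C)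
    (refines_upper hE) (by simp [cylinderStack, cylinderStack₃])
    (by simp [cylinderStack, cylinderStack₃]) (fun h => by
      simp only [cylinderStack, cylinderStack₃]
      split_ifs <;> omega) (m₀ := 1) (A := A) (B := B) rfl rfl rfl (fun m hm => ⟨0, by
        simp only [zero_mul, add_zero]
        split_ifs at hm <;> omega⟩) (by simp [cylinderStack₃]) c
  have h2 := PlaneStack.ncard_curves_of_refines hn (cylinderStack₃ A B C) (cylinderStack A E')
    (refines_lower hE') (by simp [cylinderStack, cylinderStack₃])
    (by simp [cylinderStack, cylinderStack₃]) (fun h => by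
      simp only [cylinderStack, cylinderStack₃]
      split_ifs <;> omega) (m₀ := 0) (A := B) (B := C) rfl rfl rfl (fun m hm => ⟨0, by
        simp only [zero_mul, add_zero]
        split_ifs at hm <;> omega⟩) (by simp [cylinderStack₃]) c
  rw [ncard_cylinderStack_curves] at h1 h2
  rw [← h1, ← h2]

theorem stackLoops_assoc (hn : 0 < n) {A B C E E' : AffineDiagram n} (hE : IsComposite A B E)
    (hE' : IsComposite B C E') :
    stackLoops E C + stackLoops A B = stackLoops A E' + stackLoops B C := by
  simp only [← innerCount_true]
  exact innerCount_assoc hn hE hE' True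

/-- Stacking diagrams is associative. -/
theorem IsComposite.assoc (hn : 0 < n) {A B C E E' G : AffineDiagram n} (hE : IsComposite A B E)
    (hE' : IsComposite B C E') (hG : IsComposite E C G) : IsComposite A E' G := by
  constructor
  · intro x
    have h1 := hG.1 x
    rw [stackConn_eq] at h1 ⊢
    have h2 := ((refines_upper (C := C) hE).conn_iff hn _ _).2 h1
    refine ((refines_lower (A := A) hE').conn_iff hn _ _).1 ?_
    convert h2 using 2 <;> [cases x; cases G.pair x] <;> rfl
  · have h := innerCount_assoc hn hE hE' False
    simp only [innerCount_false] at h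
    rw [hG.2, hE.2, hE'.2]
    omega

/-! ### Diagrams on the torus -/

/-- One diagram on the torus. -/
def torusStack (D : AffineDiagram n) : PlaneStack n where
  layers _ := some D
  period := 1
  forbidden _ := False
  layers_add _ := rfl
  forbidden_add _ := Iff.rfl
  finite := ⟨{0}, Set.finite_singleton 0, fun h _ => ⟨-h, by simp⟩⟩

/-- Two stacked diagrams on the torus. -/
def torusStack₂ (A B : AffineDiagram n) : PlaneStack n where
  layers m := if Even m then some B else some A
  period := 2
  forbidden _ := False
  layers_add m := by simp
  forbidden_add _ := Iff.rfl
  finite := ⟨{0, 1}, Set.toFinite _, fun h _ => ⟨-(h / 2), by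
    simp only [Set.mem_insert_iff, Set.mem_singleton_iff]; omega⟩⟩

/-- Cutting the torus along its even rows shows `A` on top of `B`, cutting along its odd rows shows
`B` on top of `A`. The symmetry of the trace compares the two cuts. -/
theorem refines_torusStack₂ {A B E : AffineDiagram n} (hE : IsComposite A B E) :
    Refines (torusStack₂ A B).layers (torusStack E).layers (fun h => 2 * h) where
  strictMono a b hab := by simp only; omega
  step m := Or.inr ⟨by ring, A, B, E, by simp [torusStack₂], by simp [torusStack₂],
    rfl, hE⟩
  cover h := by
    rcases Int.even_or_odd' h with ⟨m, h | h⟩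
    · exact ⟨m, Or.inl h⟩
    · exact ⟨m, Or.inr ⟨h, by ring⟩⟩

theorem refines_torusStack₂' {A B E : AffineDiagram n} (hE : IsComposite B A E) :
    Refines (torusStack₂ A B).layers (torusStack E).layers (fun h => 2 * h + 1) where
  strictMono a b hab := by simp only; omega
  step m := Or.inr ⟨by ring, B, A, E, by simp [torusStack₂],
    by simp [torusStack₂], rfl, hE⟩
  cover h := by
    rcases Int.even_or_odd' h with ⟨m, h | h⟩
    · exact ⟨m - 1, Or.inr ⟨by rw [h]; ring, by ring⟩⟩
    · exact ⟨m, Or.inl h⟩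

theorem torusPeriods_subset_iff (D : AffineDiagram n) (i : ℤ) :
    torusPeriods D i ⊆ {0} ↔ (torusStack D).Contractible (i, 0) := by
  simp only [torusPeriods, PlaneStack.Contractible, torusStack, torusConn_eq, Set.subset_def,
    Set.mem_ofPred_eq, Set.mem_singleton_iff, Prod.forall, mul_one, zero_add, Prod.mk_eq_zero]

theorem torusStack_closed (D : AffineDiagram n) (P : ℤ × ℤ) : (torusStack D).Closed P :=
  fun _ _ h => h

theorem torusCurve_eq_iff (D : AffineDiagram n) (i j : ℤ) :
    torusCurve D i = torusCurve D j ↔ (torusStack D).curve (i, 0) = (torusStack D).curve (j, 0) := by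
  have hmem : ∀ i k, k ∈ torusCurve D i ↔ (k, 0) ∈ (torusStack D).curve (i, 0) := by
    intro i k
    simp [torusCurve, PlaneStack.curve, torusStack, torusConn_eq]
  constructor
  · intro h
    have h1 : j ∈ torusCurve D i := by rw [h, hmem]; exact PlaneStack.mem_curve_self _
    rw [hmem] at h1
    exact (PlaneStack.curve_eq_iff _ _).2 h1
  · intro h
    ext k
    rw [hmem, hmem, h]

theorem ncard_torusStack_curves (D : AffineDiagram n) (c : Prop) :
    Set.ncard {L : Set ℤ | ∃ i, L = torusCurve D i ∧ (torusPeriods D i ⊆ {0} ↔ c)} =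
      ((torusStack D).curves c).ncard := by
  refine ncard_classes _ _ _ _ (fun i => (i, 0)) ?_ ?_ ?_
  · intro i h
    rw [← torusPeriods_subset_iff]
    exact ⟨torusStack_closed D _, h⟩
  · exact fun i j _ _ => torusCurve_eq_iff D i j
  · rintro ⟨i, h⟩ ⟨-, h2⟩
    have e1 := PlaneStack.curve_shift (S := torusStack D) (i, h) 0 (-h)
    have e2 := PlaneStack.contractible_shift_iff (S := torusStack D) (i, h) 0 (-h)
    simp only [torusStack, zero_mul, add_zero, mul_one, add_neg_cancel] at e1 e2
    refine ⟨i, ?_, e1⟩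
    rw [torusPeriods_subset_iff]
    exact (iff_congr e2 Iff.rfl).2 h2

theorem torusContractible_eq (D : AffineDiagram n) :
    torusContractible D = ((torusStack D).curves True).ncard := by
  rw [← ncard_torusStack_curves, torusContractible]
  simp only [iff_true]

theorem torusNoncontractible_eq (D : AffineDiagram n) :
    torusNoncontractible D = ((torusStack D).curves False).ncard + D.bands := by
  rw [← ncard_torusStack_curves, torusNoncontractible]
  simp only [iff_false]

/-- The curves can be moved off the seam. -/
def PlaneStack.Vertical (S : PlaneStack n) : Prop :=
  ∀ (P : ℤ × ℤ) (p q : ℤ), LConn S.layers P (P.1 + p * n, P.2 + q * S.period) → p = 0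

/-- The curves are parallel to the circle of the cylinder. -/
def PlaneStack.Horizontal (S : PlaneStack n) : Prop :=
  ∀ (P : ℤ × ℤ) (p q : ℤ), LConn S.layers P (P.1 + p * n, P.2 + q * S.period) → q * S.period = 0

theorem PlaneStack.conn_shift_iff {S : PlaneStack n} {P Q : ℤ × ℤ} (p q : ℤ) :
    LConn S.layers (P.1 + p * n, P.2 + q * S.period) (Q.1 + p * n, Q.2 + q * S.period) ↔
      LConn S.layers P Q := by
  refine ⟨fun h => ?_, fun h => PlaneStack.conn_shift h p q⟩
  convert PlaneStack.conn_shift h (-p) (-q) using 1 <;> ext <;> simp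

section

variable {S S' : PlaneStack n} {e : ℤ → ℤ} (hR : Refines S.layers S'.layers e)
    (he : ∀ h q, e (h + q * S'.period) = e h + q * S.period) {m₀ : ℤ} {A B : AffineDiagram n}
    (hm₀ : e (m₀ + 1) = e m₀ + 2) (hB : S.layers (e m₀) = some B)
    (hA : S.layers (e m₀ + 1) = some A) (hm : ∀ m, e (m + 1) = e m + 2 → ∃ q, m = m₀ +
      q * S'.period)
include hR he hm₀ hB hA hm

/-- Curves that meet a surviving row can be tested in `S'`. An essential loop inside a contracted
pair is invisible there, since composition turns it into a band, and has to be excluded separately.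
-/
theorem PlaneStack.vertical_iff_of_refines (hn : 0 < n) : S.Vertical ↔ S'.Vertical ∧
    ∀ i, InnerLoop A B i → InnerContractible A B i := by
  constructor
  · intro h
    constructor
    · intro P p q hP
      have := (hR.conn_iff hn _ _).2 hP
      rw [he] at this
      exact h _ p q this
    · intro i hi p hp
      have := (hR.conn_inner_iff hm₀ hB hA hi _).2 hp
      exact h (i, e m₀ + 1) p 0 (by simpa using this)
  · rintro ⟨h1, h2⟩ P p q hP
    rcases PlaneStack.point_cases hR he hm₀ hB hA hm P with ⟨Q, hQ⟩ | ⟨i, r, hi, rfl⟩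
    · refine h1 Q p q ((hR.conn_iff hn _ _).1 ?_)
      rw [he]
      exact (hQ.symm.trans hP).trans (PlaneStack.conn_shift hQ p q)
    · have h3 : LConn S.layers (i, e m₀ + 1) (i + p * n, e m₀ + 1 + q * S.period) := by
        rw [← PlaneStack.conn_shift_iff 0 r]
        convert hP using 2 <;> simp
        ring
      obtain ⟨j, h4, h5⟩ := hR.conn_inner hm₀ hB hA hi h3
      obtain rfl : i + p * n = j := (Prod.ext_iff.1 h4).1
      exact h2 i hi p h5

/-- A loop inside a contracted pair never changes its height, so it is horizontal in any case and
adds no condition. -/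
theorem PlaneStack.horizontal_iff_of_refines (hn : 0 < n)
    (hper : ∀ q, q * S'.period = 0 ↔ q * S.period = 0) : S.Horizontal ↔ S'.Horizontal := by
  constructor
  · intro h P p q hP
    have := (hR.conn_iff hn _ _).2 hP
    rw [he] at this
    exact (hper q).2 (h _ p q this)
  · intro h P p q hP
    rcases PlaneStack.point_cases hR he hm₀ hB hA hm P with ⟨Q, hQ⟩ | ⟨i, r, hi, rfl⟩
    · refine (hper q).1 (h Q p q ((hR.conn_iff hn _ _).1 ?_))
      rw [he]
      exact (hQ.symm.trans hP).trans (PlaneStack.conn_shift hQ p q)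
    · have h3 : LConn S.layers (i, e m₀ + 1) (i + p * n, e m₀ + 1 + q * S.period) := by
        rw [← PlaneStack.conn_shift_iff 0 r]
        convert hP using 2 <;> simp
        ring
      obtain ⟨j, h4, h5⟩ := hR.conn_inner hm₀ hB hA hi h3
      have := (Prod.ext_iff.1 h4).2
      simpa using this

end

theorem forall_innerContractible_iff (hn : 0 < n) (A B : AffineDiagram n) :
    (∀ i, InnerLoop A B i → InnerContractible A B i) ↔ stackBands A B = 0 := by
  have hfin := (cylinderStack A B).finite_curves hn False
  rw [← innerCount_false, ← ncard_cylinderStack_curves, Set.ncard_eq_zero hfin]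
  constructor
  · intro h
    refine Set.eq_empty_of_forall_notMem ?_
    rintro _ ⟨⟨i, k⟩, -, h1, h2⟩
    have h3 := h1 _ .refl
    simp only [cylinderStack, ne_eq, not_not] at h3
    subst h3
    rw [← innerContractible_iff] at h2
    exact h2.1 (h i ((innerLoop_iff_closed A B i).2 h1))
  · intro h i hi
    by_contra hc
    have : (cylinderStack A B).curve (i, 1) ∈ (cylinderStack A B).curves False :=
      ⟨_, rfl, (innerLoop_iff_closed A B i).1 hi, by
        rw [← innerContractible_iff]; exact iff_of_false hc id⟩
    rw [h] at this
    exact this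

/-- The subgroup is generated by the periods at base points of height 0, together with `(1, 0)` if
there are bands. A vertical shift brings every base point to height 0. -/
theorem homology_le_vertical_iff (D : AffineDiagram n) :
    D.torusDiagram.homology ≤ AddSubgroup.zmultiples (0, 1) ↔
      (torusStack D).Vertical ∧ D.bands = 0 := by
  have hz : ∀ w : ℤ × ℤ, w ∈ AddSubgroup.zmultiples ((0, 1) : ℤ × ℤ) ↔ w.1 = 0 := by
    intro w
    rw [AddSubgroup.mem_zmultiples_iff]
    constructor
    · rintro ⟨k, rfl⟩; simp
    · intro h; exact ⟨w.2, by ext <;> simp [h]⟩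
  simp only [torusDiagram, AddSubgroup.closure_le, Set.subset_def, SetLike.mem_coe, hz]
  constructor
  · intro h
    constructor
    · rintro ⟨i, k⟩ p q hp
      refine h (p, q) (Or.inl ⟨i, ?_⟩)
      rw [torusPeriods, torusConn_eq]
      have := PlaneStack.conn_shift (S := torusStack D) hp 0 (-k)
      simpa [torusStack] using this
    · by_contra hb
      exact one_ne_zero (h (1, 0) (Or.inr ⟨by omega, rfl⟩))
  · rintro ⟨h1, h2⟩ w (⟨i, hi⟩ | ⟨h, rfl⟩)
    · rw [torusPeriods, torusConn_eq] at hi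
      refine h1 (i, 0) w.1 w.2 ?_
      simpa [torusStack] using hi
    · omega

theorem homology_le_horizontal_iff (D : AffineDiagram n) :
    D.torusDiagram.homology ≤ AddSubgroup.zmultiples (1, 0) ↔ (torusStack D).Horizontal := by
  have hz : ∀ w : ℤ × ℤ, w ∈ AddSubgroup.zmultiples ((1, 0) : ℤ × ℤ) ↔ w.2 = 0 := by
    intro w
    rw [AddSubgroup.mem_zmultiples_iff]
    constructor
    · rintro ⟨k, rfl⟩; simp
    · intro h; exact ⟨w.1, by ext <;> simp [h]⟩
  simp only [torusDiagram, AddSubgroup.closure_le, Set.subset_def, SetLike.mem_coe, hz]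
  constructor
  · rintro h ⟨i, k⟩ p q hp
    have h2 := h (p, q) (Or.inl ⟨i, by
      rw [torusPeriods, torusConn_eq]
      have := PlaneStack.conn_shift (S := torusStack D) hp 0 (-k)
      simpa [torusStack] using this⟩)
    simp only at h2
    rw [h2, zero_mul]
  · rintro h1 w (⟨i, hi⟩ | ⟨h, rfl⟩)
    · rw [torusPeriods, torusConn_eq] at hi
      have := h1 (i, 0) w.1 w.2 (by simpa [torusStack] using hi)
      simpa [torusStack] using this
    · rfl

/-- The value of the trace on a diagram. -/
def traceValue (D : AffineDiagram n) : ℤ[T;T⁻¹] :=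
  DiagramAlgebra.quantumTwo ^ D.torusContractible * traceWeight n D.torusDiagram

/-- The weight depends on the homology only through the two axes that may contain it, so no finer
comparison of the two cuts of the torus is needed. -/
theorem traceWeight_congr {E E' : TorusTraceDiagram} (hl : E.loops = E'.loops)
    (hv : E.homology ≤ AddSubgroup.zmultiples (0, 1) ↔
      E'.homology ≤ AddSubgroup.zmultiples (0, 1))
    (hh : E.homology ≤ AddSubgroup.zmultiples (1, 0) ↔
      E'.homology ≤ AddSubgroup.zmultiples (1, 0)) : traceWeight n E = traceWeight n E' := by
  unfold traceWeight
  rw [hl]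
  split_ifs <;> first | rfl | (exfalso; tauto)

/-- The trace is symmetric on the products of diagrams. -/
theorem traceValue_comm (hn : 0 < n) {A B E E' : AffineDiagram n} (hE : IsComposite A B E)
    (hE' : IsComposite B A E') :
    DiagramAlgebra.quantumTwo ^ stackLoops A B * traceValue E =
      DiagramAlgebra.quantumTwo ^ stackLoops B A * traceValue E' := by
  have he : ∀ h q : ℤ, 2 * (h + q * (torusStack E).period) =
      2 * h + q * (torusStack₂ A B).period := fun h q => by simp only [torusStack, torusStack₂]; ring
  have he' : ∀ h q : ℤ, 2 * (h + q * (torusStack E').period) + 1 =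
      2 * h + 1 + q * (torusStack₂ A B).period :=
    fun h q => by simp only [torusStack, torusStack₂]; ring
  have hper : ∀ (E : AffineDiagram n) (q : ℤ), q * (torusStack E).period = 0 ↔
      q * (torusStack₂ A B).period = 0 := fun E q => by simp [torusStack, torusStack₂]
  have hA : (torusStack₂ A B).layers 1 = some A := by simp [torusStack₂]
  have hB : (torusStack₂ A B).layers (2 * 0) = some B := by simp [torusStack₂]
  have hB' : (torusStack₂ A B).layers 2 = some B := by simp [torusStack₂]
  have hm : ∀ m : ℤ, ∃ q : ℤ, m = 0 + q * 1 := fun m => ⟨m, by ring⟩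
  have c1 := fun c => PlaneStack.ncard_curves_of_refines hn (torusStack₂ A B) (torusStack E)
    (refines_torusStack₂ hE) he (hper E) (fun _ => Iff.rfl) (m₀ := 0) (by norm_num) hB hA
    (fun m _ => hm m) (fun h => h) c
  have c2 := fun c => PlaneStack.ncard_curves_of_refines hn (torusStack₂ A B) (torusStack E')
    (refines_torusStack₂' hE') he' (hper E') (fun _ => Iff.rfl) (m₀ := 0) (by norm_num) hA hB'
    (fun m _ => hm m) (fun h => h) c
  have v1 := PlaneStack.vertical_iff_of_refines (S := torusStack₂ A B) (S' := torusStack E)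
    (refines_torusStack₂ hE) he (m₀ := 0) (by norm_num) hB hA (fun m _ => hm m) hn
  have v2 := PlaneStack.vertical_iff_of_refines (S := torusStack₂ A B) (S' := torusStack E')
    (refines_torusStack₂' hE') he' (m₀ := 0) (by norm_num) hA hB' (fun m _ => hm m) hn
  have h1 := PlaneStack.horizontal_iff_of_refines (S := torusStack₂ A B) (S' := torusStack E)
    (refines_torusStack₂ hE) he (m₀ := 0) (by norm_num) hB hA (fun m _ => hm m) hn (hper E)
  have h2 := PlaneStack.horizontal_iff_of_refines (S := torusStack₂ A B) (S' := torusStack E')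
    (refines_torusStack₂' hE') he' (m₀ := 0) (by norm_num) hA hB' (fun m _ => hm m) hn (hper E')
  rw [forall_innerContractible_iff hn] at v1 v2
  have ct := (c1 True).symm.trans (c2 True)
  have cf := (c1 False).symm.trans (c2 False)
  rw [innerCount_true, innerCount_true, ← torusContractible_eq, ← torusContractible_eq] at ct
  rw [innerCount_false, innerCount_false] at cf
  unfold traceValue
  rw [← mul_assoc, ← mul_assoc, ← pow_add, ← pow_add, add_comm, ct, add_comm]
  congr 1
  have e1 := hE.2
  have e2 := hE'.2
  refine traceWeight_congr ?_ ?_ ?_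
  · simp only [torusDiagram]
    rw [torusNoncontractible_eq, torusNoncontractible_eq]
    omega
  -- The composite has no bands exactly if `A` and `B` have none and none arises between them. The
  -- last condition is the one that accompanies verticality in `v1` and `v2`.
  · rw [homology_le_vertical_iff, homology_le_vertical_iff]
    have hv := v1.symm.trans v2
    constructor
    · rintro ⟨h, hb⟩
      have := hv.1 ⟨h, by omega⟩
      exact ⟨this.1, by omega⟩
    · rintro ⟨h, hb⟩
      have := hv.2 ⟨h, by omega⟩
      exact ⟨this.1, by omega⟩
  · rw [homology_le_horizontal_iff, homology_le_horizontal_iff, ← h1, ← h2]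

/-! ### Reflection of stacked diagrams -/

theorem _root_.Node.flip_flip (x : Node) : x.flip.flip = x := by cases x <;> rfl

theorem flip_flip (D : AffineDiagram n) : D.flip.flip = D := by
  ext x
  · simp [flip, Node.flip_flip]
  · rfl

theorem flip_pair (D : AffineDiagram n) (x : Node) : D.flip.pair x = (D.pair x.flip).flip := rfl

theorem flip_bands (D : AffineDiagram n) : D.flip.bands = D.bands := rfl

theorem StackConn.flip {A B : AffineDiagram n} {P Q : ℤ × ℤ} (h : StackConn A B P Q) :
    StackConn B.flip A.flip (P.1, 2 - P.2) (Q.1, 2 - Q.2) := by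
  induction h with
  | refl => exact .refl
  | tail _ h ih =>
    refine ih.tail ?_
    have h1 : ∀ y : Node, ((place 1 y).1, 2 - (place 1 y).2) = place 0 y.flip := by
      rintro (_ | _) <;> simp [place, Node.flip]
    have h0 : ∀ y : Node, ((place 0 y).1, 2 - (place 0 y).2) = place 1 y.flip := by
      rintro (_ | _) <;> simp [place, Node.flip]
    rcases h with ⟨x, rfl, rfl⟩ | ⟨x, rfl, rfl⟩
    · exact Or.inr ⟨x.flip, h1 x, by rw [h1, flip_pair, Node.flip_flip]⟩
    · exact Or.inl ⟨x.flip, h0 x, by rw [h0, flip_pair, Node.flip_flip]⟩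

theorem stackConn_flip_iff (A B : AffineDiagram n) (P Q : ℤ × ℤ) :
    StackConn B.flip A.flip P Q ↔ StackConn A B (P.1, 2 - P.2) (Q.1, 2 - Q.2) := by
  constructor
  · intro h
    have := h.flip
    rwa [flip_flip, flip_flip] at this
  · intro h
    simpa using h.flip

theorem outer_flip (x : Node) : ((outer x).1, 2 - (outer x).2) = outer x.flip := by
  cases x <;> simp [outer, Node.flip]

theorem innerLoop_flip_iff (A B : AffineDiagram n) (i : ℤ) :
    InnerLoop B.flip A.flip i ↔ InnerLoop A B i := by
  simp only [InnerLoop, stackConn_flip_iff, outer_flip]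
  constructor
  · intro h x
    have := h x.flip
    rwa [Node.flip_flip] at this
  · exact fun h x => h x.flip

theorem innerCount_flip (A B : AffineDiagram n) (c : Prop) :
    innerCount B.flip A.flip c = innerCount A B c := by
  simp only [innerCount, innerLoop_flip_iff, innerCurve, InnerContractible, stackConn_flip_iff,
    show (2 : ℤ) - 1 = 1 from rfl]

theorem stackLoops_flip (A B : AffineDiagram n) :
    stackLoops B.flip A.flip = stackLoops A B := by
  rw [← innerCount_true, ← innerCount_true, innerCount_flip]

theorem IsComposite.flip {A B E : AffineDiagram n} (h : IsComposite A B E) :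
    IsComposite B.flip A.flip E.flip := by
  constructor
  · intro x
    rw [stackConn_flip_iff, outer_flip, outer_flip, flip_pair, Node.flip_flip]
    exact h.1 x.flip
  · have h1 := innerCount_flip A B False
    rw [innerCount_false, innerCount_false] at h1
    rw [flip_bands, flip_bands, flip_bands, h.2, h1, add_comm B.bands]

theorem TorusConn.flip {D : AffineDiagram n} {P Q : ℤ × ℤ} (h : TorusConn D P Q) :
    TorusConn D.flip (P.1, -P.2) (Q.1, -Q.2) := by
  induction h with
  | refl => exact .refl
  | tail _ h ih =>
    refine ih.tail ?_
    obtain ⟨m, x, rfl, rfl⟩ := h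
    have h1 : ∀ y : Node, ((place m y).1, -(place m y).2) = place (-m - 1) y.flip := by
      rintro (_ | _) <;> simp [place, Node.flip, sub_eq_add_neg, add_comm]
    exact ⟨-m - 1, x.flip, h1 x, by rw [h1, flip_pair, Node.flip_flip]⟩

theorem torusConn_flip_iff (D : AffineDiagram n) (P Q : ℤ × ℤ) :
    TorusConn D.flip P Q ↔ TorusConn D (P.1, -P.2) (Q.1, -Q.2) := by
  constructor
  · intro h
    have := h.flip
    rwa [flip_flip] at this
  · intro h
    simpa using h.flip

theorem torusStack_conn_flip_iff (D : AffineDiagram n) (P Q : ℤ × ℤ) :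
    LConn (torusStack D.flip).layers P Q ↔ LConn (torusStack D).layers (P.1, -P.2) (Q.1, -Q.2) := by
  have := torusConn_flip_iff D P Q
  rwa [torusConn_eq, torusConn_eq] at this

theorem torusCurve_flip (D : AffineDiagram n) (i : ℤ) : torusCurve D.flip i = torusCurve D i := by
  ext j
  simp only [torusCurve, torusConn_flip_iff, Set.mem_ofPred_eq, neg_zero]
  refine exists_congr fun p => ⟨fun ⟨q, h⟩ => ⟨-q, h⟩, fun ⟨q, h⟩ => ⟨-q, by rwa [neg_neg]⟩⟩

theorem torusPeriods_flip_iff (D : AffineDiagram n) (i : ℤ) :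
    torusPeriods D.flip i ⊆ {0} ↔ torusPeriods D i ⊆ {0} := by
  simp only [torusPeriods, torusConn_flip_iff, Set.subset_def, Set.mem_ofPred_eq, neg_zero,
    Set.mem_singleton_iff, Prod.forall, Prod.mk_eq_zero]
  refine forall_congr' fun p => ⟨fun h q hq => ?_, fun h q hq => ?_⟩
  · have := h (-q) (by rwa [neg_neg])
    simpa using this
  · have := h (-q) hq
    simpa using this

/-- The trace is invariant under reflection. -/
theorem traceValue_flip (D : AffineDiagram n) : traceValue D.flip = traceValue D := by
  unfold traceValue
  have h1 : torusContractible D.flip = torusContractible D := by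
    simp only [torusContractible, torusCurve_flip, torusPeriods_flip_iff]
  have h2 : torusNoncontractible D.flip = torusNoncontractible D := by
    simp only [torusNoncontractible, torusCurve_flip, torusPeriods_flip_iff, flip_bands]
  rw [h1]
  congr 1
  refine traceWeight_congr h2 ?_ ?_
  · rw [homology_le_vertical_iff, homology_le_vertical_iff, flip_bands]
    refine and_congr_left fun _ => ?_
    unfold PlaneStack.Vertical
    simp only [torusStack_conn_flip_iff]
    simp only [torusStack, mul_one]
    constructor
    · rintro h ⟨i, k⟩ p q hp
      exact h (i, -k) p (-q) (by convert hp using 2 <;> simp; ring)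
    · rintro h ⟨i, k⟩ p q hp
      exact h (i, -k) p (-q) (by convert hp using 2; ring)
  · rw [homology_le_horizontal_iff, homology_le_horizontal_iff]
    unfold PlaneStack.Horizontal
    simp only [torusStack_conn_flip_iff]
    simp only [torusStack, mul_one]
    constructor
    · rintro h ⟨i, k⟩ p q hp
      exact neg_eq_zero.1 (h (i, -k) p (-q) (by convert hp using 2 <;> simp; ring))
    · rintro h ⟨i, k⟩ p q hp
      exact neg_eq_zero.1 (h (i, -k) p (-q) (by convert hp using 2; ring))

end AffineDiagram

end

/-! ### Tableaux as periodic noncrossing involutions of the line. -/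

section

namespace AffineDiagram

variable {n : ℕ}

/-! ### Periodic noncrossing involutions of the line -/

/-- A periodic noncrossing involution of the line; the fixed points are visible from infinity. -/
structure IsLine (n : ℕ) (σ : ℤ → ℤ) : Prop where
  invol : ∀ i, σ (σ i) = i
  shift : ∀ i, σ (i + n) = σ i + n
  arc : ∀ i k, i < k → k < σ i → σ k ≠ k ∧ i < σ k ∧ σ k < σ i

namespace IsLine

variable {σ : ℤ → ℤ} (h : IsLine n σ)
include h

theorem shift_mul (i p : ℤ) : σ (i + p * n) = σ i + p * n := by
  induction p using Int.induction_on with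
  | zero => simp
  | succ p ih => rw [add_mul, one_mul, ← add_assoc, h.shift, ih, add_assoc]
  | pred p ih =>
    have := h.shift (i + (-(p : ℤ) - 1) * n)
    rw [show i + (-(p : ℤ) - 1) * n + n = i + -(p : ℤ) * n by ring, ih] at this
    linarith

theorem arc' (i k : ℤ) (h1 : σ i < k) (h2 : k < i) : σ k ≠ k ∧ σ i < σ k ∧ σ k < i := by
  have := h.arc (σ i) k h1 (by rwa [h.invol])
  rwa [h.invol] at this

/-- An arc longer than `n` would cover `i + n` and hence cross its own translate; an arc of length
exactly `n` contradicts involutivity. -/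
theorem lt_add (i : ℤ) (hn : 0 < n) : σ i < i + n := by
  by_contra hc
  rcases eq_or_lt_of_le (not_lt.1 hc) with h1 | h1
  · have h2 := h.invol i
    rw [← h1, h.shift, ← h1] at h2
    omega
  · have := (h.arc i (i + n) (by omega) h1).2.2
    rw [h.shift] at this
    omega

theorem sub_lt (i : ℤ) (hn : 0 < n) : i - n < σ i := by
  have := h.lt_add (σ i) hn
  rw [h.invol] at this
  omega

theorem eq_of_eq_add {i p : ℤ} (hn : 0 < n) (hp : σ i = i + p * n) : p = 0 := by
  have h1 := h.lt_add i hn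
  have h2 := h.sub_lt i hn
  rw [hp] at h1 h2
  have h3 : p < 1 := by
    by_contra hc
    have : (1 : ℤ) * n ≤ p * n := by gcongr; omega
    omega
  have h4 : -1 < p := by
    by_contra hc
    have : p * n ≤ (-1 : ℤ) * n := by gcongr; omega
    omega
  omega

end IsLine

/-! ### Residues -/

theorem label_pos (r : Fin n) : 1 ≤ label r := by simp [label]

theorem label_le (r : Fin n) : label r ≤ n := by
  have := r.2
  simp only [label]
  omega

theorem label_lt_label {r s : Fin n} : label r < label s ↔ r < s := by
  simp [label]

/-- In the coordinates residue and sheet, the order of the line is lexicographic with the sheet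
first. Comparisons on the line thereby become accessible to `omega`. -/
theorem label_add_lt_iff {r s : Fin n} {p q : ℤ} :
    label r + p * n < label s + q * n ↔ p < q ∨ p = q ∧ r < s := by
  have h1 := label_pos r
  have h2 := label_pos s
  have h3 := label_le r
  have h4 := label_le s
  rcases lt_trichotomy p q with h | rfl | h
  · refine iff_of_true ?_ (Or.inl h)
    have : (p + 1) * n ≤ q * n := by gcongr; omega
    linarith
  · simp [label_lt_label]
  · refine iff_of_false ?_ (by omega)
    have : (q + 1) * n ≤ p * n := by gcongr; omega
    linarith

theorem label_add_inj {r s : Fin n} {p q : ℤ} :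
    label r + p * n = label s + q * n ↔ r = s ∧ p = q := by
  constructor
  · intro h
    have h1 : ¬ label r + p * n < label s + q * n := by omega
    have h2 : ¬ label s + q * n < label r + p * n := by omega
    rw [label_add_lt_iff] at h1 h2
    omega
  · rintro ⟨rfl, rfl⟩; rfl

theorem exists_label_add (hn : 0 < n) (i : ℤ) : ∃ (r : Fin n) (p : ℤ), i = label r + p * n := by
  have h1 := Int.emod_nonneg (i - 1) (show (n : ℤ) ≠ 0 by omega)
  have h2 := Int.emod_lt_of_pos (i - 1) (show (0 : ℤ) < n by omega)
  refine ⟨⟨((i - 1) % n).toNat, by omega⟩, (i - 1) / n, ?_⟩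
  have := Int.emod_add_mul_ediv (i - 1) n
  simp only [label, Int.toNat_of_nonneg h1]
  linarith

/-- The residue of an integer in `{1, …, n}`. -/
def residue [NeZero n] (i : ℤ) : Fin n := (exists_label_add (Nat.pos_of_neZero n) i).choose

/-- The number of the translate of `{1, …, n}` that contains an integer. -/
def sheet [NeZero n] (i : ℤ) : ℤ :=
  (exists_label_add (n := n) (Nat.pos_of_neZero n) i).choose_spec.choose

section

variable [NeZero n]

theorem label_residue (i : ℤ) : label (residue (n := n) i) + sheet (n := n) i * n = i :=
  (exists_label_add (Nat.pos_of_neZero n) i).choose_spec.choose_spec.symm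

theorem residue_label_add (r : Fin n) (p : ℤ) : residue (label r + p * n) = r :=
  (label_add_inj.1 (label_residue (n := n) (label r + p * n))).1

theorem sheet_label_add (r : Fin n) (p : ℤ) : sheet (n := n) (label r + p * n) = p :=
  (label_add_inj.1 (label_residue (n := n) (label r + p * n))).2

end

/-- The number of fixed points of a periodic map, up to translation. -/
def fixCount (n : ℕ) (σ : ℤ → ℤ) : ℕ := {r : Fin n | σ (label r) = label r}.ncard

theorem IsLine.fixCount_pos_iff {σ : ℤ → ℤ} (h : IsLine n σ) (hn : 0 < n) :
    0 < fixCount n σ ↔ ∃ i, σ i = i := by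
  rw [fixCount, Set.ncard_pos (Set.toFinite _)]
  constructor
  · rintro ⟨r, hr⟩
    exact ⟨_, hr⟩
  · rintro ⟨i, hi⟩
    obtain ⟨r, p, rfl⟩ := exists_label_add hn i
    rw [h.shift_mul] at hi
    exact ⟨r, by simpa using hi⟩

/-! ### Annular involutions as involutions of the line -/

open Classical in
/-- The correction term that lifts an annular involution to the line. -/
def annularShift (S : Equiv.Perm (Fin n)) (r : Fin n) : ℤ :=
  if ∃ k, S k = k ∧ (r < k ∧ k < S r ∨ S r < k ∧ k < r) then (if r < S r then -1 else 1) else 0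

/-- The lift of an annular involution to the line. -/
def annularMap [NeZero n] (S : Equiv.Perm (Fin n)) (i : ℤ) : ℤ :=
  label (S (residue i)) + (sheet (n := n) i + annularShift S (residue i)) * n

theorem _root_.IsAnnular.interval {S : Equiv.Perm (Fin n)} (hS : IsAnnular S) {r k : Fin n}
    (hr : r < S r) : (r ≤ S k ∧ S k ≤ S r) ↔ (r ≤ k ∧ k ≤ S r) := by
  have h := (hS.2 r (S r) hr rfl).1
  have h2 : ∀ k, (r ≤ k ∧ k ≤ S r) → (r ≤ S k ∧ S k ≤ S r) := by
    intro k hk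
    have : S k ∈ S '' Set.Icc r (S r) := ⟨k, hk, rfl⟩
    rwa [h] at this
  refine ⟨fun hk => ?_, h2 k⟩
  have := h2 _ hk
  rwa [hS.1] at this

theorem _root_.IsAnnular.fixed {S : Equiv.Perm (Fin n)} (hS : IsAnnular S) {r : Fin n}
    (hr : r < S r) : (∀ k, r ≤ k → k ≤ S r → S k ≠ k) ∨ ∀ k, S k = k → r < k ∧ k < S r := by
  rcases (hS.2 r (S r) hr rfl).2 with h | h
  · left
    intro k h1 h2 hk
    have : k ∈ Set.Icc r (S r) ∩ {k | S k = k} := ⟨⟨h1, h2⟩, hk⟩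
    rw [h] at this
    exact this
  · right
    intro k hk
    obtain ⟨h1, h2⟩ := h hk
    constructor
    · refine lt_of_le_of_ne h1 ?_
      rintro rfl
      rw [hk] at hr
      exact lt_irrefl _ hr
    · refine lt_of_le_of_ne h2 ?_
      rintro rfl
      rw [hS.1] at hk
      exact absurd hk hr.ne

theorem annularShift_eq_zero {S : Equiv.Perm (Fin n)} {r : Fin n}
    (h : ∀ k, S k = k → ¬ (r < k ∧ k < S r) ∧ ¬ (S r < k ∧ k < r)) : annularShift S r = 0 := by
  rw [annularShift, if_neg]
  rintro ⟨k, hk, h1 | h1⟩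
  · exact (h k hk).1 h1
  · exact (h k hk).2 h1

theorem annularShift_neg {S : Equiv.Perm (Fin n)} {r k : Fin n} (hk : S k = k) (h1 : r < k)
    (h2 : k < S r) : annularShift S r = -1 := by
  rw [annularShift, if_pos ⟨k, hk, Or.inl ⟨h1, h2⟩⟩, if_pos (h1.trans h2)]

theorem annularShift_pos {S : Equiv.Perm (Fin n)} {r k : Fin n} (hk : S k = k) (h1 : S r < k)
    (h2 : k < r) : annularShift S r = 1 := by
  rw [annularShift, if_pos ⟨k, hk, Or.inr ⟨h1, h2⟩⟩, if_neg (h1.trans h2).not_gt]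

theorem annularShift_apply {S : Equiv.Perm (Fin n)} (hS : IsAnnular S) (r : Fin n) :
    annularShift S (S r) = -annularShift S r := by
  by_cases h : ∃ k, S k = k ∧ (r < k ∧ k < S r ∨ S r < k ∧ k < r)
  · obtain ⟨k, hk, ⟨h1, h2⟩ | ⟨h1, h2⟩⟩ := h
    · rw [annularShift_neg hk h1 h2, annularShift_pos hk (by rwa [hS.1]) h2, neg_neg]
    · rw [annularShift_pos hk h1 h2, annularShift_neg hk h1 (by rwa [hS.1])]
  · push Not at h
    have h' := fun k hk => not_or.1 (show ¬ (r < k ∧ k < S r ∨ S r < k ∧ k < r) by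
      rintro (⟨h1, h2⟩ | ⟨h1, h2⟩)
      · exact absurd h2 ((h k hk).1 h1).not_gt
      · exact absurd h2 ((h k hk).2 h1).not_gt)
    rw [annularShift_eq_zero h', annularShift_eq_zero, neg_zero]
    intro k hk
    rw [hS.1]
    exact (h' k hk).symm

section

variable [NeZero n]

theorem annularMap_label_add (S : Equiv.Perm (Fin n)) (r : Fin n) (p : ℤ) :
    annularMap S (label r + p * n) = label (S r) + (p + annularShift S r) * n := by
  rw [annularMap, residue_label_add, sheet_label_add]

theorem annularMap_label (S : Equiv.Perm (Fin n)) (r : Fin n) :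
    annularMap S (label r) = label (S r) + annularShift S r * n := by
  simpa using annularMap_label_add S r 0

theorem annularMap_fixed_iff (S : Equiv.Perm (Fin n)) (r : Fin n) (p : ℤ) :
    annularMap S (label r + p * n) = label r + p * n ↔ S r = r := by
  rw [annularMap_label_add, label_add_inj]
  refine ⟨fun h => h.1, fun h => ⟨h, ?_⟩⟩
  rw [annularShift_eq_zero, add_zero]
  intro k hk
  rw [h]
  exact ⟨fun h => lt_asymm h.1 h.2, fun h => lt_asymm h.1 h.2⟩

/-- Fixed points carry through edges, so no arc may cover them. A pair whose interval contains the
fixed points is therefore joined around the other side: its smaller end `r` goes to `S r - n` and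
its larger end to `S r + n`. The annular condition says that whatever such an arc covers, the
interval or its complement in a period, is stable under `S` and free of fixed points. -/
theorem isLine_annularMap {S : Equiv.Perm (Fin n)} (hS : IsAnnular S) :
    IsLine n (annularMap S) where
  invol i := by
    obtain ⟨r, p, rfl⟩ := exists_label_add (Nat.pos_of_neZero n) i
    rw [annularMap_label_add, annularMap_label_add, annularShift_apply hS, hS.1]
    ring
  shift i := by
    obtain ⟨r, p, rfl⟩ := exists_label_add (Nat.pos_of_neZero n) i
    rw [show label r + p * n + n = label r + (p + 1) * n by ring, annularMap_label_add,
      annularMap_label_add]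
    ring
  arc i k h1 h2 := by
    obtain ⟨r, p, rfl⟩ := exists_label_add (Nat.pos_of_neZero n) i
    obtain ⟨s, q, rfl⟩ := exists_label_add (Nat.pos_of_neZero n) k
    rw [Ne, annularMap_fixed_iff]
    rw [annularMap_label_add] at h2 ⊢
    rw [annularMap_label_add]
    rw [label_add_lt_iff] at h1 h2 ⊢
    rw [label_add_lt_iff]
    have hne : ∀ {s t}, s ≠ t → S s ≠ S t := fun h => S.injective.ne h
    rcases lt_trichotomy r (S r) with hr | hr | hr
    · have hI := fun k => hS.interval hr (k := k)
      rcases hS.fixed hr with hf | hf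
      · have e0 : annularShift S r = 0 := annularShift_eq_zero fun k hk =>
          ⟨fun h => hf k h.1.le h.2.le hk, fun h => absurd (h.1.trans h.2) hr.not_gt⟩
        rw [e0, add_zero] at h2 ⊢
        have hs : r < s ∧ s < S r ∧ p = q := by omega
        have h3 := (hI s).2 ⟨hs.1.le, hs.2.1.le⟩
        have h4 : S s ≠ r := fun h => hs.2.1.ne (by rw [← h, hS.1])
        have h5 : S s ≠ S r := hne hs.1.ne'
        have e1 : annularShift S s = 0 := annularShift_eq_zero fun k hk =>
          ⟨fun h => hf k (hs.1.trans h.1).le (h.2.le.trans h3.2) hk,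
            fun h => hf k (h3.1.trans h.1.le) (h.2.trans hs.2.1).le hk⟩
        rw [e1]
        refine ⟨hf s hs.1.le hs.2.1.le, ?_, ?_⟩
        · exact Or.inr ⟨by omega, lt_of_le_of_ne h3.1 h4.symm⟩
        · exact Or.inr ⟨by omega, lt_of_le_of_ne h3.2 h5⟩
      -- If there are fixed points, all inside the interval, the arc from `r` runs to the left and
      -- `h2` is impossible. If there are none at all, no shift occurs and the previous argument
      -- applies.
      · by_cases hk : ∃ k, S k = k
        · obtain ⟨k, hk⟩ := hk
          obtain ⟨a, b⟩ := hf k hk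
          rw [annularShift_neg hk a b] at h2
          omega
        · push Not at hk
          have e0 : ∀ s, annularShift S s = 0 := fun s =>
            annularShift_eq_zero fun k hk' => absurd hk' (hk k)
          rw [e0, add_zero] at h2 ⊢
          rw [e0]
          have hs : r < s ∧ s < S r ∧ p = q := by omega
          have h3 := (hI s).2 ⟨hs.1.le, hs.2.1.le⟩
          have h4 : S s ≠ r := fun h => hs.2.1.ne (by rw [← h, hS.1])
          have h5 : S s ≠ S r := hne hs.1.ne'
          refine ⟨hk s, ?_, ?_⟩
          · exact Or.inr ⟨by omega, lt_of_le_of_ne h3.1 h4.symm⟩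
          · exact Or.inr ⟨by omega, lt_of_le_of_ne h3.2 h5⟩
    · rw [annularShift_eq_zero, ← hr] at h2
      · omega
      · intro k _
        rw [← hr]
        exact ⟨fun h => lt_asymm h.1 h.2, fun h => lt_asymm h.1 h.2⟩
    · have hr' : S r < S (S r) := by rwa [hS.1]
      have hI := fun k => hS.interval hr' (k := k)
      have hF := hS.fixed hr'
      rw [hS.1] at hI hF
      by_cases hk : ∃ k, S k = k ∧ S r < k ∧ k < r
      · obtain ⟨k, hk, hk1, hk2⟩ := hk
        have hf : ∀ k, S k = k → S r < k ∧ k < r :=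
          hF.resolve_left fun h => h k hk1.le hk2.le hk
        rw [annularShift_pos hk hk1 hk2] at h2 ⊢
        -- The arc from `r` to `S r + n` covers the residues outside `[S r, r]`, in sheet `p` to the
        -- right of this interval and in sheet `p + 1` to its left. The shift of `s` is governed by
        -- the sides on which `s` and `S s` lie.
        have h3 : ¬ (S r ≤ s ∧ s ≤ r) := by omega
        have h4 : ¬ (S r ≤ S s ∧ S s ≤ r) := by rwa [hI]
        have h5 : S s ≠ s := fun h => h3 ⟨(hf s h).1.le, (hf s h).2.le⟩
        refine ⟨h5, ?_⟩
        by_cases hs : r < s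
        · by_cases hs' : r < S s
          · rw [annularShift_eq_zero fun j hj => by have := hf j hj; omega]
            omega
          · rw [annularShift_pos hk (by omega) (by omega)]
            omega
        · by_cases hs' : r < S s
          · rw [annularShift_neg hk (by omega) (by omega)]
            omega
          · rw [annularShift_eq_zero fun j hj => by have := hf j hj; omega]
            omega
      · push Not at hk
        rw [annularShift_eq_zero] at h2
        · omega
        · intro k hk'
          have := hk k hk'
          omega

theorem fixCount_annularMap (S : Equiv.Perm (Fin n)) :
    fixCount n (annularMap S) = {k | S k = k}.ncard := by
  rw [fixCount]
  congr 1
  ext r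
  have := annularMap_fixed_iff S r 0
  simpa using this

theorem annularMap_injective : Function.Injective (annularMap (n := n)) := by
  intro S S' h
  ext r : 1
  have := congrFun h (label r)
  rw [annularMap_label, annularMap_label, label_add_inj] at this
  exact this.1

namespace IsLine

variable {σ : ℤ → ℤ} (h : IsLine n σ)

/-- The annular involution of a line involution. -/
def toPerm : Equiv.Perm (Fin n) :=
  have hinv : Function.Involutive fun r : Fin n => residue (n := n) (σ (label r)) := by
    intro r
    have h1 := h.shift_mul (label (residue (n := n) (σ (label r)))) (sheet (n := n) (σ (label r)))
    rw [label_residue, h.invol] at h1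
    have h2 : σ (label (residue (n := n) (σ (label r)))) =
        label r + -sheet (n := n) (σ (label r)) * n := by linarith
    simp only
    rw [h2, residue_label_add]
  hinv.toPerm

theorem toPerm_apply (r : Fin n) : h.toPerm r = residue (σ (label r)) := rfl

theorem apply_label (r : Fin n) :
    σ (label r) = label (h.toPerm r) + sheet (n := n) (σ (label r)) * n := by
  rw [toPerm_apply, label_residue]

theorem toPerm_eq_of {r s : Fin n} {p : ℤ} (hp : σ (label r) = label s + p * n) :
    h.toPerm r = s := by
  rw [toPerm_apply, hp, residue_label_add]

theorem toPerm_fixed_iff (r : Fin n) : h.toPerm r = r ↔ σ (label r) = label r := by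
  constructor
  · intro hr
    have h1 := h.apply_label r
    rw [hr] at h1
    rw [h.eq_of_eq_add (Nat.pos_of_neZero n) h1] at h1
    simpa using h1
  · intro hr
    exact h.toPerm_eq_of (p := 0) (by simpa using hr)

theorem toPerm_toPerm (r : Fin n) : h.toPerm (h.toPerm r) = r := by
  refine h.toPerm_eq_of (p := -sheet (n := n) (σ (label r))) ?_
  have h1 := h.shift_mul (label (h.toPerm r)) (sheet (n := n) (σ (label r)))
  rw [← h.apply_label, h.invol] at h1
  linarith

/-- Arcs are shorter than `n`, so the smaller end of a pair is joined within its sheet or to the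
sheet on the left. These are the two ways around the cylinder. -/
theorem sheet_cases {r : Fin n} (hr : r < h.toPerm r) :
    sheet (n := n) (σ (label r)) = 0 ∨ sheet (n := n) (σ (label r)) = -1 := by
  have h1 := h.lt_add (label r) (Nat.pos_of_neZero n)
  have h2 := h.sub_lt (label r) (Nat.pos_of_neZero n)
  rw [h.apply_label] at h1 h2
  rw [show label r + (n : ℤ) = label r + 1 * n by ring, label_add_lt_iff] at h1
  rw [show label r - (n : ℤ) = label r + -1 * n by ring, label_add_lt_iff] at h2
  omega

theorem inside {r s : Fin n} (h0 : sheet (n := n) (σ (label r)) = 0)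
    (h1 : r < s) (h2 : s < h.toPerm r) :
    h.toPerm s ≠ s ∧ r < h.toPerm s ∧ h.toPerm s < h.toPerm r := by
  have e := h.apply_label r
  rw [h0, zero_mul, add_zero] at e
  obtain ⟨h3, h4, h5⟩ := h.arc (label r) (label s) (label_lt_label.2 h1)
    (by rw [e]; exact label_lt_label.2 h2)
  rw [Ne, ← h.toPerm_fixed_iff] at h3
  refine ⟨h3, ?_⟩
  rw [e] at h5
  rw [h.apply_label s] at h4 h5
  have h4' : label r + 0 * n < label (h.toPerm s) + sheet (n := n) (σ (label s)) * n := by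
    simpa using h4
  have h5' : label (h.toPerm s) + sheet (n := n) (σ (label s)) * n <
    label (h.toPerm r) + 0 * n := by simpa using h5
  rw [label_add_lt_iff] at h4' h5'
  omega

/-- Here the arc goes from the label of `toPerm r` to the translate of the label of `r` by `n`. It
covers the larger labels in the same sheet and the smaller ones in the next sheet, that is, the
complement of the interval. -/
theorem outside {r s : Fin n} (h0 : sheet (n := n) (σ (label r)) = -1)
    (hs : s < r ∨ h.toPerm r < s) :
    h.toPerm s ≠ s ∧ (h.toPerm s < r ∨ h.toPerm r < h.toPerm s) := by
  have e := h.apply_label r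
  rw [h0] at e
  have key : ∀ q : ℤ, (label (h.toPerm r) + 0 * n < label s + q * n) →
      (label s + q * n < label r + 1 * n) →
      h.toPerm s ≠ s ∧ (h.toPerm s < r ∨ h.toPerm r < h.toPerm s) := by
    intro q h1 h2
    have e2 : σ (label (h.toPerm r) + 0 * n) = label r + 1 * n := by
      have h5 := h.invol (label r)
      rw [e, h.shift_mul] at h5
      rw [zero_mul, add_zero]
      linarith
    obtain ⟨h3, h4, h5⟩ := h.arc _ _ h1 (by rwa [e2])
    rw [e2, h.shift_mul, h.apply_label s, add_assoc, ← add_mul, label_add_lt_iff] at h5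
    rw [h.shift_mul, h.apply_label s, add_assoc, ← add_mul, label_add_lt_iff] at h4
    rw [h.shift_mul, Ne, add_left_inj, ← h.toPerm_fixed_iff] at h3
    refine ⟨h3, ?_⟩
    omega
  rcases hs with hs | hs
  · exact key 1 (label_add_lt_iff.2 (Or.inl (by omega))) (label_add_lt_iff.2 (Or.inr ⟨rfl, hs⟩))
  · exact key 0 (label_add_lt_iff.2 (Or.inr ⟨rfl, hs⟩)) (label_add_lt_iff.2 (Or.inl (by omega)))

/-- What an arc covers is stable and free of fixed points. This is the inside of the interval if the
arc stays in its sheet, and otherwise the complement, in which case every fixed point lies in the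
interval. -/
theorem isAnnular_toPerm : IsAnnular h.toPerm := by
  refine ⟨h.toPerm_toPerm, ?_⟩
  rintro r s hr rfl
  have key : (∀ k, (r ≤ k ∧ k ≤ h.toPerm r) → (r ≤ h.toPerm k ∧ h.toPerm k ≤ h.toPerm r)) →
      h.toPerm '' Set.Icc r (h.toPerm r) = Set.Icc r (h.toPerm r) := by
    intro hk
    ext k
    constructor
    · rintro ⟨k, hk', rfl⟩
      exact hk k hk'
    · intro hk'
      exact ⟨h.toPerm k, hk k hk', h.toPerm_toPerm k⟩
  rcases h.sheet_cases hr with h0 | h0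
  · have hin := fun k => h.inside (s := k) h0
    constructor
    · refine key fun k hk => ?_
      rcases eq_or_lt_of_le hk.1 with rfl | h1
      · exact ⟨hr.le, le_rfl⟩
      rcases eq_or_lt_of_le hk.2 with rfl | h2
      · rw [h.toPerm_toPerm]; exact ⟨le_rfl, hr.le⟩
      · exact ⟨(hin k h1 h2).2.1.le, (hin k h1 h2).2.2.le⟩
    · left
      refine Set.eq_empty_of_forall_notMem ?_
      rintro k ⟨hk, hf : h.toPerm k = k⟩
      rcases eq_or_lt_of_le hk.1 with rfl | h1
      · exact hr.ne' hf
      rcases eq_or_lt_of_le hk.2 with rfl | h2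
      · rw [h.toPerm_toPerm] at hf; exact hr.ne hf
      · exact (hin k h1 h2).1 hf
  · have hout := fun k => h.outside (s := k) h0
    constructor
    · refine key fun k hk => ?_
      by_contra hc
      have := (hout (h.toPerm k) (by omega)).2
      rw [h.toPerm_toPerm] at this
      omega
    · right
      intro k (hf : h.toPerm k = k)
      by_contra hc
      rw [Set.mem_Icc] at hc
      exact (hout k (by omega)).1 hf

/-- A fixed point decides which way around each pair is joined, because it may not be covered.
Without fixed points this information is lost in the permutation, which is why the cell 0 is indexed
by involutions of the whole line. -/
theorem annularMap_toPerm (hfix : ∃ i, σ i = i) : annularMap h.toPerm = σ := by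
  have hS := h.isAnnular_toPerm
  have hfix' : ∃ r, h.toPerm r = r := by
    obtain ⟨i, hi⟩ := hfix
    obtain ⟨r, p, rfl⟩ := exists_label_add (Nat.pos_of_neZero n) i
    rw [h.shift_mul, add_left_inj] at hi
    exact ⟨r, (h.toPerm_fixed_iff r).2 hi⟩
  have hlt : ∀ r, r < h.toPerm r → annularShift h.toPerm r = sheet (n := n) (σ (label r)) := by
    intro r hr
    rcases h.sheet_cases hr with h0 | h0
    · rw [h0]
      refine annularShift_eq_zero fun k hk => ⟨fun h1 => ?_, fun h1 => ?_⟩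
      · exact (h.inside h0 h1.1 h1.2).1 hk
      · exact absurd (h1.1.trans h1.2) hr.not_gt
    · rw [h0]
      obtain ⟨k, hk⟩ := hfix'
      have h1 : ¬ (k < r ∨ h.toPerm r < k) := fun h1 => (h.outside h0 h1).1 hk
      refine annularShift_neg hk ?_ ?_
      · refine lt_of_le_of_ne (by omega) ?_
        rintro rfl
        exact hr.ne' hk
      · refine lt_of_le_of_ne (by omega) ?_
        rintro rfl
        rw [h.toPerm_toPerm] at hk
        exact hr.ne hk
  have hall : ∀ r, annularShift h.toPerm r = sheet (n := n) (σ (label r)) := by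
    intro r
    rcases lt_trichotomy r (h.toPerm r) with hr | hr | hr
    · exact hlt r hr
    · rw [(h.toPerm_fixed_iff r).1 hr.symm, annularShift_eq_zero]
      · have := sheet_label_add (n := n) r 0
        simpa using this.symm
      · intro k _
        rw [← hr]
        exact ⟨fun h => lt_asymm h.1 h.2, fun h => lt_asymm h.1 h.2⟩
    · have h1 := hlt (h.toPerm r) (by rwa [h.toPerm_toPerm])
      rw [annularShift_apply hS] at h1
      have h2 := h.shift_mul (label (h.toPerm r)) (sheet (n := n) (σ (label r)))
      rw [← h.apply_label, h.invol, h.apply_label (h.toPerm r), h.toPerm_toPerm] at h2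
      have h3 : label r + 0 * n = label r + (sheet (n := n) (σ (label (h.toPerm r))) +
        sheet (n := n) (σ (label r))) * n := by linarith
      have h4 := (label_add_inj.1 h3).2
      omega
  funext i
  obtain ⟨r, p, rfl⟩ := exists_label_add (Nat.pos_of_neZero n) i
  rw [annularMap_label_add, h.shift_mul, h.apply_label, hall]
  ring

end IsLine

/-! ### Tableaux as involutions of the line -/

/-- The involution of the line of a tableau. -/
def tabMap : (l : ℕ) → cellTableaux n l → ℤ → ℤ
  | 0, S => fun i => (show AffineInvolution n from S).1 i
  | t + 1, S => annularMap (show AnnularInvolution n (t + 1) from S).1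

theorem isLine_tabMap (l : ℕ) (S : cellTableaux n l) : IsLine n (tabMap l S) := by
  cases l with
  | zero =>
    obtain ⟨S, h1, h2, h3, h4⟩ := S
    refine ⟨h1, h3, fun i k hi hk => ⟨h2 k, ?_⟩⟩
    change k < S i at hk
    change i < S k ∧ S k < S i
    have h5 := h4 i (S i) (hi.trans hk) rfl
    have h6 : S k ∈ S '' Set.Icc i (S i) := ⟨k, ⟨hi.le, hk.le⟩, rfl⟩
    rw [h5] at h6
    refine ⟨lt_of_le_of_ne h6.1 ?_, lt_of_le_of_ne h6.2 (S.injective.ne hi.ne')⟩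
    intro h7
    rw [h7, h1] at hk
    exact lt_irrefl _ hk
  | succ t => exact isLine_annularMap S.2.1

theorem fixCount_tabMap (l : ℕ) (S : cellTableaux n l) : fixCount n (tabMap l S) = l := by
  cases l with
  | zero =>
    obtain ⟨S, h1, h2, h3, h4⟩ := S
    by_contra h
    obtain ⟨i, hi⟩ := ((isLine_tabMap 0 ⟨S, h1, h2, h3, h4⟩).fixCount_pos_iff
      (Nat.pos_of_neZero n)).1 (Nat.pos_of_ne_zero h)
    exact h2 i hi
  | succ t => exact (fixCount_annularMap _).trans S.2.2

theorem tabMap_injective (l : ℕ) : Function.Injective (tabMap (n := n) l) := by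
  cases l with
  | zero =>
    intro S S' h
    exact Subtype.ext (Equiv.ext fun i => congrFun h i)
  | succ t =>
    intro S S' h
    exact Subtype.ext (annularMap_injective h)

theorem exists_tabMap {σ : ℤ → ℤ} (h : IsLine n σ) :
    ∃ S : cellTableaux n (fixCount n σ), tabMap (fixCount n σ) S = σ := by
  have hpos := h.fixCount_pos_iff (Nat.pos_of_neZero n)
  generalize hl : fixCount n σ = l at hpos ⊢
  cases l with
  | zero =>
    simp only [lt_irrefl, false_iff, not_exists] at hpos
    refine ⟨⟨⟨σ, σ, h.invol, h.invol⟩, h.invol, hpos, h.shift, ?_⟩, rfl⟩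
    rintro i j hij rfl
    have key : ∀ k, k ∈ Set.Icc i (σ i) → σ k ∈ Set.Icc i (σ i) := by
      rintro k ⟨h1, h2⟩
      rcases eq_or_lt_of_le h1 with rfl | h1
      · exact ⟨hij.le, le_rfl⟩
      rcases eq_or_lt_of_le h2 with rfl | h2
      · rw [h.invol]; exact ⟨le_rfl, hij.le⟩
      · have := h.arc i k h1 h2
        exact ⟨this.2.1.le, this.2.2.le⟩
    ext k
    constructor
    · rintro ⟨k, hk, rfl⟩
      exact key k hk
    · intro hk
      exact ⟨σ k, key k hk, h.invol k⟩
  | succ t =>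
    have hfix := hpos.1 (Nat.succ_pos t)
    refine ⟨⟨h.toPerm, h.isAnnular_toPerm, ?_⟩, h.annularMap_toPerm hfix⟩
    rw [← fixCount_annularMap (n := n), h.annularMap_toPerm hfix, hl]

/-- The involution is determined by its values at the labels, and these are bounded because arcs are
shorter than `n`. -/
theorem finite_cellTableaux (l : ℕ) : Finite (cellTableaux n l) := by
  let f : cellTableaux n l → Fin n → Finset.Icc (1 - n : ℤ) (2 * n) := fun S r =>
    ⟨tabMap l S (label r), by
      have h1 := (isLine_tabMap l S).lt_add (label r) (Nat.pos_of_neZero n)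
      have h2 := (isLine_tabMap l S).sub_lt (label r) (Nat.pos_of_neZero n)
      have h3 := label_pos r
      have h4 := label_le r
      rw [Finset.mem_Icc]
      omega⟩
  refine Finite.of_injective f fun S S' h => tabMap_injective l ?_
  funext i
  obtain ⟨r, p, rfl⟩ := exists_label_add (Nat.pos_of_neZero n) i
  rw [(isLine_tabMap l S).shift_mul, (isLine_tabMap l S').shift_mul]
  have := congrArg Subtype.val (congrFun h r)
  simp only [f] at this
  rw [this]

/-- The residues that are not fixed are exchanged in pairs; hence the number of through edges is a
legitimate cell. -/
theorem exists_add_two_mul {σ : ℤ → ℤ} (h : IsLine n σ) : ∃ r, fixCount n σ + 2 * r = n := by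
  classical
  have h1 : Even ({r | h.toPerm r ≠ r} : Finset (Fin n)).card := by
    refine even_card_of_involution _ h.toPerm (fun r _ => h.toPerm_toPerm r) ?_ ?_
    · intro r hr
      have hr' := (Finset.mem_filter.1 hr).2
      refine Finset.mem_filter.2 ⟨Finset.mem_univ _, ?_⟩
      rw [h.toPerm_toPerm]
      exact hr'.symm
    · intro r hr
      exact (Finset.mem_filter.1 hr).2
  have h2 := Finset.card_filter_add_card_filter_not (s := Finset.univ) fun r => h.toPerm r = r
  obtain ⟨c, hc⟩ := h1
  refine ⟨c, ?_⟩
  have h3 : fixCount n σ = ({r | h.toPerm r = r} : Finset (Fin n)).card := by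
    rw [fixCount, ← Set.ncard_coe_finset]
    congr 1
    ext r
    simp [h.toPerm_fixed_iff]
  rw [Finset.card_univ, Fintype.card_fin] at h2
  rw [h3]
  simp only [ne_eq] at hc
  omega

end

end AffineDiagram

end

/-! ### Numbering the through edges: link and winding number. -/

section

namespace AffineDiagram

variable {n : ℕ}

/-! ### Counting fixed points on the line -/

open Classical in
/-- The signed number of fixed points of `σ` in the interval from `1` to `i`. -/
def lineCount (n : ℕ) (σ : ℤ → ℤ) (i : ℤ) : ℤ :=
  ∑ r : Fin n with σ (label r) = label r, ((i - label r) / n + 1)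

theorem lineCount_add (hn : 0 < n) (σ : ℤ → ℤ) (i p : ℤ) :
    lineCount n σ (i + p * n) = lineCount n σ i + p * fixCount n σ := by
  classical
  have h1 : fixCount n σ = ({r | σ (label r) = label r} : Finset (Fin n)).card := by
    rw [fixCount, ← Set.ncard_coe_finset]
    congr 1
    ext r
    simp
  have h2 : p * (({r | σ (label r) = label r} : Finset (Fin n)).card : ℤ) =
      ∑ _r : Fin n with σ (label _r) = label _r, p := by
    rw [Finset.sum_const, nsmul_eq_mul, mul_comm]
  rw [lineCount, lineCount, h1, h2, ← Finset.sum_add_distrib]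
  refine Finset.sum_congr rfl fun r _ => ?_
  rw [show i + p * n - label r = i - label r + p * n by ring,
    Int.add_mul_ediv_right _ _ (by omega)]
  ring

theorem lineCount_zero (hn : 0 < n) (σ : ℤ → ℤ) : lineCount n σ 0 = 0 := by
  refine Finset.sum_eq_zero fun r _ => ?_
  have h1 := label_pos r
  have h2 := label_le r
  have h3 := ((Int.ediv_emod_unique (a := 0 - label r) (b := n) (r := n - label r) (q := -1)
    (by omega)).2 ⟨by ring, by omega, by omega⟩).1
  rw [h3]
  rfl

theorem ediv_sub_one {b : ℤ} (hb : 0 < b) (x : ℤ) :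
    x / b = (x - 1) / b + if b ∣ x then 1 else 0 := by
  have h1 := Int.emod_nonneg x hb.ne'
  have h2 := Int.emod_lt_of_pos x hb
  have h3 := Int.emod_add_mul_ediv x b
  split_ifs with h
  · obtain ⟨c, rfl⟩ := h
    rw [Int.mul_ediv_cancel_left _ hb.ne',
      ((Int.ediv_emod_unique (a := b * c - 1) (r := b - 1) (q := c - 1) hb).2
        ⟨by ring, by omega, by omega⟩).1]
    ring
  · have h4 : x % b ≠ 0 := fun h' => h (Int.dvd_of_emod_eq_zero h')
    rw [((Int.ediv_emod_unique (a := x - 1) (r := x % b - 1) (q := x / b) hb).2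
        ⟨by linarith, by omega, by omega⟩).1, add_zero]

section

variable {σ : ℤ → ℤ} (hσ : IsLine n σ) (hn : 0 < n)
include hσ hn

open Classical in
-- Passing from `i - 1` to `i` changes only the summand of the residue of `i`, and only if that
-- residue is fixed. So `lineCount` is a step function that numbers the fixed points consecutively.
theorem lineCount_sub_one (i : ℤ) :
    lineCount n σ i = lineCount n σ (i - 1) + if σ i = i then 1 else 0 := by
  have h1 : lineCount n σ i = ∑ r : Fin n with σ (label r) = label r,
      (((i - 1 - label r) / n + 1) + if (n : ℤ) ∣ i - label r then 1 else 0) := by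
    refine Finset.sum_congr rfl fun r _ => ?_
    rw [ediv_sub_one (b := n) (by omega) (i - label r), show i - label r - 1 = i - 1 - label r by ring]
    ring
  rw [h1, Finset.sum_add_distrib]
  congr 1
  obtain ⟨s, p, rfl⟩ := exists_label_add hn i
  have h2 : ∀ r : Fin n, (n : ℤ) ∣ label s + p * n - label r ↔ r = s := by
    intro r
    constructor
    · rintro ⟨c, hc⟩
      have : label s + p * n = label r + c * n := by linarith
      exact (label_add_inj.1 this).1.symm
    · rintro rfl
      exact ⟨p, by ring⟩
  simp only [h2, Finset.sum_ite_eq', Finset.mem_filter, Finset.mem_univ, true_and,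
    hσ.shift_mul, add_left_inj]

theorem lineCount_mono : Monotone (lineCount n σ) := by
  classical
  refine monotone_int_of_le_succ fun i => ?_
  have := lineCount_sub_one hσ hn (i + 1)
  rw [add_sub_cancel_right] at this
  rw [this]
  split_ifs <;> simp

theorem lineCount_lt {i j : ℤ} (hij : i < j) (hj : σ j = j) :
    lineCount n σ i < lineCount n σ j := by
  classical
  rw [lineCount_sub_one hσ hn j, if_pos hj]
  have := lineCount_mono hσ hn (show i ≤ j - 1 by omega)
  omega

theorem lineCount_lt_iff {i j : ℤ} (hj : σ j = j) :
    lineCount n σ i < lineCount n σ j ↔ i < j := by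
  refine ⟨fun h => ?_, fun h => lineCount_lt hσ hn h hj⟩
  by_contra hc
  exact absurd h (lineCount_mono hσ hn (not_lt.1 hc)).not_gt

theorem lineCount_inj {i j : ℤ} (hi : σ i = i) (hj : σ j = j)
    (h : lineCount n σ i = lineCount n σ j) : i = j := by
  have h1 := lineCount_lt_iff hσ hn (i := i) hj
  have h2 := lineCount_lt_iff hσ hn (i := j) hi
  omega

theorem lineCount_le_zero_iff {i : ℤ} (hi : σ i = i) : lineCount n σ i ≤ 0 ↔ i ≤ 0 := by
  constructor
  · intro h
    by_contra hc
    have := lineCount_lt hσ hn (not_le.1 hc) hi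
    rw [lineCount_zero hn] at this
    omega
  · intro h
    have := lineCount_mono hσ hn h
    rwa [lineCount_zero hn] at this

/-- The count is monotone, has steps of at most one and is unbounded in both directions. At the
least `i` where it reaches `m` it makes a step, so `i` is fixed and has number `m`. -/
theorem exists_lineCount_eq (hpos : 0 < fixCount n σ) (m : ℤ) :
    ∃ i, σ i = i ∧ lineCount n σ i = m := by
  classical
  have hval : ∀ p : ℤ, lineCount n σ (p * n) = p * fixCount n σ := by
    intro p
    have := lineCount_add hn σ 0 p
    rwa [lineCount_zero hn, zero_add, zero_add] at this
  obtain ⟨i, hi, hleast⟩ := Int.exists_least_of_bdd (P := fun i => m ≤ lineCount n σ i)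
    -- A bound that serves both signs: for `m ≤ 0` the count at `(m - 1) * n` is at most `m - 1`,
    -- and for `m > 0` the count at `-n` is negative.
    ⟨(m - 1) * n ⊓ (-1 * n), fun z hz => by
      by_contra hc
      rw [not_le, lt_inf_iff] at hc
      rcases le_or_gt m 0 with hm | hm
      · have h1 := (lineCount_mono hσ hn hc.1.le).trans_eq (hval (m - 1))
        have : (m - 1) * fixCount n σ ≤ (m - 1) * 1 := by
          apply mul_le_mul_of_nonpos_left <;> omega
        omega
      · have h1 := (lineCount_mono hσ hn hc.2.le).trans_eq (hval (-1))
        omega⟩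
    ⟨|m| * n, by
      rw [hval]
      have h1 : |m| * 1 ≤ |m| * fixCount n σ := by gcongr; omega
      have h2 := le_abs_self m
      omega⟩
  refine ⟨i, ?_⟩
  have h1 := lineCount_sub_one hσ hn i
  have h2 : ¬ m ≤ lineCount n σ (i - 1) := fun h => by
    have := hleast _ h
    omega
  split_ifs at h1 with h
  · exact ⟨h, by omega⟩
  · omega

end

open Classical in
/-- The fixed point of `σ` with a given number. -/
def nthFixed (n : ℕ) (σ : ℤ → ℤ) (m : ℤ) : ℤ :=
  if h : ∃ i, σ i = i ∧ lineCount n σ i = m then h.choose else 0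

section

variable {σ : ℤ → ℤ} (hσ : IsLine n σ) (hn : 0 < n)
include hσ hn

theorem nthFixed_spec (hpos : 0 < fixCount n σ) (m : ℤ) :
    σ (nthFixed n σ m) = nthFixed n σ m ∧ lineCount n σ (nthFixed n σ m) = m := by
  have h := exists_lineCount_eq hσ hn hpos m
  rw [nthFixed, dif_pos h]
  exact h.choose_spec

theorem nthFixed_eq {i m : ℤ} (hi : σ i = i) (hm : lineCount n σ i = m) :
    nthFixed n σ m = i := by
  have hpos := (hσ.fixCount_pos_iff hn).2 ⟨i, hi⟩
  have h := nthFixed_spec hσ hn hpos m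
  exact lineCount_inj hσ hn h.1 hi (h.2.trans hm.symm)

end

/-! ### The edges of a diagram between nodes of the same row -/

/-- The involution of the line given by the top row of a diagram. -/
def topMap (D : AffineDiagram n) (i : ℤ) : ℤ :=
  match D.pair (Node.top i) with
  | Node.top j => j
  | Node.bot _ => i

/-- The involution of the line given by the bottom row of a diagram. -/
def botMap (D : AffineDiagram n) : ℤ → ℤ := topMap D.flip

theorem topMap_of_top {D : AffineDiagram n} {i j : ℤ} (h : D.pair (Node.top i) = Node.top j) :
    topMap D i = j := by
  rw [topMap, h]

theorem topMap_of_bot {D : AffineDiagram n} {i j : ℤ} (h : D.pair (Node.top i) = Node.bot j) :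
    topMap D i = i := by
  rw [topMap, h]

theorem topMap_eq_self_iff {D : AffineDiagram n} {i : ℤ} :
    topMap D i = i ↔ ∃ j, D.pair (Node.top i) = Node.bot j := by
  constructor
  · intro h
    rcases hp : D.pair (Node.top i) with j | j
    · rw [topMap_of_top hp] at h
      subst h
      exact (D.pair_ne _ hp).elim
    · exact ⟨j, rfl⟩
  · rintro ⟨j, h⟩
    exact topMap_of_bot h

theorem pair_top_of_ne {D : AffineDiagram n} {i : ℤ} (h : topMap D i ≠ i) :
    D.pair (Node.top i) = Node.top (topMap D i) := by
  rcases hp : D.pair (Node.top i) with j | j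
  · rw [topMap_of_top hp]
  · exact (h (topMap_of_bot hp)).elim

theorem botMap_of_bot {D : AffineDiagram n} {i j : ℤ} (h : D.pair (Node.bot i) = Node.bot j) :
    botMap D i = j :=
  topMap_of_top (D := D.flip) (by rw [flip_pair, Node.flip, h, Node.flip])

theorem botMap_eq_self_iff {D : AffineDiagram n} {i : ℤ} :
    botMap D i = i ↔ ∃ j, D.pair (Node.bot i) = Node.top j := by
  rw [botMap, topMap_eq_self_iff]
  refine exists_congr fun j => ?_
  rw [flip_pair, Node.flip]
  cases D.pair (Node.bot i) <;> simp [Node.flip]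

theorem pair_bot_of_ne {D : AffineDiagram n} {i : ℤ} (h : botMap D i ≠ i) :
    D.pair (Node.bot i) = Node.bot (botMap D i) := by
  have := pair_top_of_ne h
  rw [flip_pair] at this
  rw [← Node.flip_flip (D.pair (Node.bot i))]
  exact congrArg Node.flip this

theorem botMap_flip (D : AffineDiagram n) : botMap D.flip = topMap D := by
  rw [botMap, flip_flip]

theorem pair_eq_comm (D : AffineDiagram n) {x y : Node} : D.pair x = y ↔ D.pair y = x :=
  ⟨fun h => by rw [← h, D.pair_pair], fun h => by rw [← h, D.pair_pair]⟩

/-- Noncrossing on the boundary of the strip confines the partners of the nodes under an arc to that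
arc. In particular no through edge starts there, which is the visibility of fixed points. -/
theorem isLine_topMap (D : AffineDiagram n) : IsLine n (topMap D) where
  invol i := by
    by_cases h : topMap D i = i
    · rw [h, h]
    · have h1 := pair_top_of_ne h
      rw [pair_eq_comm] at h1
      exact topMap_of_top h1
  shift i := by
    have h1 := D.pair_shift (Node.top i)
    rcases hp : D.pair (Node.top i) with j | j
    · rw [hp] at h1
      rw [topMap_of_top hp]
      exact topMap_of_top h1
    · rw [hp] at h1
      rw [topMap_of_bot hp]
      exact topMap_of_bot h1
  arc i k h1 h2 := by
    have h3 := pair_top_of_ne (D := D) (i := i) (by omega)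
    have h4 := D.noncrossing (Node.top i) (Node.top k)
    rw [h3] at h4
    have h5 : ¬ Node.Before (Node.top (topMap D i)) (D.pair (Node.top k)) := fun h => h4 ⟨h1, h2, h⟩
    rcases hp : D.pair (Node.top k) with j | j
    · rw [hp] at h5
      have h6 : j ≤ topMap D i := by simpa [Node.Before] using h5
      have hp' := (pair_eq_comm D).1 hp
      rw [topMap_of_top hp]
      have h7 := D.noncrossing (Node.top j) (Node.top i)
      rw [h3, hp'] at h7
      have h8 : ¬ j < i := fun h => h7 ⟨h, h1, h2⟩
      refine ⟨?_, ?_, ?_⟩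
      · rintro rfl
        exact D.pair_ne _ hp
      · refine lt_of_le_of_ne (not_lt.1 h8) ?_
        rintro rfl
        rw [h3] at hp'
        cases hp'
        exact lt_irrefl _ h2
      · refine lt_of_le_of_ne h6 ?_
        rintro rfl
        rw [pair_eq_comm, hp'] at h3
        cases h3
        exact lt_irrefl _ h1
    · rw [hp] at h5
      exact (h5 trivial).elim

theorem isLine_botMap (D : AffineDiagram n) : IsLine n (botMap D) := isLine_topMap D.flip

/-- The boundary order runs backwards along the bottom row, so for through edges noncrossing means
that the order from left to right is kept. -/
theorem through_lt {D : AffineDiagram n} {p p' q q' : ℤ}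
    (h : D.pair (Node.top p) = Node.bot q) (h' : D.pair (Node.top p') = Node.bot q')
    (hlt : p < p') : q < q' := by
  have h1 := D.noncrossing (Node.top p) (Node.top p')
  rw [h, h'] at h1
  have h2 : ¬ q' < q := fun h => h1 ⟨hlt, trivial, h⟩
  refine lt_of_le_of_ne (not_lt.1 h2) ?_
  rintro rfl
  rw [pair_eq_comm] at h h'
  rw [h] at h'
  cases h'
  exact lt_irrefl _ hlt

theorem through_lt_iff {D : AffineDiagram n} {p p' q q' : ℤ}
    (h : D.pair (Node.top p) = Node.bot q) (h' : D.pair (Node.top p') = Node.bot q') :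
    p < p' ↔ q < q' := by
  refine ⟨through_lt h h', fun hlt => ?_⟩
  rcases lt_trichotomy p p' with h1 | rfl | h1
  · exact h1
  · rw [h] at h'
    cases h'
    exact (lt_irrefl _ hlt).elim
  · have := through_lt h' h h1
    omega

theorem strictMono_surjective_int {f : ℤ → ℤ} (hf : StrictMono f) (hs : Function.Surjective f)
    (m : ℤ) : f m = m + f 0 := by
  have h1 : ∀ m, f (m + 1) = f m + 1 := by
    intro m
    obtain ⟨k, hk⟩ := hs (f m + 1)
    have h2 : m < k := hf.lt_iff_lt.1 (by omega)
    have h3 := hf.monotone (show m + 1 ≤ k by omega)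
    have h4 := hf (show m < m + 1 by omega)
    omega
  induction m using Int.induction_on with
  | zero => simp
  | succ m ih => rw [h1, ih]; ring
  | pred m ih =>
    have := h1 (-(m : ℤ) - 1)
    rw [sub_add_cancel, ih] at this
    linarith

/-- The through edges of `D` shift the numbers of the nodes by `k`. -/
def Linked (D : AffineDiagram n) (k : ℤ) : Prop :=
  ∀ p q, D.pair (Node.top p) = Node.bot q →
    lineCount n (topMap D) p = lineCount n (botMap D) q + k

theorem fixCount_botMap_pos_iff (hn : 0 < n) (D : AffineDiagram n) :
    0 < fixCount n (botMap D) ↔ 0 < fixCount n (topMap D) := by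
  rw [(isLine_topMap D).fixCount_pos_iff hn, (isLine_botMap D).fixCount_pos_iff hn]
  constructor
  · rintro ⟨q, hq⟩
    obtain ⟨p, hp⟩ := botMap_eq_self_iff.1 hq
    exact ⟨p, topMap_eq_self_iff.2 ⟨q, (pair_eq_comm D).1 hp⟩⟩
  · rintro ⟨p, hp⟩
    obtain ⟨q, hq⟩ := topMap_eq_self_iff.1 hp
    exact ⟨q, botMap_eq_self_iff.2 ⟨p, (pair_eq_comm D).1 hq⟩⟩

/-- Through edges form an increasing bijection between the fixed points of the two rows. In terms of
their consecutive numbers it is an increasing bijection of `ℤ`, hence a translation. Without through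
edges the condition is empty. -/
theorem exists_linked (hn : 0 < n) (D : AffineDiagram n) : ∃ k, Linked D k := by
  by_cases hpos : 0 < fixCount n (topMap D)
  · have hσ := isLine_topMap D
    have hτ := isLine_botMap D
    have hpos' := (fixCount_botMap_pos_iff hn D).2 hpos
    have hq := fun m => nthFixed_spec hτ hn hpos' m
    have hp : ∀ m, ∃ p, D.pair (Node.bot (nthFixed n (botMap D) m)) = Node.top p :=
      fun m => botMap_eq_self_iff.1 (hq m).1
    choose g hg using hp
    have hfix : ∀ m, topMap D (g m) = g m := fun m =>
      topMap_eq_self_iff.2 ⟨_, (pair_eq_comm D).1 (hg m)⟩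
    have hmono : StrictMono fun m => lineCount n (topMap D) (g m) := by
      intro a b hab
      have h1 : nthFixed n (botMap D) a < nthFixed n (botMap D) b := by
        rw [← lineCount_lt_iff hτ hn (hq b).1, (hq a).2, (hq b).2]
        exact hab
      rw [← through_lt_iff ((pair_eq_comm D).1 (hg a)) ((pair_eq_comm D).1 (hg b))] at h1
      exact (lineCount_lt_iff hσ hn (hfix b)).2 h1
    have hval : ∀ p q, D.pair (Node.top p) = Node.bot q →
        g (lineCount n (botMap D) q) = p := by
      intro p q hpq
      have h1 : nthFixed n (botMap D) (lineCount n (botMap D) q) = q :=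
        nthFixed_eq hτ hn (botMap_eq_self_iff.2 ⟨p, (pair_eq_comm D).1 hpq⟩) rfl
      have h2 := hg (lineCount n (botMap D) q)
      rw [h1, (pair_eq_comm D).1 hpq] at h2
      cases h2
      rfl
    have hsurj : Function.Surjective fun m => lineCount n (topMap D) (g m) := by
      intro m
      obtain ⟨p, hp, rfl⟩ := exists_lineCount_eq hσ hn hpos m
      obtain ⟨q, hq⟩ := topMap_eq_self_iff.1 hp
      exact ⟨lineCount n (botMap D) q, by simp only [hval p q hq]⟩
    refine ⟨lineCount n (topMap D) (g 0), fun p q hpq => ?_⟩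
    have := strictMono_surjective_int hmono hsurj (lineCount n (botMap D) q)
    simp only [hval p q hpq] at this
    exact this
  · refine ⟨0, fun p q hpq => ?_⟩
    exact (hpos (((isLine_topMap D).fixCount_pos_iff hn).2 ⟨p, topMap_of_bot hpq⟩)).elim

/-- Translating a through edge by `n` raises the number of each end by the number of fixed residues
in its row. The link is the same for both edges, so the two increments agree. -/
theorem fixCount_botMap (hn : 0 < n) (D : AffineDiagram n) :
    fixCount n (botMap D) = fixCount n (topMap D) := by
  by_cases hpos : 0 < fixCount n (topMap D)
  · obtain ⟨k, hk⟩ := exists_linked hn D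
    obtain ⟨p, hp⟩ := ((isLine_topMap D).fixCount_pos_iff hn).1 hpos
    obtain ⟨q, hq⟩ := topMap_eq_self_iff.1 hp
    have h1 := hk p q hq
    have h2 := hk (p + 1 * n) (q + 1 * n) (by
      have := D.pair_shift (Node.top p)
      rw [hq] at this
      simpa [Node.shift] using this)
    rw [lineCount_add hn, lineCount_add hn] at h2
    omega
  · have := fixCount_botMap_pos_iff hn D
    omega

theorem bands_eq_zero_of_pos (hn : 0 < n) {D : AffineDiagram n}
    (h : 0 < fixCount n (topMap D)) : D.bands = 0 := by
  obtain ⟨p, hp⟩ := ((isLine_topMap D).fixCount_pos_iff hn).1 h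
  obtain ⟨q, hq⟩ := topMap_eq_self_iff.1 hp
  exact D.bands_eq_zero p q hq

/-- A diagram is determined by the two involutions, the link and the number of bands. -/
theorem ext_of_linked (hn : 0 < n) {D D' : AffineDiagram n} (ht : topMap D = topMap D')
    (hb : botMap D = botMap D') {k : ℤ} (hk : Linked D k) (hk' : Linked D' k)
    (hbands : D.bands = D'.bands) : D = D' := by
  have htop : ∀ i, D.pair (Node.top i) = D'.pair (Node.top i) := by
    intro i
    by_cases h : topMap D i = i
    · obtain ⟨j, hj⟩ := topMap_eq_self_iff.1 h
      rw [ht] at h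
      obtain ⟨j', hj'⟩ := topMap_eq_self_iff.1 h
      have h1 := hk i j hj
      have h2 := hk' i j' hj'
      rw [ht, hb] at h1
      rw [hj, hj']
      refine congrArg _ (lineCount_inj (isLine_botMap D') hn ?_ ?_ (by omega))
      · rw [← hb]
        exact botMap_eq_self_iff.2 ⟨i, (pair_eq_comm D).1 hj⟩
      · exact botMap_eq_self_iff.2 ⟨i, (pair_eq_comm D').1 hj'⟩
    · rw [pair_top_of_ne h, pair_top_of_ne (by rwa [← ht]), ht]
  refine AffineDiagram.ext (funext fun x => ?_) hbands
  rcases x with i | i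
  · exact htop i
  · by_cases h : botMap D i = i
    · obtain ⟨j, hj⟩ := botMap_eq_self_iff.1 h
      rw [hj]
      rw [pair_eq_comm, htop, pair_eq_comm] at hj
      exact hj.symm
    · rw [pair_bot_of_ne h, pair_bot_of_ne (by rwa [← hb]), hb]

/-! ### Diagrams with given involutions -/

open Classical in
/-- The edges of the diagram with the given involutions and link. -/
def linePair (n : ℕ) (σ τ : ℤ → ℤ) (k : ℤ) : Node → Node
  | Node.top i => if σ i = i then Node.bot (nthFixed n τ (lineCount n σ i - k))
    else Node.top (σ i)
  | Node.bot i => if τ i = i then Node.top (nthFixed n σ (lineCount n τ i + k))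
    else Node.bot (τ i)

section

variable {σ τ : ℤ → ℤ} (hσ : IsLine n σ) (hτ : IsLine n τ) (hn : 0 < n)
  (hfix : fixCount n σ = fixCount n τ) (k : ℤ)

theorem linePair_top_fixed {i : ℤ} (h : σ i = i) :
    linePair n σ τ k (Node.top i) = Node.bot (nthFixed n τ (lineCount n σ i - k)) := if_pos h

theorem linePair_top {i : ℤ} (h : σ i ≠ i) :
    linePair n σ τ k (Node.top i) = Node.top (σ i) := if_neg h

theorem linePair_bot_fixed {i : ℤ} (h : τ i = i) :
    linePair n σ τ k (Node.bot i) = Node.top (nthFixed n σ (lineCount n τ i + k)) := if_pos h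

theorem linePair_bot {i : ℤ} (h : τ i ≠ i) :
    linePair n σ τ k (Node.bot i) = Node.bot (τ i) := if_neg h

include hσ hτ hn hfix

/-- The diagram with given involutions, link and number of bands. -/
def ofLines (b : ℕ) (hb : 0 < fixCount n σ → b = 0) : AffineDiagram n where
  pair := linePair n σ τ k
  pair_pair x := by
    rcases x with i | i
    · by_cases h : σ i = i
      · have hpos := (hσ.fixCount_pos_iff hn).2 ⟨i, h⟩
        have h1 := nthFixed_spec hτ hn (hfix ▸ hpos) (lineCount n σ i - k)
        rw [linePair_top_fixed k h, linePair_bot_fixed k h1.1, h1.2,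
          nthFixed_eq hσ hn h (by ring)]
      · rw [linePair_top k h, linePair_top k (by rw [hσ.invol]; exact Ne.symm h), hσ.invol]
    · by_cases h : τ i = i
      · have hpos := (hτ.fixCount_pos_iff hn).2 ⟨i, h⟩
        have h1 := nthFixed_spec hσ hn (hfix ▸ hpos) (lineCount n τ i + k)
        rw [linePair_bot_fixed k h, linePair_top_fixed k h1.1, h1.2,
          nthFixed_eq hτ hn h (by ring)]
      · rw [linePair_bot k h, linePair_bot k (by rw [hτ.invol]; exact Ne.symm h), hτ.invol]
  pair_ne x := by
    rcases x with i | i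
    · by_cases h : σ i = i
      · rw [linePair_top_fixed k h]; simp
      · rw [linePair_top k h]; simpa using h
    · by_cases h : τ i = i
      · rw [linePair_bot_fixed k h]; simp
      · rw [linePair_bot k h]; simpa using h
  pair_shift x := by
    -- Raising the number by a full set of fixed residues moves the fixed point by `n`. Both rows
    -- have equally many, so the through edges are periodic.
    have hnth : ∀ (ρ : ℤ → ℤ), IsLine n ρ → 0 < fixCount n ρ → ∀ m,
        nthFixed n ρ (m + fixCount n ρ) = nthFixed n ρ m + n := by
      intro ρ hρ hpos m
      have h1 := nthFixed_spec hρ hn hpos m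
      refine nthFixed_eq hρ hn (by rw [hρ.shift, h1.1]) ?_
      have := lineCount_add hn ρ (nthFixed n ρ m) 1
      rw [one_mul, one_mul, h1.2] at this
      exact this
    have hcount : ∀ (ρ : ℤ → ℤ) i, lineCount n ρ (i + n) = lineCount n ρ i + fixCount n ρ := by
      intro ρ i
      simpa using lineCount_add hn ρ i 1
    rcases x with i | i
    · change linePair n σ τ k (Node.top (i + n)) = _
      by_cases h : σ i = i
      · have hpos := (hσ.fixCount_pos_iff hn).2 ⟨i, h⟩
        rw [linePair_top_fixed k h, linePair_top_fixed k (by rw [hσ.shift, h]), hcount,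
          add_sub_right_comm, hfix, hnth τ hτ (hfix ▸ hpos)]
        rfl
      · rw [linePair_top k h, linePair_top k (by rw [hσ.shift]; simpa using h), hσ.shift]
        rfl
    · change linePair n σ τ k (Node.bot (i + n)) = _
      by_cases h : τ i = i
      · have hpos := (hτ.fixCount_pos_iff hn).2 ⟨i, h⟩
        rw [linePair_bot_fixed k h, linePair_bot_fixed k (by rw [hτ.shift, h]), hcount,
          add_right_comm, ← hfix, hnth σ hσ (hfix ▸ hpos)]
        rfl
      · rw [linePair_bot k h, linePair_bot k (by rw [hτ.shift]; simpa using h), hτ.shift]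
        rfl
  noncrossing x y := by
    -- Through edges keep their order because the numbering is increasing, an arc and a through edge
    -- do not cross because no fixed point lies under an arc, and arcs of the same row are nested or
    -- disjoint.
    rintro ⟨h1, h2, h3⟩
    rcases x with i | i
    · by_cases hi : σ i = i
      · have hpos := (hσ.fixCount_pos_iff hn).2 ⟨i, hi⟩
        have hq := nthFixed_spec hτ hn (hfix ▸ hpos) (lineCount n σ i - k)
        rw [linePair_top_fixed k hi] at h2 h3
        rcases y with j | j
        · have h1' : i < j := h1
          by_cases hj : σ j = j
          · have hr := nthFixed_spec hτ hn (hfix ▸ hpos) (lineCount n σ j - k)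
            rw [linePair_top_fixed k hj] at h3
            have h3' : nthFixed n τ (lineCount n σ j - k) < nthFixed n τ (lineCount n σ i - k) := h3
            rw [← lineCount_lt_iff hτ hn hq.1, hr.2, hq.2] at h3'
            have := lineCount_lt hσ hn h1' hj
            omega
          · rw [linePair_top k hj] at h3
            exact h3.elim
        · have h2' : nthFixed n τ (lineCount n σ i - k) < j := h2
          by_cases hj : τ j = j
          · rw [linePair_bot_fixed k hj] at h3
            exact h3.elim
          · rw [linePair_bot k hj] at h3
            have h3' : τ j < nthFixed n τ (lineCount n σ i - k) := h3
            exact (hτ.arc' j _ h3' h2').1 hq.1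
      · rw [linePair_top k hi] at h2 h3
        rcases y with j | j
        · have := hσ.arc i j h1 h2
          rw [linePair_top k this.1] at h3
          have h3' : σ i < σ j := h3
          omega
        · exact h2.elim
    · rcases y with j | j
      · exact h1.elim
      · have h1' : j < i := h1
        by_cases hi : τ i = i
        · rw [linePair_bot_fixed k hi] at h2
          exact h2.elim
        · rw [linePair_bot k hi] at h2 h3
          have h2' : τ i < j := h2
          have := hτ.arc' i j h2' h1'
          rw [linePair_bot k this.1] at h3
          have h3' : τ j < τ i := h3
          omega
  bands := b
  bands_eq_zero i j hij := by
    refine hb ((hσ.fixCount_pos_iff hn).2 ⟨i, ?_⟩)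
    by_contra h
    rw [linePair_top k h] at hij
    cases hij

variable (b : ℕ) (hb : 0 < fixCount n σ → b = 0)

theorem topMap_ofLines : topMap (ofLines hσ hτ hn hfix k b hb) = σ := by
  funext i
  by_cases h : σ i = i
  · rw [topMap_of_bot (D := ofLines hσ hτ hn hfix k b hb) (linePair_top_fixed k h), h]
  · exact topMap_of_top (D := ofLines hσ hτ hn hfix k b hb) (linePair_top k h)

theorem botMap_ofLines : botMap (ofLines hσ hτ hn hfix k b hb) = τ := by
  funext i
  by_cases h : τ i = i
  · rw [h]
    exact botMap_eq_self_iff.2 ⟨_, linePair_bot_fixed k h⟩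
  · exact botMap_of_bot (D := ofLines hσ hτ hn hfix k b hb) (linePair_bot k h)

theorem linked_ofLines : Linked (ofLines hσ hτ hn hfix k b hb) k := by
  intro p q hpq
  rw [topMap_ofLines, botMap_ofLines]
  change linePair n σ τ k (Node.top p) = Node.bot q at hpq
  by_cases h : σ p = p
  · have hpos := (hσ.fixCount_pos_iff hn).2 ⟨p, h⟩
    have hq := nthFixed_spec hτ hn (hfix ▸ hpos) (lineCount n σ p - k)
    rw [linePair_top_fixed k h] at hpq
    cases hpq
    rw [hq.2]
    ring
  · rw [linePair_top k h] at hpq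
    cases hpq

theorem exists_diagram (b : ℕ) (hb : 0 < fixCount n σ → b = 0) :
    ∃ D : AffineDiagram n, topMap D = σ ∧ botMap D = τ ∧ Linked D k ∧ D.bands = b :=
  ⟨ofLines hσ hτ hn hfix k b hb, topMap_ofLines .., botMap_ofLines ..,
    linked_ofLines hσ hτ hn hfix k b hb, rfl⟩

end

/-! ### The winding number -/

/-- The through edge with number `m` at the bottom has number `m + k` at the top, and the ends to
the left of the seam are those with number at most 0. The edges counted positively are those with `1
- k ≤ m ≤ 0`, the edges counted negatively those with `1 ≤ m ≤ -k`. The difference is `k` for either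
sign. -/
theorem Linked.winding_eq (hn : 0 < n) {D : AffineDiagram n} {k : ℤ} (hk : Linked D k)
    (hpos : 0 < fixCount n (topMap D)) : D.winding = k := by
  have hσ := isLine_topMap D
  have hτ := isLine_botMap D
  have hpos' : 0 < fixCount n (botMap D) := by rwa [fixCount_botMap hn]
  have hp := fun m => nthFixed_spec hσ hn hpos m
  have hq := fun m => nthFixed_spec hτ hn hpos' m
  set f : ℤ → ℤ × ℤ := fun m => (nthFixed n (topMap D) (m + k), nthFixed n (botMap D) m) with hf
  have hinj : Function.Injective f := by
    intro a b hab
    have := congrArg (lineCount n (botMap D)) (Prod.ext_iff.1 hab).2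
    simp only [hf] at this
    rwa [(hq a).2, (hq b).2] at this
  have hedge : ∀ w : ℤ × ℤ, D.pair (Node.bot w.2) = Node.top w.1 ↔ ∃ m, f m = w := by
    rintro ⟨p, q⟩
    simp only
    constructor
    · intro h
      have h1 : botMap D q = q := botMap_eq_self_iff.2 ⟨p, h⟩
      have h2 := (pair_eq_comm D).1 h
      refine ⟨lineCount n (botMap D) q, Prod.ext ?_ ?_⟩
      · exact nthFixed_eq hσ hn (topMap_of_bot h2) (hk p q h2)
      · exact nthFixed_eq hτ hn h1 rfl
    · rintro ⟨m, h⟩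
      obtain ⟨rfl, rfl⟩ := Prod.ext_iff.1 h
      obtain ⟨p, hp'⟩ := botMap_eq_self_iff.1 (hq m).1
      have h2 := (pair_eq_comm D).1 hp'
      have h3 := hk _ _ h2
      rw [(hq m).2] at h3
      change D.pair (Node.bot (nthFixed n (botMap D) m)) = _
      rw [hp']
      exact congrArg _ (nthFixed_eq hσ hn (topMap_of_bot h2) h3).symm
  have hle : ∀ m, (f m).2 ≤ 0 ↔ m ≤ 0 := by
    intro m
    rw [← (hq m).2]
    simp only [hf]
    rw [(hq m).2, ← lineCount_le_zero_iff hτ hn (hq m).1, (hq m).2]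
  have hle' : ∀ m, (f m).1 ≤ 0 ↔ m + k ≤ 0 := by
    intro m
    simp only [hf]
    rw [← lineCount_le_zero_iff hσ hn (hp (m + k)).1, (hp (m + k)).2]
  have h1 : {w : ℤ × ℤ | w.2 ≤ 0 ∧ 1 ≤ w.1 ∧ D.pair (Node.bot w.2) = Node.top w.1} =
      f '' Set.Icc (1 - k) 0 := by
    ext w
    simp only [Set.mem_ofPred_eq, hedge, Set.mem_image, Set.mem_Icc]
    constructor
    · rintro ⟨ha, hb, m, rfl⟩
      have := hle m
      have := hle' m
      exact ⟨m, by omega, rfl⟩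
    · rintro ⟨m, hm, rfl⟩
      have := hle m
      have := hle' m
      exact ⟨by omega, by omega, m, rfl⟩
  have h2 : {w : ℤ × ℤ | w.1 ≤ 0 ∧ 1 ≤ w.2 ∧ D.pair (Node.bot w.2) = Node.top w.1} =
      f '' Set.Icc 1 (-k) := by
    ext w
    simp only [Set.mem_ofPred_eq, hedge, Set.mem_image, Set.mem_Icc]
    constructor
    · rintro ⟨ha, hb, m, rfl⟩
      have := hle m
      have := hle' m
      exact ⟨m, by omega, rfl⟩
    · rintro ⟨m, hm, rfl⟩
      have := hle m
      have := hle' m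
      exact ⟨by omega, by omega, m, rfl⟩
  rw [winding, h1, h2, Set.ncard_image_of_injective _ hinj, Set.ncard_image_of_injective _ hinj,
    ← Finset.coe_Icc, ← Finset.coe_Icc, Set.ncard_coe_finset, Set.ncard_coe_finset, Int.card_Icc,
    Int.card_Icc]
  omega

theorem Linked.flip {D : AffineDiagram n} {k : ℤ} (hk : Linked D k) : Linked D.flip (-k) := by
  intro p q hpq
  rw [flip_pair] at hpq
  have h1 : D.pair (Node.bot p) = Node.top q := by
    rw [← Node.flip_flip (D.pair (Node.bot p))]
    exact congrArg Node.flip hpq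
  have := hk q p ((pair_eq_comm D).1 h1)
  rw [botMap_flip]
  change lineCount n (botMap D) p = _
  omega

end AffineDiagram

end

/-! ### Coordinates of a diagram: two tableaux and an index. -/

section

namespace AffineDiagram

variable {n : ℕ} [NeZero n]

/-! ### Diagrams and pairs of tableaux -/

/-- The permutation only records which residues are joined. A fixed point determines in addition the
direction of every arc, and with it the whole involution of the line. -/
theorem topIs_iff {D : AffineDiagram n} {S : Equiv.Perm (Fin n)}
    (hfix : ∃ r, S r = r) : D.TopIs S ↔ topMap D = annularMap S := by
  have h0 := isLine_topMap D
  have key : ∀ i j : Fin n, i ≠ j → ((∃ p : ℤ, D.pair (Node.top (label i)) =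
      Node.top (label j + p * n)) ↔ ∃ p : ℤ, topMap D (label i) = label j + p * n) := by
    intro i j hij
    refine exists_congr fun p => ⟨topMap_of_top, fun h => ?_⟩
    rw [pair_top_of_ne, h]
    rw [h]
    intro h'
    have : label j + p * n = label i + 0 * n := by simpa using h'
    exact hij (label_add_inj.1 this).1.symm
  constructor
  · intro h
    have h1 : ∀ r, S r = r → topMap D (label r) = label r := by
      intro r hr
      rw [← h0.toPerm_fixed_iff]
      by_contra hne
      have := (h r _ (Ne.symm hne)).2 ((key _ _ (Ne.symm hne)).2 ⟨_, h0.apply_label r⟩)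
      rw [hr] at this
      exact hne this.symm
    have h2 : h0.toPerm = S := by
      ext r : 1
      by_cases hr : S r = r
      · rw [hr, h0.toPerm_fixed_iff]
        exact h1 r hr
      · obtain ⟨p, hp⟩ := (key r (S r) (Ne.symm hr)).1 ((h r (S r) (Ne.symm hr)).1 rfl)
        exact h0.toPerm_eq_of hp
    obtain ⟨r, hr⟩ := hfix
    rw [← h2, h0.annularMap_toPerm ⟨_, h1 r hr⟩]
  · intro h i j hij
    rw [key i j hij, h, annularMap_label]
    constructor
    · rintro rfl
      exact ⟨_, rfl⟩
    · rintro ⟨p, hp⟩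
      exact (label_add_inj.1 hp).1

theorem botIs_iff {D : AffineDiagram n} {S : Equiv.Perm (Fin n)}
    (hfix : ∃ r, S r = r) : D.BotIs S ↔ botMap D = annularMap S := by
  rw [botMap, ← topIs_iff hfix]
  refine forall_congr' fun i => forall_congr' fun j => forall_congr' fun _ => iff_congr Iff.rfl
    (exists_congr fun p => ?_)
  rw [flip_pair, Node.flip]
  cases D.pair (Node.bot (label i)) <;> simp [Node.flip]

/-- The link of the diagrams with a given index. -/
def indexLink : (l : ℕ) → (cellTable l).ι → ℤ
  | 0, _ => 0
  | _ + 1, k => (show ℤ from k)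

/-- The number of bands of the diagrams with a given index. -/
def indexBands : (l : ℕ) → (cellTable l).ι → ℕ
  | 0, k => (show ℕ from k)
  | _ + 1, _ => 0

/-- `D` is the diagram with the tableaux `S` and `U` and the index `k`. -/
structure IsCell (l : ℕ) (S : cellTableaux n l) (k : (cellTable l).ι) (U : cellTableaux n l)
    (D : AffineDiagram n) : Prop where
  topMap_eq : topMap D = tabMap l S
  botMap_eq : botMap D = tabMap l U
  linked : Linked D (indexLink l k)
  bands_eq : D.bands = indexBands l k

omit [NeZero n] in
theorem linked_of_fixCount_eq_zero (hn : 0 < n) {D : AffineDiagram n}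
    (h : fixCount n (topMap D) = 0) (k : ℤ) : Linked D k := fun p q hpq =>
  absurd (((isLine_topMap D).fixCount_pos_iff hn).2 ⟨p, topMap_of_bot hpq⟩) (by omega)

/-- Both rows have `l` fixed points, so some diagram realizes them with the prescribed link and
bands, and `ext_of_linked` leaves no choice. The index carries a link if `l > 0` and a number of
bands if `l = 0`, so bands and through edges never occur together. -/
theorem existsUnique_isCell (l : ℕ) (S : cellTableaux n l) (k : (cellTable l).ι)
    (U : cellTableaux n l) : ∃! D, IsCell l S k U D := by
  have hn := Nat.pos_of_neZero n
  have hb : 0 < fixCount n (tabMap l S) → indexBands l k = 0 := by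
    rw [fixCount_tabMap]
    cases l with
    | zero => exact fun h => absurd h (lt_irrefl 0)
    | succ t => exact fun _ => rfl
  obtain ⟨D, h1, h2, h3, h4⟩ := exists_diagram (isLine_tabMap l S) (isLine_tabMap l U) hn
    (by rw [fixCount_tabMap, fixCount_tabMap]) (indexLink l k) (indexBands l k) hb
  refine ⟨D, ⟨h1, h2, h3, h4⟩, fun D' h => ?_⟩
  exact ext_of_linked hn (h.1.trans h1.symm) (h.2.trans h2.symm) h.3 h3 (h.4.trans h4.symm)

/-- The diagram with the tableaux `S` and `U` and the index `k`. -/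
def cellDiagram (l : ℕ) (S : cellTableaux n l) (k : (cellTable l).ι) (U : cellTableaux n l) :
    AffineDiagram n := (existsUnique_isCell l S k U).choose

theorem isCell_cellDiagram (l : ℕ) (S : cellTableaux n l) (k : (cellTable l).ι)
    (U : cellTableaux n l) : IsCell l S k U (cellDiagram l S k U) :=
  (existsUnique_isCell l S k U).choose_spec.1

theorem IsCell.eq {l : ℕ} {S : cellTableaux n l} {k : (cellTable l).ι} {U : cellTableaux n l}
    {D : AffineDiagram n} (h : IsCell l S k U D) : D = cellDiagram l S k U :=
  (existsUnique_isCell l S k U).choose_spec.2 D h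

theorem IsCell.fixCount_eq {l : ℕ} {S : cellTableaux n l} {k : (cellTable l).ι}
    {U : cellTableaux n l} {D : AffineDiagram n} (h : IsCell l S k U D) :
    fixCount n (topMap D) = l := by
  rw [h.topMap_eq, fixCount_tabMap]

theorem exists_isCell_of_maps (D : AffineDiagram n) {l : ℕ} {S U : cellTableaux n l}
    (hS : topMap D = tabMap l S) (hU : botMap D = tabMap l U) : ∃ k, IsCell l S k U D := by
  have hn := Nat.pos_of_neZero n
  have hl : fixCount n (topMap D) = l := by rw [hS, fixCount_tabMap]
  cases l with
  | zero => exact ⟨D.bands, hS, hU, linked_of_fixCount_eq_zero hn hl _, rfl⟩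
  | succ t =>
    obtain ⟨k, hk⟩ := exists_linked hn D
    exact ⟨k, hS, hU, hk, bands_eq_zero_of_pos hn (by omega)⟩

theorem exists_isCell (D : AffineDiagram n) :
    ∃ S k U, IsCell (fixCount n (topMap D)) S k U D := by
  have hn := Nat.pos_of_neZero n
  obtain ⟨S, hS⟩ := exists_tabMap (isLine_topMap D)
  obtain ⟨U, hU⟩ : ∃ U : cellTableaux n (fixCount n (topMap D)),
      tabMap (fixCount n (topMap D)) U = botMap D := by
    rw [← fixCount_botMap hn D]
    exact exists_tabMap (isLine_botMap D)
  obtain ⟨k, hk⟩ := exists_isCell_of_maps D hS.symm hU.symm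
  exact ⟨S, k, U, hk⟩

theorem indexLink_indexBands_injective {l : ℕ} {k k' : (cellTable l).ι}
    (h1 : indexLink l k = indexLink l k') (h2 : indexBands l k = indexBands l k') : k = k' := by
  cases l with
  | zero => exact h2
  | succ t => exact h1

theorem IsCell.unique {l : ℕ} {S S' : cellTableaux n l} {k k' : (cellTable l).ι}
    {U U' : cellTableaux n l} {D : AffineDiagram n} (h : IsCell l S k U D)
    (h' : IsCell l S' k' U' D) : S = S' ∧ k = k' ∧ U = U' := by
  have hn := Nat.pos_of_neZero n
  refine ⟨tabMap_injective l (h.1.symm.trans h'.1), ?_,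
    tabMap_injective l (h.2.symm.trans h'.2)⟩
  refine indexLink_indexBands_injective ?_ (h.4.symm.trans h'.4)
  have hl := h.fixCount_eq
  cases l with
  | zero => rfl
  | succ t =>
    exact (h.3.winding_eq hn (by omega)).symm.trans (h'.3.winding_eq hn (by omega))

/-- In the presence of through edges the link is the winding number, so the geometric description of
`[S₁, S₂, w]` agrees with the coordinates. -/
theorem isTriple_iff {t : ℕ} (S₁ S₂ : AnnularInvolution n (t + 1)) (w : ℤ)
    (D : AffineDiagram n) : IsTriple S₁ S₂ w D ↔ IsCell (t + 1) S₁ w S₂ D := by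
  have hn := Nat.pos_of_neZero n
  have hfix : ∀ S : AnnularInvolution n (t + 1), ∃ r, S.1 r = r := by
    intro S
    have : 0 < {k | S.1 k = k}.ncard := by rw [S.2.2]; omega
    exact (Set.ncard_pos (Set.toFinite _)).1 this
  rw [IsTriple, topIs_iff (hfix S₁), botIs_iff (hfix S₂)]
  constructor
  · rintro ⟨h1, h2, rfl⟩
    have hpos : 0 < fixCount n (topMap D) := by
      rw [h1, fixCount_annularMap, S₁.2.2]
      omega
    obtain ⟨k, hk⟩ := exists_linked hn D
    refine ⟨h1, h2, ?_, bands_eq_zero_of_pos hn hpos⟩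
    rw [← hk.winding_eq hn hpos] at hk
    exact hk
  · intro h
    have := h.fixCount_eq
    exact ⟨h.1, h.2, h.3.winding_eq hn (by omega)⟩

theorem isTripleZero_iff (S₁ S₂ : AffineInvolution n) (k : ℕ) (D : AffineDiagram n) :
    IsTripleZero S₁ S₂ k D ↔ IsCell 0 S₁ k S₂ D := by
  have hn := Nat.pos_of_neZero n
  constructor
  · rintro ⟨h1, h2, h3⟩
    have ht : topMap D = tabMap 0 S₁ := funext fun i => topMap_of_top (h1 i)
    refine ⟨ht, funext fun i => botMap_of_bot (h2 i),
      linked_of_fixCount_eq_zero hn ?_ _, h3⟩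
    exact (congrArg (fixCount n) ht).trans (fixCount_tabMap 0 S₁)
  · intro h
    refine ⟨fun i => ?_, fun i => ?_, h.4⟩
    · have h1 : topMap D i = S₁.1 i := congrFun h.1 i
      rw [pair_top_of_ne, h1]
      rw [h1]
      exact S₁.2.2.1 i
    · have h1 : botMap D i = S₂.1 i := congrFun h.2 i
      rw [pair_bot_of_ne, h1]
      rw [h1]
      exact S₂.2.2.1 i

theorem existsUnique_isTriple {t : ℕ} (ht : 0 < t) (S₁ S₂ : AnnularInvolution n t) (w : ℤ) :
    ∃! D, IsTriple S₁ S₂ w D := by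
  obtain ⟨t, rfl⟩ := Nat.exists_eq_succ_of_ne_zero ht.ne'
  refine (existsUnique_congr fun D => isTriple_iff S₁ S₂ w D).2 ?_
  exact existsUnique_isCell (t + 1) S₁ w S₂

theorem existsUnique_isTripleZero (S₁ S₂ : AffineInvolution n) (k : ℕ) :
    ∃! D, IsTripleZero S₁ S₂ k D := by
  refine (existsUnique_congr fun D => isTripleZero_iff S₁ S₂ k D).2 ?_
  exact existsUnique_isCell 0 S₁ k S₂

/-! ### Addition and reflection of indices -/

/-- The sum of two indices. -/
def indexAdd : (l : ℕ) → (cellTable l).ι → (cellTable l).ι → (cellTable l).ι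
  | 0, k, k' => (show ℕ from k) + (show ℕ from k')
  | _ + 1, k, k' => (show ℤ from k) + (show ℤ from k')

/-- The index of the reflected diagram. -/
def indexFlip : (l : ℕ) → (cellTable l).ι → (cellTable l).ι
  | 0, k => k
  | _ + 1, k => -(show ℤ from k)

/-- The index of the unit. -/
def indexZero : (l : ℕ) → (cellTable l).ι
  | 0 => (0 : ℕ)
  | _ + 1 => (0 : ℤ)

theorem indexLink_add (l : ℕ) (k k' : (cellTable l).ι) :
    indexLink l (indexAdd l k k') = indexLink l k + indexLink l k' := by
  cases l <;> rfl

theorem indexBands_add (l : ℕ) (k k' : (cellTable l).ι) :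
    indexBands l (indexAdd l k k') = indexBands l k + indexBands l k' := by
  cases l <;> rfl

theorem indexZero_add (l : ℕ) (k : (cellTable l).ι) : indexAdd l (indexZero l) k = k := by
  cases l with
  | zero => exact Nat.zero_add (show ℕ from k)
  | succ t => exact Int.zero_add (show ℤ from k)

theorem IsCell.flip {l : ℕ} {S U : cellTableaux n l} {k : (cellTable l).ι} {D : AffineDiagram n}
    (h : IsCell l S k U D) : IsCell l U (indexFlip l k) S D.flip := by
  have hn := Nat.pos_of_neZero n
  refine ⟨h.2, (botMap_flip D).trans h.1, ?_, ?_⟩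
  · cases l with
    | zero =>
      refine linked_of_fixCount_eq_zero hn ?_ _
      change fixCount n (botMap D) = 0
      rw [fixCount_botMap hn, h.fixCount_eq]
    | succ t => exact h.3.flip
  · rw [flip_bands, h.4]
    cases l <;> rfl

end AffineDiagram

end

/-! ### Bounds for the number of loops, and the case of equality. -/

section

/-! ### Counting classes with at least two elements -/

section

variable {α β : Type} [DecidableEq β] {s : Finset α} {f : α → β}

theorem two_mul_card_image_le (h : ∀ a ∈ s, ∃ b ∈ s, b ≠ a ∧ f b = f a) :
    2 * (s.image f).card ≤ s.card := by
  refine Finset.mul_card_image_le_card s 2 fun y hy => ?_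
  obtain ⟨a, ha, rfl⟩ := Finset.mem_image.1 hy
  obtain ⟨b, hb, hba, hf⟩ := h a ha
  exact Finset.one_lt_card.2 ⟨b, by simp [hb, hf], a, by simp [ha], hba⟩

/-- The case of equality: all classes have at least two elements, so a third element in one of them
would push the total above twice the number of classes. -/
theorem eq_or_eq_of_card_le (h : ∀ a ∈ s, ∃ b ∈ s, b ≠ a ∧ f b = f a)
    (hcard : s.card ≤ 2 * (s.image f).card) {a b c : α} (ha : a ∈ s) (hb : b ∈ s) (hc : c ∈ s)
    (hab : f b = f a) (hac : f c = f a) (hb' : b ≠ a) (hc' : c ≠ a) : b = c := by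
  by_contra hbc
  have h2 : ∀ y ∈ s.image f, 2 ≤ {x ∈ s | f x = y}.card := by
    intro y hy
    obtain ⟨a, ha, rfl⟩ := Finset.mem_image.1 hy
    obtain ⟨b, hb, hba, hf⟩ := h a ha
    exact Finset.one_lt_card.2 ⟨b, by simp [hb, hf], a, by simp [ha], hba⟩
  have h3 : 2 < {x ∈ s | f x = f a}.card :=
    Finset.two_lt_card.2 ⟨a, by simp [ha], b, by simp [hb, hab], c, by simp [hc, hac],
      hb'.symm, hc'.symm, hbc⟩
  have h4 := Finset.sum_lt_sum h2 ⟨f a, Finset.mem_image_of_mem f ha, h3⟩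
  rw [← Finset.card_eq_sum_card_image, Finset.sum_const, smul_eq_mul] at h4
  omega

end

theorem card_fin_ne (n : ℕ) (σ : ℤ → ℤ) [DecidablePred fun r : Fin n => σ (label r) ≠ label r] :
    ({r | σ (label r) ≠ label r} : Finset (Fin n)).card + AffineDiagram.fixCount n σ = n := by
  classical
  have h2 := Finset.card_filter_add_card_filter_not (s := Finset.univ)
    fun r : Fin n => σ (label r) = label r
  rw [Finset.card_univ, Fintype.card_fin] at h2
  have h3 : AffineDiagram.fixCount n σ =
      ({r | σ (label r) = label r} : Finset (Fin n)).card := by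
    rw [AffineDiagram.fixCount, ← Set.ncard_coe_finset]
    congr 1
    ext r
    simp
  rw [h3, add_comm]
  convert h2

open Classical in
/-- Periodic families of classes of integers can be counted on residues. -/
theorem ncard_eq_card_image {n : ℕ} [NeZero n] {X : Type} (f : ℤ → X) (P : ℤ → Prop)
    (hf : ∀ i p : ℤ, f (i + p * n) = f i) (hP : ∀ i p : ℤ, P (i + p * n) ↔ P i) :
    {L | ∃ i, L = f i ∧ P i}.ncard =
      (({r | P (label r)} : Finset (Fin n)).image fun r => f (label r)).card := by
  rw [← Set.ncard_coe_finset]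
  congr 1
  ext L
  simp only [Set.mem_ofPred_eq, Finset.coe_image, Finset.coe_filter, Finset.mem_univ, true_and,
    Set.mem_image]
  constructor
  · rintro ⟨i, rfl, hi⟩
    obtain ⟨r, p, rfl⟩ := AffineDiagram.exists_label_add (Nat.pos_of_neZero n) i
    exact ⟨r, (hP _ _).1 hi, (hf _ _).symm⟩
  · rintro ⟨r, hr, rfl⟩
    exact ⟨_, rfl, hr⟩

namespace AffineDiagram

variable {n : ℕ} {A B : AffineDiagram n}

/-! ### The curves of a stacked diagram through the middle row -/

theorem stackConn_botMap {i : ℤ} (h : botMap A i ≠ i) :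
    StackConn A B (i, 1) (botMap A i, 1) := by
  have := stackConn_upper A B (Node.bot i)
  rwa [pair_bot_of_ne h] at this

theorem stackConn_topMap {i : ℤ} (h : topMap B i ≠ i) :
    StackConn A B (i, 1) (topMap B i, 1) := by
  have := stackConn_lower A B (Node.top i)
  rwa [pair_top_of_ne h] at this

theorem InnerLoop.botMap_ne {i : ℤ} (h : InnerLoop A B i) : botMap A i ≠ i := by
  intro hi
  obtain ⟨j, hj⟩ := botMap_eq_self_iff.1 hi
  have := stackConn_upper A B (Node.bot i)
  rw [hj] at this
  exact h (Node.top j) this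

theorem InnerLoop.topMap_ne {i : ℤ} (h : InnerLoop A B i) : topMap B i ≠ i := by
  intro hi
  obtain ⟨j, hj⟩ := topMap_eq_self_iff.1 hi
  have := stackConn_lower A B (Node.top i)
  rw [hj] at this
  exact h (Node.bot j) this

theorem InnerLoop.of_conn {i j : ℤ} (h : InnerLoop A B i) (hij : StackConn A B (i, 1) (j, 1)) :
    InnerLoop A B j := fun x hx => h x (hij.trans hx)

theorem InnerLoop.shift {i : ℤ} (h : InnerLoop A B i) (p : ℤ) : InnerLoop A B (i + p * n) := by
  intro x hx
  refine h (x.shift (-p * n)) ?_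
  rw [outer_shift]
  convert hx.shift (-p) using 2
  ring

theorem innerLoop_shift_iff (i p : ℤ) : InnerLoop A B (i + p * n) ↔ InnerLoop A B i := by
  refine ⟨fun h => ?_, fun h => h.shift p⟩
  simpa using h.shift (-p)

theorem InnerContractible.of_conn {i j : ℤ} (h : InnerContractible A B i)
    (hij : StackConn A B (i, 1) (j, 1)) : InnerContractible A B j := by
  intro p hp
  exact h p ((hij.trans hp).trans (hij.symm.shift p))

theorem InnerContractible.shift {i : ℤ} (h : InnerContractible A B i) (p : ℤ) :
    InnerContractible A B (i + p * n) := by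
  intro q hq
  refine h q ?_
  convert hq.shift (-p) using 2 <;> ring

theorem innerContractible_shift_iff (i p : ℤ) :
    InnerContractible A B (i + p * n) ↔ InnerContractible A B i := by
  refine ⟨fun h => ?_, fun h => h.shift p⟩
  simpa using h.shift (-p)

theorem innerCurve_shift (i p : ℤ) : innerCurve A B (i + p * n) = innerCurve A B i :=
  (innerCurve_eq_iff ..).2 ⟨p, .refl⟩

theorem innerCurve_eq_of_conn {i j : ℤ} (h : StackConn A B (i, 1) (j, 1)) :
    innerCurve A B i = innerCurve A B j :=
  (innerCurve_eq_iff ..).2 ⟨0, by simpa using h⟩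

section

variable [NeZero n]

variable (A B) in
open Classical in
/-- The residues of the middle row on contractible closed curves. -/
def loopResidues : Finset (Fin n) :=
  {r | InnerLoop A B (label r) ∧ InnerContractible A B (label r)}

omit [NeZero n] in
theorem mem_loopResidues {r : Fin n} : r ∈ loopResidues A B ↔
    InnerLoop A B (label r) ∧ InnerContractible A B (label r) := by
  classical
  simp [loopResidues]

open Classical in
theorem stackLoops_eq_card :
    stackLoops A B = ((loopResidues A B).image fun r => innerCurve A B (label r)).card := by
  rw [stackLoops, ncard_eq_card_image (innerCurve A B)
    (fun i => InnerLoop A B i ∧ InnerContractible A B i) innerCurve_shift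
    (fun i p => and_congr (innerLoop_shift_iff i p) (innerContractible_shift_iff i p))]
  unfold loopResidues
  congr!

omit [NeZero n] in
theorem mem_loopResidues_of_conn {r s : Fin n} (hr : r ∈ loopResidues A B) {p : ℤ}
    (h : StackConn A B (label r, 1) (label s + p * n, 1)) :
    s ∈ loopResidues A B ∧ innerCurve A B (label s) = innerCurve A B (label r) := by
  rw [mem_loopResidues] at hr ⊢
  refine ⟨⟨?_, ?_⟩, ?_⟩
  · exact (innerLoop_shift_iff _ p).1 (hr.1.of_conn h)
  · exact (innerContractible_shift_iff _ p).1 (hr.2.of_conn h)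
  · rw [innerCurve_eq_of_conn h, innerCurve_shift]

/-- No point is moved by a nonzero multiple of `n`, so the partner of a moved residue lies in a
different residue class. -/
theorem exists_partner_of_isLine {σ : ℤ → ℤ} (hσ : IsLine n σ) {r : Fin n}
    (hne : σ (label r) ≠ label r) :
    ∃ (s : Fin n) (p : ℤ), σ (label r) = label s + p * n ∧ s ≠ r := by
  obtain ⟨s, p, hp⟩ := exists_label_add (n := n) (Nat.pos_of_neZero n) (σ (label r))
  refine ⟨s, p, hp, ?_⟩
  rintro rfl
  rw [hσ.eq_of_eq_add (Nat.pos_of_neZero n) hp] at hp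
  simp at hp
  exact hne hp

theorem exists_partner_bot {r : Fin n} (hr : r ∈ loopResidues A B) :
    ∃ (s : Fin n) (p : ℤ), botMap A (label r) = label s + p * n ∧ s ≠ r ∧
      StackConn A B (label r, 1) (label s + p * n, 1) := by
  have hne := (mem_loopResidues.1 hr).1.botMap_ne
  obtain ⟨s, p, hp, hs⟩ := exists_partner_of_isLine (isLine_botMap A) hne
  exact ⟨s, p, hp, hs, hp ▸ stackConn_botMap hne⟩

theorem exists_partner_top {r : Fin n} (hr : r ∈ loopResidues A B) :
    ∃ (s : Fin n) (p : ℤ), topMap B (label r) = label s + p * n ∧ s ≠ r ∧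
      StackConn A B (label r, 1) (label s + p * n, 1) := by
  have hne := (mem_loopResidues.1 hr).1.topMap_ne
  obtain ⟨s, p, hp, hs⟩ := exists_partner_of_isLine (isLine_topMap B) hne
  exact ⟨s, p, hp, hs, hp ▸ stackConn_topMap hne⟩

theorem loopResidues_two {r : Fin n} (hr : r ∈ loopResidues A B) :
    ∃ s ∈ loopResidues A B, s ≠ r ∧ innerCurve A B (label s) = innerCurve A B (label r) := by
  obtain ⟨s, p, -, hs, hc⟩ := exists_partner_bot hr
  have := mem_loopResidues_of_conn hr hc
  exact ⟨s, this.1, hs, this.2⟩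

theorem two_mul_stackLoops_le_card (A B : AffineDiagram n) :
    2 * stackLoops A B ≤ (loopResidues A B).card := by
  classical
  rw [stackLoops_eq_card]
  exact two_mul_card_image_le fun r hr => loopResidues_two hr

/-- Each loop takes up at least two residues, and none of them is the end of a through edge of `A`.
Together with the corresponding bound for `B` this controls the degrees of the structure constants.
-/
theorem two_mul_stackLoops_add_botMap_le (A B : AffineDiagram n) :
    2 * stackLoops A B + fixCount n (botMap A) ≤ n := by
  classical
  have h1 := two_mul_stackLoops_le_card A B
  have h2 := card_fin_ne n (botMap A)
  have h3 : loopResidues A B ⊆ ({r | botMap A (label r) ≠ label r} : Finset (Fin n)) := by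
    intro r hr
    simpa using (mem_loopResidues.1 hr).1.botMap_ne
  have := Finset.card_le_card h3
  omega

theorem two_mul_stackLoops_add_topMap_le (A B : AffineDiagram n) :
    2 * stackLoops A B + fixCount n (topMap B) ≤ n := by
  classical
  have h1 := two_mul_stackLoops_le_card A B
  have h2 := card_fin_ne n (topMap B)
  have h3 : loopResidues A B ⊆ ({r | topMap B (label r) ≠ label r} : Finset (Fin n)) := by
    intro r hr
    simpa using (mem_loopResidues.1 hr).1.topMap_ne
  have := Finset.card_le_card h3
  omega

/-- If the number of loops is as large as possible, then the two inner rows agree. -/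
theorem botMap_eq_topMap_of_stackLoops (hA : n ≤ 2 * stackLoops A B + fixCount n (botMap A))
    (hB : n ≤ 2 * stackLoops A B + fixCount n (topMap B)) : botMap A = topMap B := by
  classical
  have h1 := two_mul_stackLoops_le_card A B
  have hA' := card_fin_ne n (botMap A)
  have hB' := card_fin_ne n (topMap B)
  have h3 : loopResidues A B ⊆ ({r | botMap A (label r) ≠ label r} : Finset (Fin n)) := by
    intro r hr
    simpa using (mem_loopResidues.1 hr).1.botMap_ne
  have h4 : loopResidues A B ⊆ ({r | topMap B (label r) ≠ label r} : Finset (Fin n)) := by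
    intro r hr
    simpa using (mem_loopResidues.1 hr).1.topMap_ne
  have h3' := Finset.card_le_card h3
  -- Equality in both counts: each residue moved in either row lies on a loop, and each loop meets
  -- only two residues.
  have h5 := Finset.eq_of_subset_of_card_le h3 (by omega)
  have h6 := Finset.eq_of_subset_of_card_le h4 (by omega)
  funext i
  obtain ⟨r, q, rfl⟩ := exists_label_add (Nat.pos_of_neZero n) i
  rw [(isLine_botMap A).shift_mul, (isLine_topMap B).shift_mul]
  congr 1
  by_cases hr : r ∈ loopResidues A B
  · obtain ⟨s, p, hs, hsr, hsc⟩ := exists_partner_bot hr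
    obtain ⟨s', p', hs', hsr', hsc'⟩ := exists_partner_top hr
    have hs1 := mem_loopResidues_of_conn hr hsc
    have hs2 := mem_loopResidues_of_conn hr hsc'
    rw [stackLoops_eq_card] at hA h1
    obtain rfl := eq_or_eq_of_card_le (fun r hr => loopResidues_two hr) (by omega) hr hs1.1 hs2.1
      hs1.2 hs2.2 hsr hsr'
    -- The partners in the two rows agree as residues; a difference of sheets would be a nonzero
    -- period of a contractible loop.
    have h7 : p - p' = 0 := by
      refine (mem_loopResidues.1 hs1.1).2 _ ?_
      convert (hsc'.symm.trans hsc).shift (-p') using 2 <;> ring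
    rw [hs, hs', sub_eq_zero.1 h7]
  · have h7 := hr
    rw [h5] at h7
    rw [h6] at hr
    simp only [Finset.mem_filter, Finset.mem_univ, true_and, not_not] at h7 hr
    rw [hr, h7]

end

/-! ### Composites of diagrams whose inner rows agree -/

section

variable {E : AffineDiagram n}

theorem IsComposite.pair_top_of_ne (hn : 0 < n) (hE : IsComposite A B E) {i : ℤ}
    (h : topMap A i ≠ i) : E.pair (Node.top i) = Node.top (topMap A i) := by
  have h1 := stackConn_upper A B (Node.top i)
  rw [AffineDiagram.pair_top_of_ne h] at h1
  rcases hE.eq_or_of_conn hn (x := Node.top i) (z := Node.top (topMap A i)) h1 with h2 | h2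
  · exact (h (Node.top.inj h2)).elim
  · exact h2.symm

theorem IsComposite.topMap_eq_of_ne (hn : 0 < n) (hE : IsComposite A B E) {i : ℤ}
    (h : topMap A i ≠ i) : topMap E i = topMap A i := topMap_of_top (hE.pair_top_of_ne hn h)

/-- The arcs in the top row of `A` survive in the composite, so through edges can only be lost. This
is the triangularity with respect to the order of the cells. -/
theorem IsComposite.fixCount_topMap_le (hn : 0 < n) (hE : IsComposite A B E) :
    fixCount n (topMap E) ≤ fixCount n (topMap A) := by
  refine Set.ncard_le_ncard (fun r hr => ?_) (Set.toFinite _)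
  by_contra h
  exact h ((hE.topMap_eq_of_ne hn h).symm.trans hr)

theorem IsComposite.fixCount_botMap_le (hn : 0 < n) (hE : IsComposite A B E) :
    fixCount n (botMap E) ≤ fixCount n (botMap B) := hE.flip.fixCount_topMap_le hn

theorem IsComposite.topMap_eq (hn : 0 < n) (hE : IsComposite A B E)
    (h : fixCount n (topMap A) ≤ fixCount n (topMap E)) : topMap E = topMap A := by
  have hsub : {r : Fin n | topMap E (label r) = label r} ⊆
      {r : Fin n | topMap A (label r) = label r} := by
    intro r hr
    by_contra h
    exact h ((hE.topMap_eq_of_ne hn h).symm.trans hr)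
  have heq := Set.eq_of_subset_of_ncard_le hsub h (Set.toFinite _)
  funext i
  obtain ⟨r, p, rfl⟩ := exists_label_add hn i
  rw [(isLine_topMap A).shift_mul, (isLine_topMap E).shift_mul]
  congr 1
  by_cases hr : topMap A (label r) = label r
  · have : r ∈ {r : Fin n | topMap A (label r) = label r} := hr
    rw [← heq] at this
    exact this.trans hr.symm
  · exact hE.topMap_eq_of_ne hn hr

theorem IsComposite.botMap_eq (hn : 0 < n) (hE : IsComposite A B E)
    (h : fixCount n (botMap B) ≤ fixCount n (botMap E)) : botMap E = botMap B :=
  hE.flip.topMap_eq hn h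

section

variable (hAB : botMap A = topMap B)
include hAB

theorem IsComposite.pair_top_of_fixed (hn : 0 < n) (hE : IsComposite A B E) {i : ℤ}
    (h : topMap A i = i) : ∃ j k, A.pair (Node.top i) = Node.bot j ∧
      B.pair (Node.top j) = Node.bot k ∧ E.pair (Node.top i) = Node.bot k := by
  obtain ⟨j, hj⟩ := topMap_eq_self_iff.1 h
  have h1 : topMap B j = j := by
    rw [← hAB]
    exact botMap_eq_self_iff.2 ⟨i, (pair_eq_comm A).1 hj⟩
  obtain ⟨k, hk⟩ := topMap_eq_self_iff.1 h1
  refine ⟨j, k, hj, hk, ?_⟩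
  have h2 := stackConn_upper A B (Node.top i)
  have h3 := stackConn_lower A B (Node.top j)
  rw [hj] at h2
  rw [hk] at h3
  rcases hE.eq_or_of_conn hn (x := Node.top i) (z := Node.bot k) (h2.trans h3) with h4 | h4
  · cases h4
  · exact h4.symm

theorem IsComposite.topMap_eq_of_eq (hn : 0 < n) (hE : IsComposite A B E) :
    topMap E = topMap A := by
  funext i
  by_cases h : topMap A i = i
  · obtain ⟨j, k, -, -, hk⟩ := hE.pair_top_of_fixed hAB hn h
    rw [topMap_of_bot hk, h]
  · exact hE.topMap_eq_of_ne hn h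

theorem IsComposite.botMap_eq_of_eq (hn : 0 < n) (hE : IsComposite A B E) :
    botMap E = botMap B :=
  hE.flip.topMap_eq_of_eq (by rw [botMap_flip, ← hAB]; rfl) hn

theorem IsComposite.linked_of_eq (hn : 0 < n) (hE : IsComposite A B E) {k k' : ℤ}
    (hk : Linked A k) (hk' : Linked B k') : Linked E (k + k') := by
  intro p q hpq
  rw [hE.topMap_eq_of_eq hAB hn, hE.botMap_eq_of_eq hAB hn]
  have hp : topMap A p = p := by
    rw [← hE.topMap_eq_of_eq hAB hn]
    exact topMap_of_bot hpq
  obtain ⟨j, q', h1, h2, h3⟩ := hE.pair_top_of_fixed hAB hn hp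
  rw [h3] at hpq
  cases hpq
  have h4 := hk _ _ h1
  have h5 := hk' _ _ h2
  rw [hAB] at h4
  omega

/-- When the facing rows agree, every arc of `A` closes up with the same arc of `B` to a loop with
two points. -/
theorem stackConn_cases_of_eq {i : ℤ} (hi : botMap A i ≠ i) {Q : ℤ × ℤ}
    (h : StackConn A B (i, 1) Q) : Q = (i, 1) ∨ Q = (botMap A i, 1) := by
  have hstep : ∀ j, botMap A j ≠ j → ∀ Q, StackStep A B (j, 1) Q → Q = (botMap A j, 1) := by
    rintro j hj Q (⟨x | x, hx, rfl⟩ | ⟨x | x, hx, rfl⟩)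
    · simp [place] at hx
    · obtain ⟨rfl, -⟩ := Prod.ext_iff.1 hx
      rw [pair_bot_of_ne hj]
      rfl
    · obtain ⟨rfl, -⟩ := Prod.ext_iff.1 hx
      rw [hAB] at hj ⊢
      rw [AffineDiagram.pair_top_of_ne hj]
      rfl
    · simp [place] at hx
  induction h with
  | refl => exact Or.inl rfl
  | tail _ h ih =>
    rcases ih with rfl | rfl
    · exact Or.inr (hstep _ hi _ h)
    · refine Or.inl ?_
      have := hstep _ (by rw [(isLine_botMap A).invol]; exact hi.symm) _ h
      rwa [(isLine_botMap A).invol] at this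

theorem innerLoop_iff_of_eq {i : ℤ} : InnerLoop A B i ↔ botMap A i ≠ i := by
  refine ⟨InnerLoop.botMap_ne, fun hi x hx => ?_⟩
  rcases stackConn_cases_of_eq hAB hi hx with h | h <;> cases x <;> simp [outer] at h

theorem innerContractible_of_eq (hn : 0 < n) {i : ℤ} (hi : botMap A i ≠ i) :
    InnerContractible A B i := by
  intro p hp
  rcases stackConn_cases_of_eq hAB hi hp with h | h
  · have := (Prod.ext_iff.1 h).1
    simp only [add_eq_left, mul_eq_zero] at this
    omega
  · exact (isLine_botMap A).eq_of_eq_add hn (Prod.ext_iff.1 h).1.symm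

theorem stackBands_of_eq (hn : 0 < n) : stackBands A B = 0 := by
  rw [stackBands, show {L : Set ℤ | ∃ i, L = innerCurve A B i ∧ InnerLoop A B i ∧
    ¬ InnerContractible A B i} = ∅ from ?_, Set.ncard_empty]
  refine Set.eq_empty_of_forall_notMem ?_
  rintro _ ⟨k, -, hk, hk'⟩
  exact hk' (innerContractible_of_eq hAB hn hk.botMap_ne)

/-- All moved residues lie on contractible loops, and each loop meets just two of them, so the upper
bound is attained. -/
theorem two_mul_stackLoops_of_eq [NeZero n] :
    2 * stackLoops A B + fixCount n (botMap A) = n := by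
  classical
  have hn := Nat.pos_of_neZero n
  have h1 := card_fin_ne n (botMap A)
  have h2 : loopResidues A B = ({r | botMap A (label r) ≠ label r} : Finset (Fin n)) := by
    ext r
    rw [mem_loopResidues, innerLoop_iff_of_eq hAB]
    simp only [ne_eq, Finset.mem_filter, Finset.mem_univ, true_and, and_iff_left_iff_imp]
    exact fun h => innerContractible_of_eq hAB hn h
  have h3 : (loopResidues A B).card ≤ 2 * stackLoops A B := by
    rw [stackLoops_eq_card]
    refine Finset.card_le_mul_card_image _ 2 fun L hL => ?_
    obtain ⟨r, hr, rfl⟩ := Finset.mem_image.1 hL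
    obtain ⟨s, p, hs, -, -⟩ := exists_partner_bot hr
    refine (Finset.card_le_card (t := {r, s}) fun u hu => ?_).trans Finset.card_le_two
    rw [Finset.mem_filter] at hu
    obtain ⟨q, hq⟩ := (innerCurve_eq_iff ..).1 hu.2.symm
    rw [Finset.mem_insert, Finset.mem_singleton]
    rcases stackConn_cases_of_eq hAB (mem_loopResidues.1 hr).1.botMap_ne hq with h | h
    · left
      have : label u + q * n = label r + 0 * n := by simpa using (Prod.ext_iff.1 h).1
      exact (label_add_inj.1 this).1
    · right
      have : label u + q * n = label s + p * n := ((Prod.ext_iff.1 h).1).trans hs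
      exact (label_add_inj.1 this).1
  have h4 := two_mul_stackLoops_add_botMap_le A B
  rw [h2] at h3
  omega

end

/-- The facing rows agree, so the through edges are joined end to end and their links add. The bands
add as well, because no new band is formed. -/
theorem IsCell.mul [NeZero n] {l : ℕ} {S U V : cellTableaux n l} {k k' : (cellTable l).ι}
    (hA : IsCell l S k U A) (hB : IsCell l U k' V B) (hE : IsComposite A B E) :
    IsCell l S (indexAdd l k k') V E := by
  have hn := Nat.pos_of_neZero n
  have hAB : botMap A = topMap B := hA.2.trans hB.1.symm
  refine ⟨(hE.topMap_eq_of_eq hAB hn).trans hA.1, (hE.botMap_eq_of_eq hAB hn).trans hB.2, ?_, ?_⟩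
  · rw [indexLink_add]
    exact hE.linked_of_eq hAB hn hA.3 hB.3
  · rw [indexBands_add, hE.2, stackBands_of_eq hAB hn, hA.4, hB.4, add_zero]

end

/-! ### Dependence on the bands -/

/-- A tabular basis element of the cell 0 is a combination of diagrams that differ only in their
bands. Curves, loops and the matching of a composite ignore bands, so such diagrams can be
multiplied together. -/
theorem stackConn_congr {A' B' : AffineDiagram n} (hA : A.pair = A'.pair) (hB : B.pair = B'.pair) :
    StackConn A B = StackConn A' B' := by
  unfold StackConn StackStep
  rw [hA, hB]

theorem stackLoops_congr {A' B' : AffineDiagram n} (hA : A.pair = A'.pair)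
    (hB : B.pair = B'.pair) : stackLoops A B = stackLoops A' B' := by
  unfold stackLoops innerCurve InnerLoop InnerContractible
  rw [stackConn_congr hA hB]

theorem IsComposite.pair_congr (hn : 0 < n) {A' B' E E' : AffineDiagram n}
    (hA : A.pair = A'.pair) (hB : B.pair = B'.pair) (hE : IsComposite A B E)
    (hE' : IsComposite A' B' E') : E.pair = E'.pair := by
  funext x
  have h := hE'.1 x
  rw [← stackConn_congr hA hB] at h
  exact ((hE.eq_or_of_conn hn h).resolve_left (E'.pair_ne x)).symm

end AffineDiagram

end

/-! ### The associative algebra, its unit, and leading terms of Laurent polynomials. -/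

section

open AffineDiagram

variable {n : ℕ}

namespace DiagramAlgebra

/-! ### The algebra on the basis of diagrams -/

theorem lift_of {N : Type} [AddCommGroup N] [Module ℤ[T;T⁻¹] N] (f : AffineDiagram n → N)
    (D : AffineDiagram n) : lift f (of D) = f D := by
  change Finsupp.linearCombination ℤ[T;T⁻¹] f (Finsupp.single D 1) = f D
  rw [Finsupp.linearCombination_single, one_smul]

theorem span_of : Submodule.span ℤ[T;T⁻¹] (Set.range (of (n := n))) = ⊤ := by
  have h := (Finsupp.basisSingleOne (R := ℤ[T;T⁻¹]) (ι := AffineDiagram n)).span_eq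
  rw [Finsupp.coe_basisSingleOne] at h
  exact h

theorem induction {p : DiagramAlgebra n → Prop} (hof : ∀ D, p (of D))
    (hadd : ∀ x y, p x → p y → p (x + y)) (hsmul : ∀ (c : ℤ[T;T⁻¹]) x, p x → p (c • x))
    (hzero : p 0) (x : DiagramAlgebra n) : p x := by
  have hx : x ∈ Submodule.span ℤ[T;T⁻¹] (Set.range (of (n := n))) := by
    rw [span_of]; trivial
  induction hx using Submodule.span_induction with
  | mem x hx => obtain ⟨D, rfl⟩ := hx; exact hof D
  | zero => exact hzero
  | add x y _ _ hx hy => exact hadd x y hx hy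
  | smul c x _ hx => exact hsmul c x hx

theorem linearMap_ext {N : Type} [AddCommGroup N] [Module ℤ[T;T⁻¹] N]
    {f g : DiagramAlgebra n →ₗ[ℤ[T;T⁻¹]] N} (h : ∀ D, f (of D) = g (of D)) (x : DiagramAlgebra n) :
    f x = g x := by
  induction x using induction with
  | hof D => exact h D
  | hadd x y hx hy => rw [map_add, map_add, hx, hy]
  | hsmul c x hx => rw [map_smul, map_smul, hx]
  | hzero => rw [map_zero, map_zero]

theorem mul_def (x y : DiagramAlgebra n) : x * y = mulMap x y := rfl

theorem smul_mul (c : ℤ[T;T⁻¹]) (x y : DiagramAlgebra n) : c • x * y = c • (x * y) := by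
  rw [mul_def, map_smul, LinearMap.smul_apply, ← mul_def]

theorem mul_smul (c : ℤ[T;T⁻¹]) (x y : DiagramAlgebra n) : x * c • y = c • (x * y) := by
  rw [mul_def, map_smul, ← mul_def]

theorem of_mul_of (hn : 0 < n) {A B E : AffineDiagram n} (hE : IsComposite A B E) :
    of A * of B = quantumTwo ^ stackLoops A B • of E := by
  have h : ∃ E, IsComposite A B E := ⟨E, hE⟩
  rw [mul_def, mulMap, lift_of, lift_of, diagramMul, dif_pos h, h.choose_spec.eq_comp hn,
    hE.eq_comp hn]

theorem mul_assoc (hn : 0 < n) (x y z : DiagramAlgebra n) : x * y * z = x * (y * z) := by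
  induction x using induction with
  | hadd x x' hx hx' => simp only [add_mul, hx, hx']
  | hsmul c x hx => simp only [smul_mul, hx]
  | hzero => simp only [zero_mul]
  | hof A =>
  induction y using induction with
  | hadd y y' hy hy' => simp only [add_mul, mul_add, hy, hy']
  | hsmul c y hy => simp only [smul_mul, mul_smul, hy]
  | hzero => simp only [zero_mul, mul_zero]
  | hof B =>
  induction z using induction with
  | hadd z z' hz hz' => simp only [mul_add, hz, hz']
  | hsmul c z hz => simp only [mul_smul, hz]
  | hzero => simp only [mul_zero]
  | hof C =>
  have hE := isComposite_comp hn A B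
  have hE' := isComposite_comp hn B C
  have hG := isComposite_comp hn (comp hn A B) C
  rw [of_mul_of hn hE, of_mul_of hn hE', smul_mul, mul_smul, of_mul_of hn hG,
    of_mul_of hn (hE.assoc hn hE' hG), smul_smul, smul_smul, ← pow_add, ← pow_add,
    add_comm, stackLoops_assoc hn hE hE', add_comm]

/-! ### Reflection -/

/-- Reflection of diagrams. -/
def reflect : DiagramAlgebra n →ₗ[ℤ[T;T⁻¹]] DiagramAlgebra n := lift fun D => of D.flip

theorem reflect_of (D : AffineDiagram n) : reflect (of D) = of D.flip := lift_of _ _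

theorem reflect_reflect (x : DiagramAlgebra n) : reflect (reflect x) = x := by
  have := linearMap_ext (f := reflect ∘ₗ reflect) (g := LinearMap.id (M := DiagramAlgebra n))
    (fun D => by
      rw [LinearMap.comp_apply, reflect_of, reflect_of, AffineDiagram.flip_flip, LinearMap.id_apply]) x
  exact this

theorem reflect_mul (hn : 0 < n) (x y : DiagramAlgebra n) :
    reflect (x * y) = reflect y * reflect x := by
  induction x using induction with
  | hadd x x' hx hx' => simp only [add_mul, mul_add, map_add, hx, hx']
  | hsmul c x hx => simp only [smul_mul, mul_smul, map_smul, hx]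
  | hzero => simp only [zero_mul, mul_zero, map_zero]
  | hof A =>
  induction y using induction with
  | hadd y y' hy hy' => simp only [add_mul, mul_add, map_add, hy, hy']
  | hsmul c y hy => simp only [smul_mul, mul_smul, map_smul, hy]
  | hzero => simp only [zero_mul, mul_zero, map_zero]
  | hof B =>
  have hE := isComposite_comp hn A B
  rw [of_mul_of hn hE, map_smul, reflect_of, reflect_of, reflect_of, of_mul_of hn hE.flip,
    stackLoops_flip]

end DiagramAlgebra

/-! ### The identity diagram -/

namespace AffineDiagram

variable (n) in
/-- The diagram in which every node is joined to the opposite one. -/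
def identity : AffineDiagram n where
  pair := Node.flip
  pair_pair := Node.flip_flip
  pair_ne x := by cases x <;> simp [Node.flip]
  pair_shift x := by cases x <;> rfl
  noncrossing x y := by
    rintro ⟨h1, h2, h3⟩
    cases x <;> cases y <;> simp [Node.Before, Node.flip] at h1 h2 h3
    omega
  bands := 0
  bands_eq_zero _ _ _ := rfl

theorem topMap_identity (i : ℤ) : topMap (identity n) i = i := topMap_of_bot (j := i) rfl

theorem flip_identity : (identity n).flip = identity n := by
  ext x
  · cases x <;> rfl
  · rfl

theorem botMap_identity (i : ℤ) : botMap (identity n) i = i := by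
  rw [botMap, flip_identity, topMap_identity]

theorem fixCount_identity : fixCount n (topMap (identity n)) = n := by
  rw [fixCount]
  simp [topMap_identity]

theorem not_innerLoop_identity (A : AffineDiagram n) (i : ℤ) :
    ¬ InnerLoop (identity n) A i := fun h => h.botMap_ne (botMap_identity i)

theorem stackLoops_identity (A : AffineDiagram n) : stackLoops (identity n) A = 0 := by
  simp [stackLoops, not_innerLoop_identity]

theorem isComposite_identity (A : AffineDiagram n) : IsComposite (identity n) A A := by
  refine ⟨fun x => ?_, ?_⟩
  swap
  · simp only [stackBands, not_innerLoop_identity, false_and, and_false, exists_false,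
      Set.ofPred_false, Set.ncard_empty]
    exact (Nat.zero_add _).symm
  have h : ∀ x, StackConn (identity n) A (outer x) (place 0 x) := by
    rintro (i | i)
    · exact stackConn_upper (identity n) A (Node.top i)
    · exact .refl
  exact ((h x).trans (stackConn_lower _ A x)).trans (h _).symm

end AffineDiagram

namespace DiagramAlgebra

theorem identity_mul (hn : 0 < n) (x : DiagramAlgebra n) : of (identity n) * x = x := by
  induction x using induction with
  | hof A => rw [of_mul_of hn (isComposite_identity A), stackLoops_identity, pow_zero, one_smul]
  | hadd x y hx hy => rw [mul_add, hx, hy]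
  | hsmul c x hx => rw [mul_smul, hx]
  | hzero => rw [mul_zero]

theorem mul_identity (hn : 0 < n) (x : DiagramAlgebra n) : x * of (identity n) = x := by
  rw [← reflect_reflect (x * _), reflect_mul hn, reflect_of, flip_identity, identity_mul hn,
    reflect_reflect]

end DiagramAlgebra

/-! ### Laurent polynomials with a given leading term -/

/-- `f` has degree at most `d`, and `m` is the coefficient of `v ^ d`. -/
def HasLead (f : ℤ[T;T⁻¹]) (d m : ℤ) : Prop := f.coeff d = m ∧ ∀ e, d < e → f.coeff e = 0

namespace HasLead

open DiagramAlgebra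

variable {f g : ℤ[T;T⁻¹]} {d m : ℤ}

theorem coeff_T_mul (k e : ℤ) (f : ℤ[T;T⁻¹]) : (T k * f).coeff e = f.coeff (e - k) := by
  rw [T, AddMonoidAlgebra.coeff_single_mul_apply, one_mul]
  congr 1
  ring

theorem T_mul (h : HasLead f d m) (k : ℤ) : HasLead (T k * f) (k + d) m := by
  refine ⟨?_, fun e he => ?_⟩
  · rw [coeff_T_mul, add_sub_cancel_left, h.1]
  · rw [coeff_T_mul, h.2 _ (by omega)]

/-- The summand `v` of `[2]` moves the leading term up by one, and the summand `v⁻¹` only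
contributes below it. -/
theorem quantumTwo_mul (h : HasLead f d m) : HasLead (quantumTwo * f) (d + 1) m := by
  have hc : ∀ e, (quantumTwo * f).coeff e = f.coeff (e - 1) + f.coeff (e - -1) := by
    intro e
    rw [quantumTwo, add_mul, AddMonoidAlgebra.coeff_add, Finsupp.add_apply, coeff_T_mul,
      coeff_T_mul]
  refine ⟨?_, fun e he => ?_⟩
  · rw [hc, add_sub_cancel_right, h.1, h.2 _ (by omega), add_zero]
  · rw [hc, h.2 _ (by omega), h.2 _ (by omega), add_zero]

theorem quantumTwo_pow_mul (h : HasLead f d m) (x : ℕ) :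
    HasLead (quantumTwo ^ x * f) (x + d) m := by
  induction x with
  | zero => simpa using h
  | succ x ih =>
    rw [pow_succ', _root_.mul_assoc]
    convert ih.quantumTwo_mul using 1
    push_cast
    ring

theorem C (m : ℤ) : HasLead (LaurentPolynomial.C m) 0 m := by
  refine ⟨by rw [LaurentPolynomial.C_apply, if_pos rfl], fun e he => ?_⟩
  rw [LaurentPolynomial.C_apply, if_neg he.ne']

theorem one : HasLead 1 0 1 := by
  rw [← map_one LaurentPolynomial.C]
  exact .C 1

theorem degree_le (h : HasLead f d m) : f.degree ≤ (d : WithBot ℤ) := by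
  refine Finset.max_le fun e he => ?_
  rw [Finsupp.mem_support_iff] at he
  by_contra hc
  exact he (h.2 e (by simpa using hc))

theorem degree_eq_iff (h : HasLead f d m) : f.degree = (d : WithBot ℤ) ↔ m ≠ 0 := by
  constructor
  · intro hd
    have := Finset.mem_of_max hd
    rwa [Finsupp.mem_support_iff, h.1] at this
  · intro hm
    refine le_antisymm h.degree_le (Finset.le_max ?_)
    rwa [Finsupp.mem_support_iff, h.1]

theorem degree_lt_of_eq_zero (h : HasLead f d 0) : f.degree < (d : WithBot ℤ) :=
  lt_of_le_of_ne h.degree_le fun hd => h.degree_eq_iff.1 hd rfl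

theorem sub_one (h : HasLead f 0 1) : HasLead (f - 1) 0 0 := by
  have h1 := one
  refine ⟨?_, fun e he => ?_⟩
  · rw [AddMonoidAlgebra.coeff_sub, Finsupp.sub_apply, h.1, h1.1, sub_self]
  · rw [AddMonoidAlgebra.coeff_sub, Finsupp.sub_apply, h.2 e he, h1.2 e he, sub_self]

end HasLead

end

/-! ### The tabular basis and its dual functionals. -/

section

open AffineDiagram

variable {n : ℕ}

/-! ### Monomials in the table algebras -/

/-- The basis of monomials of a table algebra. -/
def monoBasis : (l : ℕ) → Module.Basis (cellTable l).ι ℤ (cellTable l).Γ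
  | 0 => Polynomial.basisMonomials ℤ
  | _ + 1 => laurentBasis

theorem monoBasis_succ (t : ℕ) : monoBasis (t + 1) = (cellTable (t + 1)).basis := rfl

theorem monoBasis_mul (l : ℕ) (k k' : (cellTable l).ι) :
    monoBasis l k * monoBasis l k' = monoBasis l (indexAdd l k k') := by
  cases l with
  | zero =>
    have h (i j : ℕ) : Polynomial.basisMonomials ℤ i * Polynomial.basisMonomials ℤ j =
        Polynomial.basisMonomials ℤ (i + j) := by
      rw [Polynomial.coe_basisMonomials, Polynomial.monomial_mul_monomial, one_mul]
    exact h k k'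
  | succ t =>
    have h (i j : ℤ) : laurentBasis i * laurentBasis j = laurentBasis (i + j) := by
      rw [laurentBasis_apply, laurentBasis_apply, laurentBasis_apply, T_add]
    exact h k k'

theorem monoBasis_zero (l : ℕ) : monoBasis l (indexZero l) = 1 := by
  cases l with
  | zero =>
    have h : Polynomial.basisMonomials ℤ 0 = 1 := by
      rw [Polynomial.coe_basisMonomials]
      exact Polynomial.monomial_zero_one
    exact h
  | succ t =>
    have h : laurentBasis 0 = 1 := by rw [laurentBasis_apply, T_zero]
    exact h

namespace DiagramAlgebra

section

variable [NeZero n]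

/-- The linear map that sends a monomial of the table algebra to the corresponding diagram. -/
def cellHom (l : ℕ) (S U : cellTableaux n l) : (cellTable l).Γ →ₗ[ℤ] DiagramAlgebra n :=
  (monoBasis l).constr ℤ fun k => of (cellDiagram l S k U)

theorem cellHom_monoBasis (l : ℕ) (S U : cellTableaux n l) (k : (cellTable l).ι) :
    cellHom l S U (monoBasis l k) = of (cellDiagram l S k U) := Module.Basis.constr_basis ..

theorem cellHom_ext {N : Type} [AddCommGroup N] {l : ℕ} {f g : (cellTable l).Γ →ₗ[ℤ] N}
    (h : ∀ k, f (monoBasis l k) = g (monoBasis l k)) (x : (cellTable l).Γ) : f x = g x :=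
  LinearMap.congr_fun ((monoBasis l).ext h) x

theorem tripleZero_eq (S U : AffineInvolution n) (k : ℕ) :
    tripleZero S U k = of (cellDiagram 0 S k U) := by
  have h : ∃ D, IsTripleZero S U k D := (existsUnique_isTripleZero S U k).exists
  rw [tripleZero, dif_pos h, ((isTripleZero_iff ..).1 h.choose_spec).eq]

theorem triple_eq {t : ℕ} (S U : AnnularInvolution n (t + 1)) (k : ℤ) :
    triple S U k = of (cellDiagram (t + 1) S k U) := by
  have h : ∃ D, IsTriple S U k D := (existsUnique_isTriple (Nat.succ_pos t) S U k).exists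
  rw [triple, dif_pos h, ((isTriple_iff ..).1 h.choose_spec).eq]

theorem substPoly_eq (S U : AffineInvolution n) (f : ℤ[X]) :
    substPoly S U f = cellHom 0 S U f := by
  have h : substPoly S U f = (Polynomial.basisMonomials ℤ).constr ℤ
      (fun k => of (cellDiagram (n := n) 0 S k U)) f := by
    rw [Module.Basis.constr_apply, substPoly]
    simp only [tripleZero_eq]
    rfl
  exact h

theorem substLaurent_eq {t : ℕ} (S U : AnnularInvolution n (t + 1)) (f : ℤ[T;T⁻¹]) :
    substLaurent S U f = cellHom (t + 1) S U f := by
  have h : substLaurent S U f = laurentBasis.constr ℤ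
      (fun k => of (cellDiagram (n := n) (t + 1) S k U)) f := by
    rw [Module.Basis.constr_apply, substLaurent]
    simp only [triple_eq]
    rfl
  exact h

theorem cellMap_eq (l : ℕ) (S U : cellTableaux n l) (k : (cellTable l).ι) :
    cellMap n l S k U = cellHom l S U ((cellTable l).basis k) := by
  cases l with
  | zero => exact substPoly_eq S U _
  | succ t => exact substLaurent_eq S U _

theorem of_cell_mul_of_cell (l : ℕ) (S U V : cellTableaux n l) (k k' : (cellTable l).ι) :
    of (cellDiagram l S k U) * of (cellDiagram l U k' V) =
      quantumTwo ^ ((n - l) / 2) • of (cellDiagram l S (indexAdd l k k') V) := by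
  have hn := Nat.pos_of_neZero n
  have hA := isCell_cellDiagram l S k U
  have hB := isCell_cellDiagram l U k' V
  have hE := isComposite_comp hn (cellDiagram l S k U) (cellDiagram l U k' V)
  have h1 := two_mul_stackLoops_of_eq (hA.2.trans hB.1.symm)
  rw [hA.2, fixCount_tabMap] at h1
  rw [of_mul_of hn hE, (hA.mul hB hE).eq]
  congr 2
  omega

/-- Both sides are bilinear, so monomials suffice. The passage to arbitrary elements of `Γ` makes
the rule available for the Chebyshev basis. -/
theorem cellHom_mul (l : ℕ) (S U V : cellTableaux n l) (g g' : (cellTable l).Γ) :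
    cellHom l S U g * cellHom l U V g' =
      quantumTwo ^ ((n - l) / 2) • cellHom l S V (g * g') := by
  have hsm (c : ℤ) (x : DiagramAlgebra n) : quantumTwo ^ ((n - l) / 2) • (c • x) =
      c • (quantumTwo ^ ((n - l) / 2) • x) := smul_comm _ _ _
  let L : (cellTable l).Γ →ₗ[ℤ] (cellTable l).Γ →ₗ[ℤ] DiagramAlgebra n :=
    LinearMap.mk₂ ℤ (fun g g' => cellHom l S U g * cellHom l U V g')
      (fun g h g' => by rw [map_add, add_mul]) (fun c g g' => by rw [map_smul, smul_mul_assoc])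
      (fun g g' h => by rw [map_add, mul_add]) (fun c g g' => by rw [map_smul, mul_smul_comm])
  let R : (cellTable l).Γ →ₗ[ℤ] (cellTable l).Γ →ₗ[ℤ] DiagramAlgebra n :=
    LinearMap.mk₂ ℤ (fun g g' => quantumTwo ^ ((n - l) / 2) • cellHom l S V (g * g'))
      (fun g h g' => by rw [add_mul, map_add, smul_add])
      (fun c g g' => by rw [smul_mul_assoc, map_smul, hsm])
      (fun g g' h => by rw [mul_add, map_add, smul_add])
      (fun c g g' => by rw [mul_smul_comm, map_smul, hsm])
  have h : L = R := by
    refine (monoBasis l).ext fun k => (monoBasis l).ext fun k' => ?_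
    change cellHom l S U _ * cellHom l U V _ = quantumTwo ^ _ • cellHom l S V (_ * _)
    rw [monoBasis_mul, cellHom_monoBasis, cellHom_monoBasis, cellHom_monoBasis,
      of_cell_mul_of_cell]
  exact congrFun (congrArg DFunLike.coe (LinearMap.congr_fun h g)) g'

/-! ### The coefficients with respect to the tabular basis -/

open Classical in
/-- The coefficient of a diagram at the basis element with the given coordinates. -/
def cellCoeffOf (l : ℕ) (S : cellTableaux n l) (k : (cellTable l).ι) (U : cellTableaux n l)
    (D : AffineDiagram n) : ℤ :=
  if h : topMap D = tabMap l S ∧ botMap D = tabMap l U then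
    (cellTable l).basis.repr (monoBasis l (exists_isCell_of_maps D h.1 h.2).choose) k else 0

theorem cellCoeffOf_cellDiagram (l : ℕ) (S U : cellTableaux n l) (k k' : (cellTable l).ι) :
    cellCoeffOf l S k U (cellDiagram l S k' U) = (cellTable l).basis.repr (monoBasis l k') k := by
  have h := isCell_cellDiagram l S k' U
  rw [cellCoeffOf, dif_pos ⟨h.1, h.2⟩]
  rw [((exists_isCell_of_maps _ h.1 h.2).choose_spec.unique h).2.1]

theorem cellCoeffOf_eq_zero {l : ℕ} {S U : cellTableaux n l} {D : AffineDiagram n}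
    (h : ¬ (topMap D = tabMap l S ∧ botMap D = tabMap l U)) (k : (cellTable l).ι) :
    cellCoeffOf l S k U D = 0 := dif_neg h

/-- The coefficient functionals of the tabular basis. -/
def cellCoeff (l : ℕ) (S : cellTableaux n l) (k : (cellTable l).ι) (U : cellTableaux n l) :
    DiagramAlgebra n →ₗ[ℤ[T;T⁻¹]] ℤ[T;T⁻¹] :=
  lift fun D => LaurentPolynomial.C (cellCoeffOf l S k U D)

theorem cellCoeff_of (l : ℕ) (S U : cellTableaux n l) (k : (cellTable l).ι)
    (D : AffineDiagram n) :
    cellCoeff l S k U (of D) = LaurentPolynomial.C (cellCoeffOf l S k U D) := lift_of _ _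

theorem cellCoeff_cellHom (l : ℕ) (S U : cellTableaux n l) (k : (cellTable l).ι)
    (g : (cellTable l).Γ) :
    cellCoeff l S k U (cellHom l S U g) =
      LaurentPolynomial.C ((cellTable l).basis.repr g k) := by
  refine cellHom_ext (f := ((cellCoeff l S k U).restrictScalars ℤ) ∘ₗ cellHom l S U)
    (g := (LaurentPolynomial.C (R := ℤ)).toAddMonoidHom.toIntLinearMap ∘ₗ
      (cellTable l).basis.coord k) (fun k' => ?_) g
  change cellCoeff l S k U (cellHom l S U _) =
    LaurentPolynomial.C ((cellTable l).basis.repr (monoBasis l k') k)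
  rw [cellHom_monoBasis, cellCoeff_of, cellCoeffOf_cellDiagram]

theorem cellCoeff_cellHom_eq_zero {l l' : ℕ} {S U : cellTableaux n l} {S' U' : cellTableaux n l'}
    (h : ¬ (tabMap l' S' = tabMap l S ∧ tabMap l' U' = tabMap l U)) (k : (cellTable l).ι)
    (g : (cellTable l').Γ) : cellCoeff l S k U (cellHom l' S' U' g) = 0 := by
  refine cellHom_ext (f := ((cellCoeff l S k U).restrictScalars ℤ) ∘ₗ cellHom l' S' U')
    (g := 0) (fun k' => ?_) g
  change cellCoeff l S k U (cellHom l' S' U' _) = 0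
  have hc := isCell_cellDiagram l' S' k' U'
  rw [cellHom_monoBasis, cellCoeff_of, cellCoeffOf_eq_zero, map_zero]
  rwa [hc.1, hc.2]

theorem tabMap_eq_iff {l l' : ℕ} {S U : cellTableaux n l} {S' U' : cellTableaux n l'}
    (h : tabMap l' S' = tabMap l S ∧ tabMap l' U' = tabMap l U) :
    ∃ e : l = l', e ▸ S = S' ∧ e ▸ U = U' := by
  have hl : l = l' := by
    rw [← fixCount_tabMap l S, ← h.1, fixCount_tabMap]
  subst hl
  exact ⟨rfl, (tabMap_injective l h.1).symm, (tabMap_injective l h.2).symm⟩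

end

end DiagramAlgebra

/-! ### The table datum -/

section

open DiagramAlgebra TableDatum

variable [NeZero n]

theorem diagramTableDatum_elt (l : (diagramTableDatum n).Λ) (S : (diagramTableDatum n).M l)
    (b : ((diagramTableDatum n).table l).ι) (U : (diagramTableDatum n).M l) :
    (diagramTableDatum n).elt ⟨l, S, b, U⟩ = cellHom l.1 S U ((cellTable l.1).basis b) :=
  cellMap_eq l.1 S U b

omit [NeZero n] in
theorem basis_repr_self (l : ℕ) (b : (cellTable l).ι) :
    (cellTable l).basis.repr ((cellTable l).basis b) b = 1 := by
  rw [Module.Basis.repr_self, Finsupp.single_eq_same]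

omit [NeZero n] in
theorem basis_repr_of_ne (l : ℕ) {b b' : (cellTable l).ι} (h : b' ≠ b) :
    (cellTable l).basis.repr ((cellTable l).basis b') b = 0 := by
  rw [Module.Basis.repr_self, Finsupp.single_eq_of_ne (Ne.symm h)]

/-- The functionals are dual to the tabular basis. This gives linear independence and identifies
them with the coordinates that define the structure constants. -/
theorem cellCoeff_elt (X Y : (diagramTableDatum n).Index) [Decidable (X = Y)] :
    cellCoeff X.1.1 X.2.1 X.2.2.1 X.2.2.2 ((diagramTableDatum n).elt Y) =
      if X = Y then 1 else 0 := by
  obtain ⟨⟨l, hl⟩, S, b, U⟩ := X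
  obtain ⟨⟨l', hl'⟩, S', b', U'⟩ := Y
  refine (congrArg (cellCoeff l S b U) (diagramTableDatum_elt (n := n) ⟨l', hl'⟩ S' b' U')).trans ?_
  by_cases h : tabMap l' S' = tabMap l S ∧ tabMap l' U' = tabMap l U
  · obtain ⟨rfl, rfl, rfl⟩ := tabMap_eq_iff h
    refine (cellCoeff_cellHom l S U b ((cellTable l).basis b')).trans ?_
    by_cases hb : b' = b
    · subst hb
      refine (congrArg LaurentPolynomial.C (basis_repr_self l b')).trans ?_
      exact (map_one LaurentPolynomial.C).trans (if_pos rfl).symm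
    · refine (congrArg LaurentPolynomial.C (basis_repr_of_ne l hb)).trans ?_
      rw [if_neg, map_zero]
      intro h
      apply hb
      cases h
      rfl
  · refine (cellCoeff_cellHom_eq_zero h b ((cellTable l').basis b')).trans ?_
    rw [if_neg]
    intro h'
    apply h
    cases h'
    exact ⟨rfl, rfl⟩

theorem elt_linearIndependent :
    LinearIndependent ℤ[T;T⁻¹] (diagramTableDatum n).elt := by
  classical
  rw [linearIndependent_iff]
  intro c hc
  ext1 X
  have h := congrArg (cellCoeff X.1.1 X.2.1 X.2.2.1 X.2.2.2) hc
  rw [Finsupp.linearCombination_apply, Finsupp.sum, map_sum, map_zero] at h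
  simp only [map_smul, cellCoeff_elt, smul_eq_mul, mul_ite, mul_one, mul_zero,
    Finset.sum_ite_eq, Finsupp.mem_support_iff, ne_eq, ite_not] at h
  rw [Finsupp.zero_apply]
  by_contra hX
  rw [if_neg hX] at h
  exact hX h

theorem cellHom_mem_span {l : (diagramTableDatum n).Λ} (S U : cellTableaux n l.1)
    (g : (cellTable l.1).Γ) {s : Set (diagramTableDatum n).Index}
    (hs : ∀ b, (⟨l, S, b, U⟩ : (diagramTableDatum n).Index) ∈ s) :
    cellHom l.1 S U g ∈ Submodule.span ℤ[T;T⁻¹] ((diagramTableDatum n).elt '' s) := by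
  have h := (cellTable l.1).basis.linearCombination_repr g
  rw [← h, Finsupp.linearCombination_apply, Finsupp.sum, map_sum]
  refine Submodule.sum_mem _ fun b _ => ?_
  rw [map_smul]
  have hb : cellHom l.1 S U ((cellTable l.1).basis b) ∈ (diagramTableDatum n).elt '' s :=
    ⟨_, hs b, diagramTableDatum_elt l S b U⟩
  exact zsmul_mem (Submodule.subset_span hb) _

/-- The cell of a diagram. -/
def cellOf (D : AffineDiagram n) : (diagramTableDatum n).Λ :=
  ⟨fixCount n (topMap D), exists_add_two_mul (isLine_topMap D)⟩

theorem of_mem_span (D : AffineDiagram n) {s : Set (diagramTableDatum n).Index}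
    (hs : ∀ X : (diagramTableDatum n).Index, X.1 = cellOf D → X ∈ s) :
    of D ∈ Submodule.span ℤ[T;T⁻¹] ((diagramTableDatum n).elt '' s) := by
  obtain ⟨S, k, U, h⟩ := exists_isCell D
  rw [h.eq, ← cellHom_monoBasis]
  exact cellHom_mem_span (l := cellOf D) S U _ fun b => hs _ rfl

theorem elt_span : ⊤ ≤ Submodule.span ℤ[T;T⁻¹] (Set.range (diagramTableDatum n).elt) := by
  rw [← span_of, Submodule.span_le]
  rintro _ ⟨D, rfl⟩
  rw [← Set.image_univ]
  exact of_mem_span D fun _ _ => trivial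

theorem of_mem_lower {D : AffineDiagram n} {l : (diagramTableDatum n).Λ}
    (h : fixCount n (topMap D) < l.1) : of D ∈ (diagramTableDatum n).lower l := by
  have h1 := of_mem_span D (s := {X | X.1 < l}) fun X hX => by
    change X.1 < l
    rw [hX]
    exact h
  refine Submodule.span_mono ?_ h1
  rintro _ ⟨X, hX, rfl⟩
  exact ⟨X, hX, rfl⟩

theorem CExt_one_tmul (l : (diagramTableDatum n).Λ) (S U : (diagramTableDatum n).M l)
    (g : ((diagramTableDatum n).table l).Γ) :
    (diagramTableDatum n).CExt l S U (1 ⊗ₜ g) = cellHom l.1 S U g := by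
  have h : ((diagramTableDatum n).CExt l S U).restrictScalars ℤ ∘ₗ
      TensorProduct.mk ℤ ℤ[T;T⁻¹] ((diagramTableDatum n).table l).Γ 1 = cellHom l.1 S U := by
    refine ((diagramTableDatum n).table l).basis.ext fun b => ?_
    change (diagramTableDatum n).CExt l S U (1 ⊗ₜ ((diagramTableDatum n).table l).basis b) = _
    rw [CExt, ← Algebra.TensorProduct.basis_apply, Module.Basis.constr_basis]
    exact cellMap_eq l.1 S U b
  exact LinearMap.congr_fun h g

theorem CExt_tmul (l : (diagramTableDatum n).Λ) (S U : (diagramTableDatum n).M l)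
    (c : ℤ[T;T⁻¹]) (g : ((diagramTableDatum n).table l).Γ) :
    (diagramTableDatum n).CExt l S U (c ⊗ₜ g) = c • cellHom l.1 S U g := by
  rw [← CExt_one_tmul, ← map_smul, TensorProduct.smul_tmul', smul_eq_mul, mul_one]

end

end

/-! ### The axioms (A1) to (A3). -/

section

open AffineDiagram DiagramAlgebra TableDatum

variable {n : ℕ} [NeZero n]

/-! ### The action of a diagram on a cell -/

theorem isComposite_unit_cell (l : ℕ) (S U : cellTableaux n l) (k : (cellTable l).ι) :
    IsComposite (cellDiagram l S (indexZero l) S) (cellDiagram l S k U)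
      (cellDiagram l S k U) := by
  have hE := isComposite_comp (Nat.pos_of_neZero n) (cellDiagram l S (indexZero l) S)
    (cellDiagram l S k U)
  have h := (isCell_cellDiagram l S _ S).mul (isCell_cellDiagram l S k U) hE
  rw [indexZero_add] at h
  rwa [h.eq] at hE

/-- The diagram `X₀ = [S, S, 0]` acts from the left as a unit, up to loops, on all diagrams of the
cell with top tableau `S`, so the action of `D` on them can be read off from `E = D X₀`. Either `E`
has lost through edges, and all products lie in lower cells, or `E` still has bottom tableau `S` and
is some `[S', S, k₀]`, which does not depend on `U`. -/
theorem exists_act (D : AffineDiagram n) (l : (diagramTableDatum n).Λ) (S : cellTableaux n l.1) :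
    (∃ (c : ℕ) (S' : cellTableaux n l.1) (k₀ : (cellTable l.1).ι), ∀ U g,
      of D * cellHom l.1 S U g =
        quantumTwo ^ c • cellHom l.1 S' U (monoBasis l.1 k₀ * g)) ∨
    ∀ U g, of D * cellHom l.1 S U g ∈ (diagramTableDatum n).lower l := by
  have hn := Nat.pos_of_neZero n
  have h0 := isCell_cellDiagram l.1 S (indexZero l.1) S
  have hE := isComposite_comp hn D (cellDiagram l.1 S (indexZero l.1) S)
  set X₀ := cellDiagram l.1 S (indexZero l.1) S
  set E := comp hn D X₀
  have hX : ∀ U k, IsComposite X₀ (cellDiagram l.1 S k U) (cellDiagram l.1 S k U) :=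
    fun U k => isComposite_unit_cell l.1 S U k
  have hG : ∀ U k, IsComposite D (cellDiagram l.1 S k U) (comp hn E (cellDiagram l.1 S k U)) :=
    fun U k => hE.assoc hn (hX U k) (isComposite_comp hn _ _)
  have hle := hE.fixCount_botMap_le hn
  rw [h0.2, fixCount_tabMap] at hle
  rcases hle.lt_or_eq with hlt | heq
  · right
    intro U g
    have hg := (monoBasis l.1).linearCombination_repr g
    rw [← hg, Finsupp.linearCombination_apply, Finsupp.sum, map_sum, Finset.mul_sum]
    refine Submodule.sum_mem _ fun k _ => ?_
    rw [map_smul, mul_smul_comm, cellHom_monoBasis, of_mul_of hn (hG U k)]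
    refine zsmul_mem (Submodule.smul_mem _ _ (of_mem_lower ?_)) _
    refine ((isComposite_comp hn E _).fixCount_topMap_le hn).trans_lt ?_
    rwa [← fixCount_botMap hn]
  · left
    have hEb : botMap E = tabMap l.1 S :=
      (hE.botMap_eq hn (by rw [h0.2, fixCount_tabMap, heq])).trans h0.2
    obtain ⟨S', hS'⟩ : ∃ S' : cellTableaux n l.1, topMap E = tabMap l.1 S' := by
      rw [fixCount_botMap hn] at heq
      rw [← heq]
      obtain ⟨S', hS'⟩ := exists_tabMap (isLine_topMap E)
      exact ⟨S', hS'.symm⟩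
    obtain ⟨k₀, hk₀⟩ := exists_isCell_of_maps E hS' hEb
    refine ⟨stackLoops D X₀, S', k₀, fun U g => ?_⟩
    refine cellHom_ext (f := (LinearMap.mulLeft ℤ (of D)) ∘ₗ cellHom l.1 S U)
      (g := (DistribSMul.toLinearMap ℤ (DiagramAlgebra n)
        (quantumTwo ^ stackLoops D X₀)) ∘ₗ cellHom l.1 S' U ∘ₗ
        LinearMap.mulLeft ℤ (monoBasis l.1 k₀)) (fun k => ?_) g
    change of D * cellHom l.1 S U _ = quantumTwo ^ _ • cellHom l.1 S' U (_ * _)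
    have hk := isCell_cellDiagram l.1 S k U
    rw [monoBasis_mul, cellHom_monoBasis, cellHom_monoBasis, of_mul_of hn (hG U k),
      (hk₀.mul hk (isComposite_comp hn E _)).eq]
    have h1 := two_mul_stackLoops_of_eq (hk₀.2.trans hk.1.symm)
    have h2 := two_mul_stackLoops_of_eq (h0.2.trans hk.1.symm)
    -- The loop numbers of `E` and of `X₀` with the basis diagram are both `(n - l) / 2`. They
    -- cancel here, so `D` forms the same number of loops with every basis diagram with top tableau
    -- `S` as with `X₀`.
    have h3 := stackLoops_assoc hn hE (hX U k)
    rw [hk₀.2] at h1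
    rw [h0.2] at h2
    congr 2
    omega

theorem exists_act' (D : AffineDiagram n) (l : (diagramTableDatum n).Λ)
    (S : (diagramTableDatum n).M l) :
    (∃ (S' : (diagramTableDatum n).M l) (r : ℤ[T;T⁻¹] ⊗[ℤ] ((diagramTableDatum n).table l).Γ),
      ∀ U g, of D * (diagramTableDatum n).CExt l S U (1 ⊗ₜ g) =
        (diagramTableDatum n).CExt l S' U (r * (1 ⊗ₜ g))) ∨
    ∀ U g, of D * (diagramTableDatum n).CExt l S U (1 ⊗ₜ g) ∈ (diagramTableDatum n).lower l := by
  rcases exists_act D l S with ⟨c, S', k₀, h⟩ | h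
  · have key : ∀ (S' : (diagramTableDatum n).M l) (g₀ : ((diagramTableDatum n).table l).Γ) U
        (g : ((diagramTableDatum n).table l).Γ), (diagramTableDatum n).CExt l S' U
          (((quantumTwo ^ c) ⊗ₜ g₀) * (1 ⊗ₜ g)) = quantumTwo ^ c • cellHom l.1 S' U (g₀ * g) := by
      intro S' g₀ U g
      rw [Algebra.TensorProduct.tmul_mul_tmul, mul_one, CExt_tmul]
    refine Or.inl ⟨S', (quantumTwo ^ c) ⊗ₜ monoBasis l.1 k₀, fun U g => ?_⟩
    rw [CExt_one_tmul]
    exact (h U g).trans (key S' _ U g).symm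
  · refine Or.inr fun U g => ?_
    rw [CExt_one_tmul]
    exact h U g

theorem exists_mul_elt (l : (diagramTableDatum n).Λ) (a : DiagramAlgebra n) :
    ∃ r : (diagramTableDatum n).M l → (diagramTableDatum n).M l →
        ℤ[T;T⁻¹] ⊗[ℤ] ((diagramTableDatum n).table l).Γ,
      ∀ (g : ((diagramTableDatum n).table l).Γ) (S U : (diagramTableDatum n).M l),
        a * (diagramTableDatum n).CExt l S U (1 ⊗ₜ g) -
          ∑ᶠ S', (diagramTableDatum n).CExt l S' U (r S' S * (1 ⊗ₜ g)) ∈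
            (diagramTableDatum n).lower l := by
  classical
  have : Finite ((diagramTableDatum n).M l) := finite_cellTableaux l.1
  induction a using DiagramAlgebra.induction with
  | hof D =>
    have h : ∀ S : (diagramTableDatum n).M l, ∃ r : (diagramTableDatum n).M l →
        ℤ[T;T⁻¹] ⊗[ℤ] ((diagramTableDatum n).table l).Γ,
        ∀ (g : ((diagramTableDatum n).table l).Γ) (U : (diagramTableDatum n).M l),
        of D * (diagramTableDatum n).CExt l S U (1 ⊗ₜ g) -
          ∑ᶠ S', (diagramTableDatum n).CExt l S' U (r S' * (1 ⊗ₜ g)) ∈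
            (diagramTableDatum n).lower l := by
      intro S
      rcases exists_act' D l S with ⟨S₁, r, h⟩ | h
      · refine ⟨Pi.single S₁ r, fun g U => ?_⟩
        rw [finsum_eq_single _ S₁ fun S' hS' => by
          rw [Pi.single_eq_of_ne hS', zero_mul, map_zero], Pi.single_eq_same, h U g, sub_self]
        exact Submodule.zero_mem _
      · refine ⟨0, fun g U => ?_⟩
        have h0 : ∑ᶠ S', (diagramTableDatum n).CExt l S' U
            ((0 : (diagramTableDatum n).M l → _) S' * (1 ⊗ₜ g)) = 0 := by
          refine finsum_eq_zero_of_forall_eq_zero fun S' => ?_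
          rw [Pi.zero_apply, zero_mul, map_zero]
        rw [h0, sub_zero]
        exact h U g
    choose r hr using h
    exact ⟨fun S' S => r S S', fun g S U => hr S g U⟩
  | hadd a b ha hb =>
    obtain ⟨r, hr⟩ := ha
    obtain ⟨r', hr'⟩ := hb
    refine ⟨fun S' S => r S' S + r' S' S, fun g S U => ?_⟩
    have h := Submodule.add_mem _ (hr g S U) (hr' g S U)
    simp only [add_mul, map_add]
    rw [finsum_add_distrib (Set.toFinite _) (Set.toFinite _)]
    convert h using 1
    abel
  | hsmul c a ha =>
    obtain ⟨r, hr⟩ := ha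
    refine ⟨fun S' S => c • r S' S, fun g S U => ?_⟩
    have h := Submodule.smul_mem _ c (hr g S U)
    simp only [smul_mul_assoc, map_smul]
    rw [← smul_finsum' c (Set.toFinite _), DiagramAlgebra.smul_mul, ← smul_sub]
    exact h
  | hzero =>
    refine ⟨0, fun g S U => ?_⟩
    simp only [zero_mul, Pi.zero_apply, map_zero, finsum_zero, sub_zero]
    exact Submodule.zero_mem _

/-! ### The diagram algebra is tabular -/

theorem bar_monoBasis (l : ℕ) (k : (cellTable l).ι) :
    (cellTable l).bar (monoBasis l k) = monoBasis l (indexFlip l k) := by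
  cases l with
  | zero => rfl
  | succ t => exact invert_laurentBasis k

theorem reflect_cellHom (l : ℕ) (S U : cellTableaux n l) (g : (cellTable l).Γ) :
    reflect (cellHom l S U g) = cellHom l U S ((cellTable l).bar g) := by
  refine cellHom_ext (f := (reflect.restrictScalars ℤ) ∘ₗ cellHom l S U)
    (g := cellHom l U S ∘ₗ (cellTable l).bar) (fun k => ?_) g
  change reflect (cellHom l S U _) = cellHom l U S ((cellTable l).bar _)
  rw [bar_monoBasis, cellHom_monoBasis, cellHom_monoBasis, reflect_of,
    (isCell_cellDiagram l S k U).flip.eq]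

/-- The identity has `n > 0` through edges, and in such cells the tabular basis elements are single
diagrams. The unit itself can therefore serve as the only idempotent in (A1). -/
theorem of_identity_mem : of (identity n) ∈ Set.range (diagramTableDatum n).elt := by
  obtain ⟨S, k, U, h⟩ := exists_isCell (identity n)
  have hl : ∃ r, fixCount n (topMap (identity n)) + 2 * r = n :=
    exists_add_two_mul (isLine_topMap _)
  have hpos : 0 < fixCount n (topMap (identity n)) := by
    rw [fixCount_identity]
    exact Nat.pos_of_neZero n
  generalize fixCount n (topMap (identity n)) = l at S k U h hl hpos
  obtain ⟨t, rfl⟩ := Nat.exists_eq_succ_of_ne_zero hpos.ne'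
  refine ⟨⟨⟨t + 1, hl⟩, S, k, U⟩, ?_⟩
  refine (diagramTableDatum_elt (n := n) ⟨t + 1, hl⟩ S k U).trans ?_
  rw [h.eq]
  exact cellHom_monoBasis (t + 1) S U k

theorem diagramTableDatum_isTabular : (diagramTableDatum n).IsTabular where
  mul_assoc := DiagramAlgebra.mul_assoc (Nat.pos_of_neZero n)
  smul_mul := DiagramAlgebra.smul_mul
  mul_smul := DiagramAlgebra.mul_smul
  finite_poset := by
    refine Finite.of_injective
      (fun l : {i : ℕ // ∃ r : ℕ, i + 2 * r = n} => (⟨l.1, ?_⟩ : Fin (n + 1))) ?_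
    · obtain ⟨r, hr⟩ := l.2
      omega
    · intro l l' h
      exact Subtype.ext (Fin.mk.inj_iff.1 h)
  table_normalized l := cellTable_isNormalized l.1
  finite_tableaux l := finite_cellTableaux l.1
  elt_injective := elt_linearIndependent.injective
  elt_linearIndependent := elt_linearIndependent
  elt_span := elt_span
  idempotents := by
    have hn := Nat.pos_of_neZero n
    refine ⟨{of (identity n)}, Set.singleton_subset_iff.2 of_identity_mem, ?_, ?_, ?_, ?_⟩
    · rintro _ rfl
      exact identity_mul hn _
    · rintro _ rfl _ rfl h
      exact (h rfl).elim
    · rw [eq_top_iff]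
      intro x _
      refine Submodule.subset_span ⟨_, rfl, _, rfl, x, ?_⟩
      rw [identity_mul hn, mul_identity hn]
    · intro X
      refine ⟨_, rfl, _, rfl, ?_⟩
      rw [identity_mul hn, mul_identity hn]
  star_mul := reflect_mul (Nat.pos_of_neZero n)
  star_star := reflect_reflect
  star_elt l S U b := by
    rw [CExt_one_tmul]
    refine (congrArg reflect (cellMap_eq l.1 S U b)).trans ?_
    exact reflect_cellHom l.1 S U _
  mul_elt := exists_mul_elt

end

/-! ### Structure constants, the a-function and (A4). -/

section

open AffineDiagram DiagramAlgebra TableDatum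

variable {n : ℕ}

/-! ### Integral spans of diagrams -/

namespace AffineDiagram

theorem topMap_congr {D D' : AffineDiagram n} (h : D.pair = D'.pair) : topMap D = topMap D' := by
  funext i
  rw [topMap, topMap, h]

theorem botMap_congr {D D' : AffineDiagram n} (h : D.pair = D'.pair) : botMap D = botMap D' := by
  refine topMap_congr (funext fun x => ?_)
  rw [flip_pair, flip_pair, h]

theorem pair_eq_of_fixCount_eq_zero (hn : 0 < n) {D D' : AffineDiagram n}
    (h0 : fixCount n (topMap D) = 0) (ht : topMap D = topMap D') (hb : botMap D = botMap D') :
    D.pair = D'.pair := by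
  have h0' : fixCount n (botMap D) = 0 := by rw [fixCount_botMap hn, h0]
  have h1 : ∀ i, topMap D i ≠ i := fun i hi =>
    absurd (((isLine_topMap D).fixCount_pos_iff hn).2 ⟨i, hi⟩) (by omega)
  have h2 : ∀ i, botMap D i ≠ i := fun i hi =>
    absurd (((isLine_botMap D).fixCount_pos_iff hn).2 ⟨i, hi⟩) (by omega)
  funext x
  rcases x with i | i
  · rw [pair_top_of_ne (h1 i), pair_top_of_ne (ht ▸ h1 i), ht]
  · rw [pair_bot_of_ne (h2 i), pair_bot_of_ne (hb ▸ h2 i), hb]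

end AffineDiagram

namespace DiagramAlgebra

section

variable [NeZero n]

/-- In a cell with through edges this is one diagram. In the cell 0 it is an integral combination of
diagrams with different numbers of bands, and `cellDiagram` only serves to name their common
matching. -/
theorem cellHom_basis_mem (l : ℕ) (S U : cellTableaux n l) (b : (cellTable l).ι) :
    cellHom l S U ((cellTable l).basis b) ∈
      AddSubgroup.closure {x | ∃ D : AffineDiagram n,
        D.pair = (cellDiagram l S b U).pair ∧ x = of D} := by
  have hn := Nat.pos_of_neZero n
  cases l with
  | zero =>
    have h := (monoBasis 0).linearCombination_repr ((cellTable 0).basis b)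
    rw [← h, Finsupp.linearCombination_apply, Finsupp.sum, map_sum]
    refine sum_mem fun k _ => ?_
    rw [map_smul, cellHom_monoBasis]
    refine zsmul_mem (AddSubgroup.subset_closure ?_) _
    have h1 := isCell_cellDiagram 0 S k U
    have h2 := isCell_cellDiagram 0 S b U
    exact ⟨_, pair_eq_of_fixCount_eq_zero hn h1.fixCount_eq (h1.1.trans h2.1.symm)
      (h1.2.trans h2.2.symm), rfl⟩
  | succ t =>
    rw [← monoBasis_succ, cellHom_monoBasis]
    exact AddSubgroup.subset_closure ⟨_, rfl, rfl⟩

end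

/-- Diagrams with the same matchings form the same number of loops, so a single power of `[2]` can
be taken out of the whole product. -/
theorem exists_smul_of_mul (hn : 0 < n) {A B E : AffineDiagram n} (hE : IsComposite A B E)
    {x y : DiagramAlgebra n}
    (hx : x ∈ AddSubgroup.closure {x | ∃ D : AffineDiagram n, D.pair = A.pair ∧ x = of D})
    (hy : y ∈ AddSubgroup.closure {x | ∃ D : AffineDiagram n, D.pair = B.pair ∧ x = of D}) :
    ∃ z ∈ AddSubgroup.closure {x | ∃ D : AffineDiagram n, D.pair = E.pair ∧ x = of D},
      x * y = quantumTwo ^ stackLoops A B • z := by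
  induction hx using AddSubgroup.closure_induction with
  | zero => exact ⟨0, zero_mem _, by rw [zero_mul, smul_zero]⟩
  | add x x' _ _ h h' =>
    obtain ⟨z, hz, h⟩ := h
    obtain ⟨z', hz', h'⟩ := h'
    exact ⟨z + z', add_mem hz hz', by rw [add_mul, h, h', smul_add]⟩
  | neg x _ h =>
    obtain ⟨z, hz, h⟩ := h
    exact ⟨-z, neg_mem hz, by rw [neg_mul, h, smul_neg]⟩
  | mem x hx =>
    obtain ⟨D, hD, rfl⟩ := hx
    induction hy using AddSubgroup.closure_induction with
    | zero => exact ⟨0, zero_mem _, by rw [mul_zero, smul_zero]⟩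
    | add x x' _ _ h h' =>
      obtain ⟨z, hz, h⟩ := h
      obtain ⟨z', hz', h'⟩ := h'
      exact ⟨z + z', add_mem hz hz', by rw [mul_add, h, h', smul_add]⟩
    | neg x _ h =>
      obtain ⟨z, hz, h⟩ := h
      exact ⟨-z, neg_mem hz, by rw [mul_neg, h, smul_neg]⟩
    | mem y hy =>
      obtain ⟨D', hD', rfl⟩ := hy
      have hE' := isComposite_comp hn D D'
      refine ⟨of (comp hn D D'), AddSubgroup.subset_closure
        ⟨_, hE'.pair_congr hn hD hD' hE, rfl⟩, ?_⟩
      rw [of_mul_of hn hE', stackLoops_congr hD hD']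

/-- Once the power of `[2]` is removed, only integers remain. A structure constant is thus an
integer times a power of `[2]`, and its degree, if it is nonzero, is a number of loops. -/
theorem cellCoeff_eq_C [NeZero n] (l : ℕ) (S U : cellTableaux n l) (k : (cellTable l).ι)
    {E : AffineDiagram n} {z : DiagramAlgebra n}
    (hz : z ∈ AddSubgroup.closure {x | ∃ D : AffineDiagram n, D.pair = E.pair ∧ x = of D}) :
    ∃ m : ℤ, cellCoeff l S k U z = LaurentPolynomial.C m ∧
      (m ≠ 0 → topMap E = tabMap l S ∧ botMap E = tabMap l U) := by
  by_cases h : topMap E = tabMap l S ∧ botMap E = tabMap l U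
  · induction hz using AddSubgroup.closure_induction with
    | zero => exact ⟨0, by rw [map_zero, map_zero], fun _ => h⟩
    | add x y _ _ hx hy =>
      obtain ⟨m, hm, -⟩ := hx
      obtain ⟨m', hm', -⟩ := hy
      exact ⟨m + m', by rw [map_add, map_add, hm, hm'], fun _ => h⟩
    | neg x _ hx =>
      obtain ⟨m, hm, -⟩ := hx
      exact ⟨-m, by rw [map_neg, map_neg, hm], fun _ => h⟩
    | mem x hx =>
      obtain ⟨D, hD, rfl⟩ := hx
      exact ⟨_, cellCoeff_of l S U k D, fun _ => h⟩
  · refine ⟨0, ?_, fun h0 => (h0 rfl).elim⟩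
    rw [map_zero]
    induction hz using AddSubgroup.closure_induction with
    | zero => rw [map_zero]
    | add x y _ _ hx hy => rw [map_add, hx, hy, add_zero]
    | neg x _ hx => rw [map_neg, hx, neg_zero]
    | mem x hx =>
      obtain ⟨D, hD, rfl⟩ := hx
      rw [cellCoeff_of, cellCoeffOf_eq_zero, map_zero]
      rwa [topMap_congr hD, botMap_congr hD]

end DiagramAlgebra

/-! ### Structure constants -/

section

variable [NeZero n]

theorem structureConst_eq (h : (diagramTableDatum n).IsTabular)
    (X Y Z : (diagramTableDatum n).Index) :
    h.structureConst X Y Z = cellCoeff Z.1.1 Z.2.1 Z.2.2.1 Z.2.2.2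
      ((diagramTableDatum n).elt X * (diagramTableDatum n).elt Y) := by
  classical
  have key : h.basis.coord Z = cellCoeff Z.1.1 Z.2.1 Z.2.2.1 Z.2.2.2 := by
    refine h.basis.ext fun W => ?_
    rw [Module.Basis.coord_apply, Module.Basis.repr_self, Finsupp.single_apply,
      IsTabular.basis, Module.Basis.mk_apply, cellCoeff_elt]
    simp only [eq_comm]
  rw [← key]
  rfl

/-- The exponent of the leading term of the largest structure constants of a cell. -/
def cellExponent (n l : ℕ) : ℤ := ((n - l) / 2 : ℕ)

theorem structureConst_of_eq (h : (diagramTableDatum n).IsTabular)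
    (l : (diagramTableDatum n).Λ) (S U V : (diagramTableDatum n).M l)
    (b b' b'' : ((diagramTableDatum n).table l).ι) :
    HasLead (h.structureConst ⟨l, S, b, U⟩ ⟨l, U, b', V⟩ ⟨l, S, b'', V⟩) (cellExponent n l.1)
      (((diagramTableDatum n).table l).basis.repr
        (((diagramTableDatum n).table l).basis b * ((diagramTableDatum n).table l).basis b')
        b'') := by
  have h1 : h.structureConst ⟨l, S, b, U⟩ ⟨l, U, b', V⟩ ⟨l, S, b'', V⟩ =
      quantumTwo ^ ((n - l.1) / 2) * LaurentPolynomial.C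
        ((cellTable l.1).basis.repr ((cellTable l.1).basis b * (cellTable l.1).basis b') b'') := by
    have h2 := cellHom_mul l.1 S U V ((cellTable l.1).basis b) ((cellTable l.1).basis b')
    have h3 := (congrArg₂ (· * ·) (diagramTableDatum_elt l S b U)
      (diagramTableDatum_elt l U b' V)).trans h2
    refine (structureConst_eq h ⟨l, S, b, U⟩ ⟨l, U, b', V⟩ ⟨l, S, b'', V⟩).trans ?_
    refine (congrArg (cellCoeff l.1 S b'' V) h3).trans ?_
    rw [map_smul, smul_eq_mul]
    exact congrArg _ (cellCoeff_cellHom l.1 S V b'' _)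
  rw [h1]
  have h2 := (HasLead.C ((cellTable l.1).basis.repr
    ((cellTable l.1).basis b * (cellTable l.1).basis b') b'')).quantumTwo_pow_mul
      ((n - l.1) / 2)
  rw [add_zero] at h2
  exact h2

theorem structureConst_hasLead (h : (diagramTableDatum n).IsTabular)
    (X Y Z : (diagramTableDatum n).Index) (hne : h.structureConst X Y Z ≠ 0) :
    ∃ (A B E : AffineDiagram n) (m : ℤ), IsComposite A B E ∧
      topMap A = tabMap X.1.1 X.2.1 ∧ botMap A = tabMap X.1.1 X.2.2.2 ∧
      topMap B = tabMap Y.1.1 Y.2.1 ∧ botMap B = tabMap Y.1.1 Y.2.2.2 ∧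
      topMap E = tabMap Z.1.1 Z.2.1 ∧ botMap E = tabMap Z.1.1 Z.2.2.2 ∧
      m ≠ 0 ∧ HasLead (h.structureConst X Y Z) (stackLoops A B) m := by
  have hn := Nat.pos_of_neZero n
  have hA := isCell_cellDiagram X.1.1 X.2.1 X.2.2.1 X.2.2.2
  have hB := isCell_cellDiagram Y.1.1 Y.2.1 Y.2.2.1 Y.2.2.2
  set A := cellDiagram X.1.1 X.2.1 X.2.2.1 X.2.2.2
  set B := cellDiagram Y.1.1 Y.2.1 Y.2.2.1 Y.2.2.2
  have hE := isComposite_comp hn A B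
  obtain ⟨z, hz, hxy⟩ := exists_smul_of_mul hn hE
    (cellHom_basis_mem X.1.1 X.2.1 X.2.2.2 X.2.2.1)
    (cellHom_basis_mem Y.1.1 Y.2.1 Y.2.2.2 Y.2.2.1)
  obtain ⟨m, hm, hm'⟩ := cellCoeff_eq_C Z.1.1 Z.2.1 Z.2.2.2 Z.2.2.1 hz
  have hXY : (diagramTableDatum n).elt X * (diagramTableDatum n).elt Y =
      quantumTwo ^ stackLoops A B • z := by
    rw [← hxy]
    exact congrArg₂ _ (diagramTableDatum_elt X.1 X.2.1 X.2.2.1 X.2.2.2)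
      (diagramTableDatum_elt Y.1 Y.2.1 Y.2.2.1 Y.2.2.2)
  have hs : h.structureConst X Y Z =
      quantumTwo ^ stackLoops A B * LaurentPolynomial.C m := by
    rw [structureConst_eq, hXY, map_smul, smul_eq_mul]
    exact congrArg _ hm
  have hm0 : m ≠ 0 := by
    rintro rfl
    rw [hs, map_zero, mul_zero] at hne
    exact hne rfl
  refine ⟨A, B, _, m, hE, hA.1, hA.2, hB.1, hB.2, (hm' hm0).1, (hm' hm0).2, hm0, ?_⟩
  rw [hs]
  simpa using (HasLead.C m).quantumTwo_pow_mul (stackLoops A B)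

/-- The left factor has at least as many through edges as `Z`, and loops avoid their ends. -/
theorem degree_structureConst_le (h : (diagramTableDatum n).IsTabular)
    (X Y Z : (diagramTableDatum n).Index) :
    (h.structureConst X Y Z).degree ≤ (cellExponent n Z.1.1 : WithBot ℤ) := by
  have hn := Nat.pos_of_neZero n
  by_cases hne : h.structureConst X Y Z = 0
  · rw [hne, LaurentPolynomial.degree_zero]
    exact bot_le
  · obtain ⟨A, B, E, m, hE, -, hA, -, -, hZ, -, hm, hl⟩ := structureConst_hasLead h X Y Z hne
    refine hl.degree_le.trans ?_
    have h1 := two_mul_stackLoops_add_botMap_le A B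
    have h2 := hE.fixCount_topMap_le hn
    rw [← fixCount_botMap hn A,
      (congrArg (fixCount n) hZ).trans (fixCount_tabMap Z.1.1 Z.2.1)] at h2
    rw [cellExponent]
    norm_cast
    omega

/-- Maximal degree leaves no slack: both factors have exactly as many through edges as `Z`, and the
loop bound is sharp for both. So the facing rows agree, and then the outer rows of the product are
those of the factors. -/
theorem degree_structureConst_eq (h : (diagramTableDatum n).IsTabular)
    (X Y Z : (diagramTableDatum n).Index)
    (hd : (h.structureConst X Y Z).degree = (cellExponent n Z.1.1 : WithBot ℤ)) :
    tabMap X.1.1 X.2.2.2 = tabMap Y.1.1 Y.2.1 ∧ tabMap Z.1.1 Z.2.1 = tabMap X.1.1 X.2.1 ∧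
      tabMap Z.1.1 Z.2.2.2 = tabMap Y.1.1 Y.2.2.2 := by
  have hn := Nat.pos_of_neZero n
  have hne : h.structureConst X Y Z ≠ 0 := by
    intro h0
    rw [h0, LaurentPolynomial.degree_zero] at hd
    exact WithBot.bot_ne_coe hd
  obtain ⟨A, B, E, m, hE, hA, hA', hB, hB', hZ, hZ', hm, hl⟩ := structureConst_hasLead h X Y Z hne
  rw [hl.degree_eq_iff.2 hm, WithBot.coe_inj, cellExponent] at hd
  have hd' : stackLoops A B = (n - Z.1.1) / 2 := by exact_mod_cast hd
  obtain ⟨r, hr⟩ := Z.1.2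
  have h1 := two_mul_stackLoops_add_botMap_le A B
  have h2 := two_mul_stackLoops_add_topMap_le A B
  have h3 := hE.fixCount_topMap_le hn
  have h4 := hE.fixCount_botMap_le hn
  have hZf : fixCount n (topMap E) = Z.1.1 :=
    (congrArg (fixCount n) hZ).trans (fixCount_tabMap Z.1.1 Z.2.1)
  have hAf := fixCount_botMap hn A
  have hBf := fixCount_botMap hn B
  have hEf := fixCount_botMap hn E
  have hAB := botMap_eq_topMap_of_stackLoops (A := A) (B := B) (by omega) (by omega)
  refine ⟨by rw [← hA', hAB, hB], ?_, ?_⟩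
  · rw [← hA, ← hZ, hE.topMap_eq_of_eq hAB hn]
  · rw [← hB', ← hZ', hE.botMap_eq_of_eq hAB hn]

theorem degree_structureConst_iff (h : (diagramTableDatum n).IsTabular)
    (X Y Z : (diagramTableDatum n).Index) :
    (h.structureConst X Y Z).degree = (cellExponent n Z.1.1 : WithBot ℤ) ↔
      ∃ (l : (diagramTableDatum n).Λ) (S U V : (diagramTableDatum n).M l)
        (b b' b'' : ((diagramTableDatum n).table l).ι),
        X = ⟨l, S, b, U⟩ ∧ Y = ⟨l, U, b', V⟩ ∧ Z = ⟨l, S, b'', V⟩ ∧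
        ((diagramTableDatum n).table l).basis.repr
          (((diagramTableDatum n).table l).basis b * ((diagramTableDatum n).table l).basis b')
          b'' ≠ 0 := by
  constructor
  · intro hd
    obtain ⟨h1, h2, h3⟩ := degree_structureConst_eq h X Y Z hd
    obtain ⟨⟨l, hl⟩, S, b, U⟩ := X
    obtain ⟨⟨l', hl'⟩, U', b', V⟩ := Y
    obtain ⟨⟨l'', hl''⟩, S'', b'', V''⟩ := Z
    have e1 : l = l' := by
      rw [← fixCount_tabMap (n := n) l U, ← fixCount_tabMap (n := n) l' U']
      exact congrArg _ h1
    have e2 : l'' = l := by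
      rw [← fixCount_tabMap (n := n) l'' S'', ← fixCount_tabMap (n := n) l S]
      exact congrArg _ h2
    subst e1
    subst e2
    obtain rfl := tabMap_injective l'' h1
    obtain rfl := tabMap_injective l'' h2
    obtain rfl := tabMap_injective l'' h3
    refine ⟨_, _, _, _, _, _, _, rfl, rfl, rfl, ?_⟩
    exact (structureConst_of_eq h ⟨l'', hl⟩ S'' U V'' b b' b'').degree_eq_iff.1 hd
  · rintro ⟨l, S, U, V, b, b', b'', rfl, rfl, rfl, hr⟩
    exact (structureConst_of_eq h l S U V b b' b'').degree_eq_iff.2 hr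

theorem isGreatest_degree (h : (diagramTableDatum n).IsTabular)
    (Z : (diagramTableDatum n).Index) :
    IsGreatest {d : WithBot ℤ | ∃ X Y, d = (h.structureConst X Y Z).degree}
      (cellExponent n Z.1.1 : WithBot ℤ) := by
  constructor
  · obtain ⟨l, S, b, V⟩ := Z
    obtain ⟨e, he⟩ := (h.table_normalized l).one_mem
    -- The maximum is attained by multiplying `Z` from the left by the element of its cell with both
    -- tableaux `S` and index the unit.
    refine ⟨⟨l, S, e, S⟩, ⟨l, S, b, V⟩, ((degree_structureConst_iff h _ _ _).2
      ⟨l, S, S, V, e, b, b, rfl, rfl, rfl, ?_⟩).symm⟩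
    rw [he, one_mul, Module.Basis.repr_self, Finsupp.single_eq_same]
    exact one_ne_zero
  · rintro _ ⟨X, Y, rfl⟩
    exact degree_structureConst_le h X Y Z

end

end

/-! ### Bounds for the curves on the torus, and the case of equality. -/

section

namespace AffineDiagram

variable {n : ℕ} {D : AffineDiagram n}

/-! ### The curves of a diagram on the torus -/

theorem TorusConn.symm {P Q : ℤ × ℤ} (h : TorusConn D P Q) : TorusConn D Q P := by
  rw [torusConn_eq] at h ⊢
  exact h.symm

theorem TorusConn.trans {P Q R : ℤ × ℤ} (h : TorusConn D P Q) (h' : TorusConn D Q R) :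
    TorusConn D P R := Relation.ReflTransGen.trans h h'

theorem TorusConn.shift {P Q : ℤ × ℤ} (h : TorusConn D P Q) (p q : ℤ) :
    TorusConn D (P.1 + p * n, P.2 + q) (Q.1 + p * n, Q.2 + q) := by
  rw [torusConn_eq] at h ⊢
  simpa [torusStack] using PlaneStack.conn_shift (S := torusStack D) h p q

theorem torusConn_botMap {i : ℤ} (h : botMap D i ≠ i) (m : ℤ) :
    TorusConn D (i, m) (botMap D i, m) :=
  .single ⟨m, Node.bot i, rfl, by rw [pair_bot_of_ne h]; rfl⟩

theorem torusConn_topMap {i : ℤ} (h : topMap D i ≠ i) (m : ℤ) :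
    TorusConn D (i, m) (topMap D i, m) :=
  .single ⟨m - 1, Node.top i, by simp [place], by rw [pair_top_of_ne h]; simp [place]⟩

theorem torusConn_through {i j : ℤ} (h : D.pair (Node.bot i) = Node.top j) (m : ℤ) :
    TorusConn D (i, m) (j, m + 1) :=
  .single ⟨m, Node.bot i, rfl, by rw [h]; rfl⟩

/-- The step relation at a given height. -/
theorem torusStep_cases {j m : ℤ} {Q : ℤ × ℤ} (h : TorusStep D (j, m) Q) :
    Q = place m (D.pair (Node.bot j)) ∨ Q = place (m - 1) (D.pair (Node.top j)) := by
  obtain ⟨m', x | x, hx, rfl⟩ := h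
  · obtain ⟨h1, h2⟩ := Prod.ext_iff.1 hx
    have h1' : j = x := h1
    have h2' : m = m' + 1 := h2
    rw [h1', h2', add_sub_cancel_right]
    exact Or.inr rfl
  · obtain ⟨h1, h2⟩ := Prod.ext_iff.1 hx
    have h1' : j = x := h1
    have h2' : m = m' := h2
    rw [h1', h2']
    exact Or.inl rfl

theorem torusPeriods_subset_singleton_iff (i : ℤ) : torusPeriods D i ⊆ {0} ↔
    ∀ p q : ℤ, TorusConn D (i, 0) (i + p * n, q) → p = 0 ∧ q = 0 := by
  simp [torusPeriods, Set.subset_def, Prod.forall]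

theorem torusPeriods_subset_of_conn {i j p q : ℤ} (h : TorusConn D (i, 0) (j + p * n, q))
    (hi : torusPeriods D i ⊆ {0}) : torusPeriods D j ⊆ {0} := by
  rw [torusPeriods_subset_singleton_iff] at hi ⊢
  intro p' q' hj
  have h1 := hj.shift p q
  have h2 := h.symm.shift p' q'
  simp only [zero_add] at h1 h2
  rw [add_right_comm, add_comm q' q] at h1
  exact hi p' q' ((h.trans h1).trans h2)

theorem torusCurve_eq_of_conn {i j p q : ℤ} (h : TorusConn D (i, 0) (j + p * n, q)) :
    torusCurve D i = torusCurve D j := by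
  ext k
  constructor
  · rintro ⟨p', q', hk⟩
    refine ⟨p' - p, q' - q, ?_⟩
    convert (h.symm.trans hk).shift (-p) (-q) using 2 <;> ring
  · rintro ⟨p', q', hk⟩
    refine ⟨p' + p, q' + q, h.trans ?_⟩
    have h1 := hk.shift p q
    simp only [zero_add] at h1
    rwa [add_assoc, ← add_mul] at h1

theorem exists_conn_of_torusCurve_eq {i j : ℤ} (h : torusCurve D i = torusCurve D j) :
    ∃ p q : ℤ, TorusConn D (i, 0) (j + p * n, q) := by
  have : j ∈ torusCurve D j := ⟨0, 0, by simp; exact .refl⟩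
  rwa [← h] at this

theorem torusCurve_shift (i p : ℤ) : torusCurve D (i + p * n) = torusCurve D i :=
  torusCurve_eq_of_conn (p := p) (q := 0) .refl

theorem torusPeriods_subset_shift_iff (i p : ℤ) :
    torusPeriods D (i + p * n) ⊆ {0} ↔ torusPeriods D i ⊆ {0} := by
  refine ⟨torusPeriods_subset_of_conn (p := p) (q := 0) .refl,
    torusPeriods_subset_of_conn (p := -p) (q := 0) ?_⟩
  simp
  exact .refl

section

variable [NeZero n]

open Classical in
/-- The residues on contractible curves of the torus. -/
def contractibleResidues (D : AffineDiagram n) : Finset (Fin n) :=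
  {r | torusPeriods D (label r) ⊆ {0}}

open Classical in
/-- The residues of the ends of through edges in the bottom row. -/
def throughResidues (D : AffineDiagram n) : Finset (Fin n) :=
  {r | botMap D (label r) = label r}

omit [NeZero n] in
theorem mem_contractibleResidues {r : Fin n} :
    r ∈ contractibleResidues D ↔ torusPeriods D (label r) ⊆ {0} := by
  classical
  simp [contractibleResidues]

omit [NeZero n] in
theorem mem_throughResidues {r : Fin n} :
    r ∈ throughResidues D ↔ botMap D (label r) = label r := by
  classical
  simp [throughResidues]

omit [NeZero n] in
theorem card_throughResidues : (throughResidues D).card = fixCount n (botMap D) := by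
  rw [fixCount, ← Set.ncard_coe_finset]
  congr 1
  ext r
  simp [mem_throughResidues]

/-- The number of non-contractible curves that pass through nodes. -/
def windingCurves (D : AffineDiagram n) : ℕ :=
  Set.ncard {L : Set ℤ | ∃ i, L = torusCurve D i ∧ ¬ torusPeriods D i ⊆ {0}}

open Classical in
theorem torusContractible_eq_card : torusContractible D =
    ((contractibleResidues D).image fun r => torusCurve D (label r)).card := by
  rw [torusContractible, ncard_eq_card_image (torusCurve D) (fun i => torusPeriods D i ⊆ {0})
    torusCurve_shift torusPeriods_subset_shift_iff]
  rfl

open Classical in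
theorem windingCurves_eq_card : windingCurves D =
    ((contractibleResidues D)ᶜ.image fun r => torusCurve D (label r)).card := by
  rw [windingCurves, ncard_eq_card_image (torusCurve D) (fun i => ¬ torusPeriods D i ⊆ {0})
    torusCurve_shift (fun i p => not_congr (torusPeriods_subset_shift_iff i p))]
  congr 2
  ext r
  simp [mem_contractibleResidues]

theorem exists_partner_torus_bot {r : Fin n} (hr : botMap D (label r) ≠ label r) :
    ∃ (s : Fin n) (p : ℤ), botMap D (label r) = label s + p * n ∧ s ≠ r ∧
      TorusConn D (label r, 0) (label s + p * n, 0) := by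
  obtain ⟨s, p, hp, hs⟩ := exists_partner_of_isLine (isLine_botMap D) hr
  exact ⟨s, p, hp, hs, hp ▸ torusConn_botMap hr 0⟩

theorem exists_partner_torus_top {r : Fin n} (hr : topMap D (label r) ≠ label r) :
    ∃ (s : Fin n) (p : ℤ), topMap D (label r) = label s + p * n ∧ s ≠ r ∧
      TorusConn D (label r, 0) (label s + p * n, 0) := by
  obtain ⟨s, p, hp, hs⟩ := exists_partner_of_isLine (isLine_topMap D) hr
  exact ⟨s, p, hp, hs, hp ▸ torusConn_topMap hr 0⟩

omit [NeZero n] in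
theorem mem_contractibleResidues_of_conn {r s : Fin n} {p q : ℤ}
    (h : TorusConn D (label r, 0) (label s + p * n, q)) :
    (s ∈ contractibleResidues D ↔ r ∈ contractibleResidues D) ∧
      torusCurve D (label s) = torusCurve D (label r) := by
  rw [mem_contractibleResidues, mem_contractibleResidues]
  refine ⟨⟨torusPeriods_subset_of_conn (p := -p) (q := -q) ?_, torusPeriods_subset_of_conn h⟩,
    (torusCurve_eq_of_conn h).symm⟩
  convert h.symm.shift (-p) (-q) using 2 <;> ring

/-- The second residue is the partner under an arc or the other end of a through edge. That end
cannot have the same residue, since the curve would then have a period that changes the height by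
one. -/
theorem contractibleResidues_two {r : Fin n} (hr : r ∈ contractibleResidues D) :
    ∃ s ∈ contractibleResidues D, s ≠ r ∧ torusCurve D (label s) = torusCurve D (label r) := by
  by_cases hb : botMap D (label r) = label r
  · obtain ⟨j, hj⟩ := botMap_eq_self_iff.1 hb
    have hc := torusConn_through hj 0
    obtain ⟨s, p, rfl⟩ := exists_label_add (n := n) (Nat.pos_of_neZero n) j
    have h := mem_contractibleResidues_of_conn hc
    refine ⟨s, h.1.2 hr, ?_, h.2⟩
    rintro rfl
    have := (torusPeriods_subset_singleton_iff _).1 (mem_contractibleResidues.1 hr) _ _ hc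
    omega
  · obtain ⟨s, p, -, hs, hc⟩ := exists_partner_torus_bot hb
    have h := mem_contractibleResidues_of_conn hc
    exact ⟨s, h.1.2 hr, hs, h.2⟩

theorem two_mul_torusContractible_le (D : AffineDiagram n) :
    2 * torusContractible D ≤ (contractibleResidues D).card := by
  classical
  rw [torusContractible_eq_card]
  exact two_mul_card_image_le fun r hr => contractibleResidues_two hr

theorem windingCurves_le_card (D : AffineDiagram n) :
    windingCurves D + (contractibleResidues D).card ≤ n := by
  classical
  rw [windingCurves_eq_card]
  have h1 := Finset.card_image_le (s := (contractibleResidues D)ᶜ)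
    (f := fun r => torusCurve D (label r))
  have h2 := Finset.card_add_card_compl (contractibleResidues D)
  rw [Fintype.card_fin] at h2
  omega

/-- A contractible curve takes up at least two residues, an essential one at least one. -/
theorem two_mul_torusContractible_add_le (D : AffineDiagram n) :
    2 * torusContractible D + windingCurves D ≤ n := by
  have h1 := two_mul_torusContractible_le D
  have h2 := windingCurves_le_card D
  omega

/-- The curves can be moved off the seam. -/
def SeamFree (D : AffineDiagram n) : Prop :=
  ∀ i p q : ℤ, TorusConn D (i, 0) (i + p * n, q) → p = 0

omit [NeZero n] in
/-- A curve that avoids the through edges stays in its row. -/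
theorem height_eq_zero_of_forall_ne {i : ℤ}
    (h : ∀ j q, TorusConn D (i, 0) (j, q) → botMap D j ≠ j) {Q : ℤ × ℤ}
    (hQ : TorusConn D (i, 0) Q) : Q.2 = 0 := by
  induction hQ with
  | refl => rfl
  | @tail P Q hP hs ih =>
    obtain ⟨j, m⟩ := P
    have ih' : m = 0 := ih
    subst ih'
    have hj := h j 0 hP
    rcases torusStep_cases hs with rfl | rfl
    · rw [pair_bot_of_ne hj]
      rfl
    · by_cases ht : topMap D j = j
      · obtain ⟨k, hk⟩ := topMap_eq_self_iff.1 ht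
        have hc := hP.tail hs
        rw [hk] at hc
        exact (h k _ hc (botMap_eq_self_iff.2 ⟨j, (pair_eq_comm D).1 hk⟩)).elim
      · rw [pair_top_of_ne ht]
        rfl

/-- A curve without through edges stays in its row. Having no horizontal period either, it would be
contractible. -/
theorem exists_throughResidue (hD : SeamFree D) {r : Fin n} (hr : r ∉ contractibleResidues D) :
    ∃ s ∈ (contractibleResidues D)ᶜ ∩ throughResidues D,
      torusCurve D (label s) = torusCurve D (label r) := by
  by_contra hc
  push Not at hc
  apply hr
  rw [mem_contractibleResidues, torusPeriods_subset_singleton_iff]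
  intro p q hpq
  refine ⟨hD _ _ _ hpq, ?_⟩
  refine height_eq_zero_of_forall_ne (fun j q hj hfix => ?_) hpq
  obtain ⟨s, p, rfl⟩ := exists_label_add (n := n) (Nat.pos_of_neZero n) j
  have h := mem_contractibleResidues_of_conn hj
  refine hc s ?_ h.2
  rw [Finset.mem_inter, Finset.mem_compl, h.1, mem_throughResidues]
  refine ⟨hr, ?_⟩
  rw [(isLine_botMap D).shift_mul] at hfix
  exact add_right_cancel hfix

theorem windingCurves_le_card_inter (hD : SeamFree D) :
    windingCurves D ≤ ((contractibleResidues D)ᶜ ∩ throughResidues D).card := by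
  classical
  rw [windingCurves_eq_card]
  refine (Finset.card_le_card ?_).trans
    (Finset.card_image_le (f := fun r : Fin n => torusCurve D (label r)))
  intro L hL
  obtain ⟨r, hr, rfl⟩ := Finset.mem_image.1 hL
  obtain ⟨s, hs, h⟩ := exists_throughResidue hD (Finset.mem_compl.1 hr)
  exact Finset.mem_image.2 ⟨s, hs, h⟩

theorem windingCurves_le (hD : SeamFree D) : windingCurves D ≤ fixCount n (botMap D) := by
  rw [← card_throughResidues]
  exact (windingCurves_le_card_inter hD).trans (Finset.card_le_card Finset.inter_subset_right)

/-- If the number of curves is as large as possible, then the diagram is symmetric. -/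
theorem eq_of_le_two_mul_torus (hD : SeamFree D)
    (h : n + fixCount n (botMap D) ≤ 2 * (torusContractible D + windingCurves D)) :
    topMap D = botMap D ∧ ∀ i, botMap D i = i → D.pair (Node.bot i) = Node.top i := by
  classical
  have hn := Nat.pos_of_neZero n
  have h1 := windingCurves_le_card_inter hD
  have h2 := Finset.card_le_card
    (Finset.inter_subset_right (s₁ := (contractibleResidues D)ᶜ) (s₂ := throughResidues D))
  have h3 := two_mul_torusContractible_le D
  have h4 := windingCurves_le_card D
  have h5 := Finset.card_add_card_compl (contractibleResidues D)
  rw [Fintype.card_fin] at h5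
  rw [card_throughResidues] at h2
  -- The estimates `h1` to `h4` add up to `2 (c + w) ≤ n + l` for `c` contractible and `w` essential
  -- curves and `l` through edges, so by hypothesis all of them are equalities. The residues on
  -- essential curves are therefore exactly the ends of the through edges.
  have hsub : throughResidues D ⊆ (contractibleResidues D)ᶜ := by
    refine Finset.inter_eq_right.1 (Finset.eq_of_subset_of_card_le Finset.inter_subset_right ?_)
    rw [card_throughResidues]
    omega
  have heq : throughResidues D = (contractibleResidues D)ᶜ := by
    refine Finset.eq_of_subset_of_card_le hsub ?_
    rw [card_throughResidues]
    omega
  -- There are as many essential curves as residues on them, so each meets one residue. A through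
  -- edge must then return to its own residue, and seam-freeness makes it vertical.
  have hinj : Set.InjOn (fun r : Fin n => torusCurve D (label r)) (contractibleResidues D)ᶜ := by
    rw [← Finset.coe_compl, ← Finset.card_image_iff, ← windingCurves_eq_card]
    omega
  have hthrough : ∀ i, botMap D i = i → D.pair (Node.bot i) = Node.top i := by
    have main : ∀ r : Fin n, botMap D (label r) = label r →
        D.pair (Node.bot (label r)) = Node.top (label r) := by
      intro r hr
      obtain ⟨j, hj⟩ := botMap_eq_self_iff.1 hr
      have hc := torusConn_through hj 0
      obtain ⟨s, p, rfl⟩ := exists_label_add (n := n) hn j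
      have hrc : r ∈ (contractibleResidues D)ᶜ := hsub (mem_throughResidues.2 hr)
      have hs := mem_contractibleResidues_of_conn hc
      have hsc : s ∈ (contractibleResidues D)ᶜ := by
        rw [Finset.mem_compl, hs.1]
        exact Finset.mem_compl.1 hrc
      obtain rfl : s = r := hinj (by simpa using hsc) (by simpa using hrc) hs.2
      rw [hj, hD _ _ _ hc]
      simp
    intro i hi
    obtain ⟨r, p, rfl⟩ := exists_label_add (n := n) hn i
    rw [(isLine_botMap D).shift_mul, add_left_inj] at hi
    have := D.pair_shift_mul p (Node.bot (label r))
    rw [main r hi] at this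
    exact this
  refine ⟨?_, hthrough⟩
  funext i
  obtain ⟨r, q, rfl⟩ := exists_label_add (n := n) hn i
  rw [(isLine_botMap D).shift_mul, (isLine_topMap D).shift_mul]
  congr 1
  by_cases hr : r ∈ throughResidues D
  · rw [mem_throughResidues] at hr
    rw [hr]
    exact topMap_of_bot ((pair_eq_comm D).1 (hthrough _ hr))
  · have hrc : r ∈ contractibleResidues D := by
      rwa [heq, Finset.mem_compl, not_not] at hr
    rw [mem_throughResidues] at hr
    have ht : topMap D (label r) ≠ label r := by
      intro ht
      obtain ⟨k, hk⟩ := topMap_eq_self_iff.1 ht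
      have hk' := (pair_eq_comm D).1 hk
      have hkf := botMap_eq_self_iff.2 ⟨_, hk'⟩
      rw [hthrough k hkf] at hk'
      cases hk'
      exact hr hkf
    obtain ⟨s, p, hs, hsr, hsc⟩ := exists_partner_torus_bot hr
    obtain ⟨s', p', hs', hsr', hsc'⟩ := exists_partner_torus_top ht
    have hs1 := mem_contractibleResidues_of_conn hsc
    have hs2 := mem_contractibleResidues_of_conn hsc'
    rw [torusContractible_eq_card] at h h3
    -- A contractible curve meets exactly two residues, so the partners in the two rows coincide;
    -- contractibility then fixes the sheet.
    obtain rfl := eq_or_eq_of_card_le (fun r hr => contractibleResidues_two hr) (by omega) hrc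
      (hs1.1.2 hrc) (hs2.1.2 hrc) hs1.2 hs2.2 hsr hsr'
    have h7 : p - p' = 0 := by
      refine ((torusPeriods_subset_singleton_iff _).1
        (mem_contractibleResidues.1 (hs1.1.2 hrc)) (p - p') 0 ?_).1
      convert (hsc'.symm.trans hsc).shift (-p') 0 using 2 <;> ring
    rw [hs, hs', sub_eq_zero.1 h7]

section

variable (heq : topMap D = botMap D)
  (hthrough : ∀ i, botMap D i = i → D.pair (Node.bot i) = Node.top i)
include heq hthrough

omit [NeZero n] heq in
-- A vertical through edge continues as a vertical line through all copies of the strip.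
theorem fst_eq_of_conn {i : ℤ} (hi : botMap D i = i) {Q : ℤ × ℤ}
    (hQ : TorusConn D (i, 0) Q) : Q.1 = i := by
  induction hQ with
  | refl => rfl
  | @tail P Q _ hs ih =>
    obtain ⟨j, m⟩ := P
    have ih' : j = i := ih
    subst ih'
    rcases torusStep_cases hs with rfl | rfl
    · rw [hthrough _ hi]
      rfl
    · rw [(pair_eq_comm D).1 (hthrough _ hi)]
      rfl

omit [NeZero n] hthrough in
theorem eq_or_eq_of_conn {i : ℤ} (hi : botMap D i ≠ i) {Q : ℤ × ℤ}
    (hQ : TorusConn D (i, 0) Q) : Q = (i, 0) ∨ Q = (botMap D i, 0) := by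
  have hstep : ∀ j, botMap D j ≠ j → ∀ Q, TorusStep D (j, 0) Q → Q = (botMap D j, 0) := by
    intro j hj Q hQ
    rcases torusStep_cases hQ with rfl | rfl
    · rw [pair_bot_of_ne hj]
      rfl
    · rw [← heq] at hj ⊢
      rw [pair_top_of_ne hj]
      rfl
  induction hQ with
  | refl => exact Or.inl rfl
  | tail _ hs ih =>
    rcases ih with rfl | rfl
    · exact Or.inr (hstep _ hi _ hs)
    · left
      have := hstep _ (by rw [(isLine_botMap D).invol]; exact hi.symm) _ hs
      rwa [(isLine_botMap D).invol] at this

theorem seamFree_of_eq : SeamFree D := by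
  have hn := Nat.pos_of_neZero n
  intro i p q hpq
  by_cases hi : botMap D i = i
  · have := fst_eq_of_conn hthrough hi hpq
    simp only [add_eq_left, mul_eq_zero] at this
    omega
  · rcases eq_or_eq_of_conn heq hi hpq with h | h
    · have := (Prod.ext_iff.1 h).1
      simp only [add_eq_left, mul_eq_zero] at this
      omega
    · exact (isLine_botMap D).eq_of_eq_add hn (Prod.ext_iff.1 h).1.symm

theorem mem_contractibleResidues_iff_of_eq {r : Fin n} :
    r ∈ contractibleResidues D ↔ r ∉ throughResidues D := by
  rw [mem_contractibleResidues, torusPeriods_subset_singleton_iff, mem_throughResidues]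
  constructor
  · intro h hr
    have := torusConn_through (hthrough _ hr) 0
    have := (h 0 1 (by simpa using this)).2
    omega
  · intro hr p q hpq
    refine ⟨seamFree_of_eq heq hthrough _ _ _ hpq, ?_⟩
    rcases eq_or_eq_of_conn heq hr hpq with h | h <;> exact (Prod.ext_iff.1 h).2

theorem windingCurves_of_eq : windingCurves D = fixCount n (botMap D) := by
  classical
  have hset : (contractibleResidues D)ᶜ = throughResidues D := by
    ext r
    rw [Finset.mem_compl, mem_contractibleResidues_iff_of_eq heq hthrough, not_not]
  rw [windingCurves_eq_card, hset, ← card_throughResidues]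
  refine Finset.card_image_of_injOn fun r hr s hs hrs => ?_
  obtain ⟨p, q, hpq⟩ := exists_conn_of_torusCurve_eq hrs
  have h1 : label s + p * n = label r + 0 * n := by
    simpa using fst_eq_of_conn hthrough (mem_throughResidues.1 hr) hpq
  exact (label_add_inj.1 h1).1.symm

/-- Every arc closes up with the same arc in the neighbouring copy of the strip. The resulting curve
meets two residues, and all residues without through edges are used up in this way. -/
theorem two_mul_torusContractible_of_eq :
    2 * torusContractible D + fixCount n (botMap D) = n := by
  classical
  have hn := Nat.pos_of_neZero n
  have h1 := two_mul_torusContractible_add_le D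
  rw [windingCurves_of_eq heq hthrough] at h1
  have hset : (contractibleResidues D)ᶜ = throughResidues D := by
    ext r
    rw [Finset.mem_compl, mem_contractibleResidues_iff_of_eq heq hthrough, not_not]
  have h2 := Finset.card_add_card_compl (contractibleResidues D)
  rw [Fintype.card_fin, hset, card_throughResidues] at h2
  have h3 : (contractibleResidues D).card ≤ 2 * torusContractible D := by
    rw [torusContractible_eq_card]
    refine Finset.card_le_mul_card_image _ 2 fun L hL => ?_
    obtain ⟨r, hr, rfl⟩ := Finset.mem_image.1 hL
    have hr' := (mem_contractibleResidues_iff_of_eq heq hthrough).1 hr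
    rw [mem_throughResidues] at hr'
    obtain ⟨s, p, hs, -, -⟩ := exists_partner_torus_bot hr'
    refine (Finset.card_le_card (t := {r, s}) fun u hu => ?_).trans Finset.card_le_two
    rw [Finset.mem_filter] at hu
    obtain ⟨q, q', hq⟩ := exists_conn_of_torusCurve_eq hu.2.symm
    rw [Finset.mem_insert, Finset.mem_singleton]
    rcases eq_or_eq_of_conn heq hr' hq with h | h
    · left
      have : label u + q * n = label r + 0 * n := by simpa using (Prod.ext_iff.1 h).1
      exact (label_add_inj.1 this).1
    · right
      have : label u + q * n = label s + p * n := ((Prod.ext_iff.1 h).1).trans hs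
      exact (label_add_inj.1 this).1
  omega

end

end

end AffineDiagram

end

/-! ### The axiom (A5) and the conclusion. -/

section

open AffineDiagram DiagramAlgebra TableDatum

variable {n : ℕ} [NeZero n]

/-! ### The values of the trace -/

namespace AffineDiagram

variable {D D' : AffineDiagram n}

omit [NeZero n] in
theorem vertical_torusStack_iff (D : AffineDiagram n) : (torusStack D).Vertical ↔ SeamFree D := by
  constructor
  · intro h i p q hpq
    rw [torusConn_eq] at hpq
    exact h (i, 0) p q (by simpa [torusStack] using hpq)
  · rintro h ⟨i, k⟩ p q hp
    have h1 := PlaneStack.conn_shift (S := torusStack D) hp 0 (-k)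
    refine h i p q ?_
    rw [torusConn_eq]
    simpa [torusStack] using h1

omit [NeZero n] in
theorem homology_le_iff_seamFree (D : AffineDiagram n) :
    D.torusDiagram.homology ≤ AddSubgroup.zmultiples (0, 1) ↔ SeamFree D ∧ D.bands = 0 := by
  rw [homology_le_vertical_iff, vertical_torusStack_iff]

omit [NeZero n] in
theorem traceValue_of_seamFree (hD : SeamFree D) (hb : D.bands = 0) : traceValue D =
    quantumTwo ^ torusContractible D * T ((windingCurves D : ℤ) - n) := by
  rw [traceValue, traceWeight, if_pos ((homology_le_iff_seamFree D).2 ⟨hD, hb⟩)]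
  change _ * T (((windingCurves D + D.bands : ℕ) : ℤ) - n) = _
  rw [hb, add_zero]

omit [NeZero n] in
-- When the curves cannot be moved off the seam, the number of essential loops enters only through
-- an integer factor, possibly zero, and does not raise the degree.
theorem exists_traceValue_of_not_seamFree (hD : ¬ SeamFree D) : ∃ m : ℤ, traceValue D =
    quantumTwo ^ torusContractible D * (T (-(n : ℤ)) * LaurentPolynomial.C m) := by
  rw [traceValue, traceWeight, if_neg fun h => hD ((homology_le_iff_seamFree D).1 h).1]
  split_ifs
  · exact ⟨_, rfl⟩
  · exact ⟨0, by simp only [map_zero, mul_zero]⟩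

/-- Without through edges every curve stays in its row, so the essential ones are parallel to the
circle. If there are none, and no bands, the first branch of the weight applies; its value is the
same because `x^0 = U_0`. -/
theorem traceValue_of_fixCount_eq_zero (h0 : fixCount n (botMap D) = 0) : traceValue D =
    quantumTwo ^ torusContractible D * (T (-(n : ℤ)) * LaurentPolynomial.C
      (chebyshevBasis.repr (X ^ (windingCurves D + D.bands)) 0)) := by
  have hn := Nat.pos_of_neZero n
  have hne : ∀ i, botMap D i ≠ i := fun i hi =>
    absurd (((isLine_botMap D).fixCount_pos_iff hn).2 ⟨i, hi⟩) (by omega)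
  have hh : D.torusDiagram.homology ≤ AddSubgroup.zmultiples (1, 0) := by
    rw [homology_le_horizontal_iff]
    rintro ⟨i, k⟩ p q hp
    have h1 := PlaneStack.conn_shift (S := torusStack D) hp 0 (-k)
    have h2 : TorusConn D (i, 0) (i + p * n, q) := by
      rw [torusConn_eq]
      simpa [torusStack] using h1
    have h3 : q = 0 := height_eq_zero_of_forall_ne (fun j _ _ => hne j) h2
    rw [h3, zero_mul]
  by_cases hD : SeamFree D ∧ D.bands = 0
  · rw [traceValue_of_seamFree hD.1 hD.2]
    have hw : windingCurves D = 0 := by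
      have := windingCurves_le hD.1
      omega
    have h1 : (X : ℤ[X]) ^ (0 + 0) = chebyshevBasis 0 := by
      rw [chebyshevBasis, Polynomial.Sequence.basis_eq_self]
      rfl
    rw [hw, hD.2, h1, Module.Basis.repr_self, Finsupp.single_eq_same, map_one, mul_one]
    congr 2
    simp
  · rw [traceValue, traceWeight, if_neg fun h => hD ((homology_le_iff_seamFree D).1 h), if_pos hh]
    rfl

omit [NeZero n] in
theorem torusConn_congr (h : D.pair = D'.pair) : TorusConn D = TorusConn D' := by
  unfold TorusConn TorusStep
  rw [h]

omit [NeZero n] in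
theorem torusContractible_congr (h : D.pair = D'.pair) :
    torusContractible D = torusContractible D' := by
  simp only [torusContractible, torusCurve, torusPeriods, torusConn_congr h]

omit [NeZero n] in
theorem windingCurves_congr (h : D.pair = D'.pair) : windingCurves D = windingCurves D' := by
  simp only [windingCurves, torusCurve, torusPeriods, torusConn_congr h]

/-- The residues are used up by contractible curves, and these have only the zero period. -/
theorem seamFree_of_two_mul_torusContractible (h : 2 * torusContractible D = n) :
    SeamFree D := by
  have h1 := two_mul_torusContractible_le D
  have h2 := Finset.card_le_univ (contractibleResidues D)
  rw [Fintype.card_fin] at h2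
  have h3 : contractibleResidues D = Finset.univ :=
    (Finset.card_eq_iff_eq_univ _).1 (by rw [Fintype.card_fin]; omega)
  intro i p q hpq
  obtain ⟨r, s, rfl⟩ := exists_label_add (Nat.pos_of_neZero n) i
  have hr := mem_contractibleResidues.1 (h3 ▸ Finset.mem_univ r)
  rw [← torusPeriods_subset_shift_iff (label r) s] at hr
  exact ((torusPeriods_subset_singleton_iff _).1 hr p q hpq).1

end AffineDiagram

namespace HasLead

variable {f : ℤ[T;T⁻¹]} {d e m : ℤ}

theorem of_lt (h : HasLead f d m) (hd : d < e) : HasLead f e 0 :=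
  ⟨h.2 e hd, fun e' he' => h.2 e' (hd.trans he')⟩

end HasLead

omit [NeZero n] in
theorem torusTrace_of (D : AffineDiagram n) : torusTrace n (of D) = traceValue D := lift_of _ _

omit [NeZero n] in
theorem torusTrace_reflect (x : DiagramAlgebra n) :
    torusTrace n (reflect x) = torusTrace n x := by
  refine linearMap_ext (f := torusTrace n ∘ₗ reflect) (g := torusTrace n) (fun D => ?_) x
  rw [LinearMap.comp_apply, reflect_of, torusTrace_of, torusTrace_of, traceValue_flip]

theorem torusTrace_mul_comm (x y : DiagramAlgebra n) :
    torusTrace n (x * y) = torusTrace n (y * x) := by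
  have hn := Nat.pos_of_neZero n
  induction x using DiagramAlgebra.induction with
  | hof D =>
    induction y using DiagramAlgebra.induction with
    | hof D' =>
      have h1 := isComposite_comp hn D D'
      have h2 := isComposite_comp hn D' D
      rw [of_mul_of hn h1, of_mul_of hn h2, map_smul, map_smul, torusTrace_of, torusTrace_of,
        smul_eq_mul, smul_eq_mul]
      exact traceValue_comm hn h1 h2
    | hadd y z hy hz => rw [mul_add, add_mul, map_add, map_add, hy, hz]
    | hsmul c y hy => rw [DiagramAlgebra.smul_mul, DiagramAlgebra.mul_smul, map_smul, map_smul, hy]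
    | hzero => rw [mul_zero, zero_mul]
  | hadd y z hy hz => rw [mul_add, add_mul, map_add, map_add, hy, hz]
  | hsmul c y hy => rw [DiagramAlgebra.smul_mul, DiagramAlgebra.mul_smul, map_smul, map_smul, hy]
  | hzero => rw [mul_zero, zero_mul]

theorem basis_indexZero (l : ℕ) : (cellTable l).basis (indexZero l) = 1 := by
  cases l with
  | zero =>
    have h : chebyshevBasis 0 = 1 := by
      rw [chebyshevBasis, Polynomial.Sequence.basis_eq_self]
      rfl
    exact h
  | succ t => exact monoBasis_zero (t + 1)

theorem basis_eq_one_iff {l : ℕ} {b : (cellTable l).ι} :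
    (cellTable l).basis b = 1 ↔ b = indexZero l := by
  constructor
  · intro h
    have h1 := (cellTable l).basis.repr_self b
    rw [h, ← basis_indexZero, Module.Basis.repr_self] at h1
    exact (Finsupp.single_left_injective one_ne_zero h1).symm
  · rintro rfl
    exact basis_indexZero l

open Classical in
-- For a seam-free diagram with `c` contractible and `w` essential curves the degree is `r + c + w -
-- n`. By `2c + w ≤ n` and `w ≤ t + 1` it is at most 0, with equality only for a symmetric diagram
-- with vertical through edges, that is, for `S = U` and `k = 0`. For other diagrams the degree is
-- at most `r + c - n`, which is negative because through edges force `2r < n`.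
theorem hasLead_traceValue {t r : ℕ} (hr : t + 1 + 2 * r = n) (S U : cellTableaux n (t + 1))
    (k : ℤ) : HasLead (T r * traceValue (cellDiagram (t + 1) S k U)) 0
      (if S = U ∧ k = 0 then 1 else 0) := by
  have hn := Nat.pos_of_neZero n
  have hD := isCell_cellDiagram (t + 1) S k U
  set D := cellDiagram (t + 1) S k U
  have hfix : fixCount n (botMap D) = t + 1 := by rw [fixCount_botMap hn, hD.fixCount_eq]
  have hiff : S = U ∧ k = 0 ↔
      topMap D = botMap D ∧ ∀ i, botMap D i = i → D.pair (Node.bot i) = Node.top i := by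
    constructor
    · rintro ⟨rfl, rfl⟩
      have h := hD.1.trans hD.2.symm
      refine ⟨h, fun i hi => ?_⟩
      obtain ⟨j, hj⟩ := botMap_eq_self_iff.1 hi
      have hj' := (pair_eq_comm D).1 hj
      have h1 : lineCount n (topMap D) j = lineCount n (botMap D) i + 0 := hD.3 j i hj'
      rw [h, add_zero] at h1
      rw [hj, lineCount_inj (isLine_botMap D) hn
        (h ▸ topMap_eq_self_iff.2 ⟨i, hj'⟩) hi h1]
    · rintro ⟨h1, h2⟩
      refine ⟨tabMap_injective (t + 1) (hD.1.symm.trans (h1.trans hD.2)), ?_⟩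
      obtain ⟨i, hi⟩ := ((isLine_botMap D).fixCount_pos_iff hn).1 (by omega)
      have h3 : lineCount n (topMap D) i = lineCount n (botMap D) i + k :=
        hD.3 i i ((pair_eq_comm D).1 (h2 i hi))
      rw [h1] at h3
      omega
  by_cases hs : SeamFree D
  · rw [traceValue_of_seamFree hs hD.4]
    have h1 := ((HasLead.one.T_mul ((windingCurves D : ℤ) - n)).quantumTwo_pow_mul
      (torusContractible D)).T_mul r
    rw [mul_one] at h1
    split_ifs with hc
    · obtain ⟨h2, h3⟩ := hiff.1 hc
      have h4 := windingCurves_of_eq h2 h3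
      have h5 := two_mul_torusContractible_of_eq h2 h3
      convert h1 using 1
      omega
    · refine h1.of_lt ?_
      by_contra hlt
      exact hc (hiff.2 (eq_of_le_two_mul_torus hs (by omega)))
  · obtain ⟨m, hm⟩ := exists_traceValue_of_not_seamFree hs
    rw [hm, if_neg fun hc => hs (seamFree_of_eq (hiff.1 hc).1 (hiff.1 hc).2)]
    have h1 := (((HasLead.C m).T_mul (-(n : ℤ))).quantumTwo_pow_mul (torusContractible D)).T_mul r
    have h2 := two_mul_torusContractible_add_le D
    exact h1.of_lt (by omega)

/-- Each band contributes a factor `x`, and so does each of the `w` essential curves formed by the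
arcs. By linearity only the coefficient of `U_0` in `x^w g` enters. -/
theorem torusTrace_cellHom_zero (S U : AffineInvolution n) (g : ℤ[X]) :
    torusTrace n (cellHom 0 S U g) =
      quantumTwo ^ torusContractible (cellDiagram (n := n) 0 S (indexZero 0) U) *
        (T (-(n : ℤ)) * LaurentPolynomial.C (chebyshevBasis.repr
          (X ^ windingCurves (cellDiagram (n := n) 0 S (indexZero 0) U) * g) 0)) := by
  have hn := Nat.pos_of_neZero n
  set D := cellDiagram (n := n) 0 S (indexZero 0) U with hDdef
  have hD : IsCell 0 S (indexZero 0) U D := isCell_cellDiagram 0 S (indexZero 0) U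
  let R : ℤ[X] →ₗ[ℤ] ℤ[T;T⁻¹] :=
    LinearMap.mulLeft ℤ (quantumTwo ^ torusContractible D * T (-(n : ℤ))) ∘ₗ
      (LaurentPolynomial.C : ℤ →+* ℤ[T;T⁻¹]).toAddMonoidHom.toIntLinearMap ∘ₗ
      chebyshevBasis.coord 0 ∘ₗ LinearMap.mulLeft ℤ (X ^ windingCurves D)
  have hR : ∀ g, R g = quantumTwo ^ torusContractible D * (T (-(n : ℤ)) * LaurentPolynomial.C
      (chebyshevBasis.repr (X ^ windingCurves D * g) 0)) := fun g => _root_.mul_assoc _ _ _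
  rw [← hR]
  refine cellHom_ext (l := 0) (f := (torusTrace n).restrictScalars ℤ ∘ₗ cellHom 0 S U) (g := R)
    (fun k => ?_) g
  change torusTrace n (cellHom 0 S U (monoBasis 0 k)) = R (monoBasis 0 k)
  have hk := isCell_cellDiagram 0 S k U
  have hp := pair_eq_of_fixCount_eq_zero hn hk.fixCount_eq (hk.1.trans hD.1.symm)
    (hk.2.trans hD.2.symm)
  have hmono : ∀ k : ℕ, Polynomial.basisMonomials ℤ k = X ^ k := fun k => by
    rw [Polynomial.coe_basisMonomials, Polynomial.X_pow_eq_monomial]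
  refine (congrArg (torusTrace n) (cellHom_monoBasis 0 S U k)).trans ?_
  rw [torusTrace_of, traceValue_of_fixCount_eq_zero
    (by rw [fixCount_botMap hn, hk.fixCount_eq]), torusContractible_congr hp,
    windingCurves_congr hp, hk.4]
  refine .trans ?_ ((hR _).symm.trans (congrArg R (hmono k).symm))
  rw [pow_add]
  rfl

open Classical in
-- The degree is at most `r + c - n`, which is negative unless the `c` contractible curves use up
-- all residues, and that forces `S = U`. If `S = U`, then `w = 0`, and the leading coefficient is
-- that of `U_0` in `U_b`.
theorem hasLead_torusTrace_cellHom_zero {r : ℕ} (hr : 2 * r = n) (S U : AffineInvolution n)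
    (b : ℕ) : HasLead (T r * torusTrace n (cellHom 0 S U (chebyshevBasis b))) 0
      (if S = U ∧ b = 0 then 1 else 0) := by
  have hn := Nat.pos_of_neZero n
  have hD : IsCell 0 S (indexZero 0) U (cellDiagram (n := n) 0 S (indexZero 0) U) :=
    isCell_cellDiagram (n := n) 0 S (indexZero 0) U
  refine (congrArg (fun f => HasLead (T r * f) 0 _)
    (torusTrace_cellHom_zero S U (chebyshevBasis b))).mpr ?_
  generalize cellDiagram (n := n) 0 S (indexZero 0) U = D at hD ⊢
  have h2 := (((HasLead.C (chebyshevBasis.repr (X ^ windingCurves D * chebyshevBasis b)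
    0)).T_mul (-(n : ℤ))).quantumTwo_pow_mul (torusContractible D)).T_mul r
  have hfix : fixCount n (botMap D) = 0 := by rw [fixCount_botMap hn, hD.fixCount_eq]
  have hle := two_mul_torusContractible_add_le D
  by_cases hSU : S = U
  · have h3 : topMap D = botMap D := hD.1.trans ((congrArg (tabMap 0) hSU).trans hD.2.symm)
    have h4 : ∀ i, botMap D i = i → D.pair (Node.bot i) = Node.top i := fun i hi =>
      absurd (((isLine_botMap D).fixCount_pos_iff hn).2 ⟨i, hi⟩) (by omega)
    have h5 := windingCurves_of_eq h3 h4
    have h6 := two_mul_torusContractible_of_eq h3 h4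
    rw [h5, hfix, pow_zero, one_mul, Module.Basis.repr_self, Finsupp.single_apply] at h2 ⊢
    convert h2 using 1
    · omega
    · simp only [hSU, true_and]
  · rw [if_neg fun h => hSU h.1]
    have hne : 2 * torusContractible D ≠ n := fun h =>
      hSU (tabMap_injective 0 (hD.1.symm.trans ((eq_of_le_two_mul_torus
        (seamFree_of_two_mul_torusContractible h) (by omega)).1.trans hD.2)))
    exact h2.of_lt (by omega)

open Classical in
theorem hasLead_torusTrace_cellHom {l r : ℕ} (hr : l + 2 * r = n) (S U : cellTableaux n l)
    (b : (cellTable l).ι) :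
    HasLead (T r * torusTrace n (cellHom l S U ((cellTable l).basis b))) 0
      (if S = U ∧ (cellTable l).basis b = 1 then 1 else 0) := by
  have hite : ∀ {f : ℤ[T;T⁻¹]} {p q : Prop} {_ : Decidable p} {_ : Decidable q}, (p ↔ q) →
      HasLead f 0 (if p then 1 else 0) → HasLead f 0 (if q then 1 else 0) := by
    intro f p q _ _ hpq h
    rwa [← if_congr hpq rfl rfl]
  cases l with
  | succ t =>
    refine hite (and_congr_right' (basis_eq_one_iff (l := t + 1)).symm)
      (?_ : HasLead _ 0 (if S = U ∧ (show ℤ from b) = 0 then 1 else 0))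
    rw [← monoBasis_succ, cellHom_monoBasis, torusTrace_of]
    exact hasLead_traceValue hr S U b
  | zero =>
    have hr' : 2 * r = n := by omega
    exact hite (and_congr_right' (basis_eq_one_iff (l := 0)).symm)
      (hasLead_torusTrace_cellHom_zero hr' S U b)

/-! ### The diagram algebra is a tabular algebra with trace -/

theorem diagramTableDatum_isTabularWithTrace :
    (diagramTableDatum n).IsTabularWithTrace (torusTrace n) where
  isTabular := diagramTableDatum_isTabular
  trace_star := torusTrace_reflect
  trace_mul_comm := torusTrace_mul_comm
  exists_aFunction := by
    classical
    refine ⟨fun Z => cellExponent n Z.1.1, isGreatest_degree _, degree_structureConst_iff _,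
      fun l S U V e he => ?_, fun l S b U => ?_⟩
    · refine (structureConst_of_eq diagramTableDatum_isTabular l S U V e e e).1.trans ?_
      rw [he, one_mul, ← he, Module.Basis.repr_self, Finsupp.single_eq_same]
    · obtain ⟨r, hr⟩ := l.2
      have h1 := hasLead_torusTrace_cellHom hr S U b
      have h2 : torusTrace n ((T (cellExponent n l.1) : ℤ[T;T⁻¹]) •
          (diagramTableDatum n).elt ⟨l, S, b, U⟩) =
          T r * torusTrace n (cellHom l.1 S U ((cellTable l.1).basis b)) := by
        rw [map_smul, smul_eq_mul]
        refine congrArg₂ (· * ·) (congrArg T ?_)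
          (congrArg (torusTrace n) (diagramTableDatum_elt l S b U))
        rw [cellExponent]
        omega
      refine ⟨fun hc => ?_, fun hc => ?_⟩
      · rw [h2]
        exact (((congrArg (HasLead _ 0) (if_pos hc)).mp h1).sub_one).degree_lt_of_eq_zero
      · rw [h2]
        exact ((congrArg (HasLead _ 0) (if_neg hc)).mp h1).degree_lt_of_eq_zero

omit [NeZero n] in
theorem finite_affineDiagram_of_finite [Module.Finite ℤ[T;T⁻¹] (DiagramAlgebra n)] :
    Finite (AffineDiagram n) :=
  Module.Finite.finite_basis (R := ℤ[T;T⁻¹]) (M := DiagramAlgebra n) ⟨LinearEquiv.refl _ _⟩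

/-- The two tableaux of the identity carry one diagram for each winding number. -/
theorem infinite_affineDiagram : Infinite (AffineDiagram n) := by
  obtain ⟨S, k, U, h⟩ := exists_isCell (identity n)
  have hpos : 0 < fixCount n (topMap (identity n)) := by
    rw [fixCount_identity]
    exact Nat.pos_of_neZero n
  generalize fixCount n (topMap (identity n)) = l at S k U h hpos
  obtain ⟨t, rfl⟩ := Nat.exists_eq_succ_of_ne_zero hpos.ne'
  refine Infinite.of_injective (fun k : ℤ => cellDiagram (t + 1) S k U) fun k k' hk => ?_
  have h1 : IsCell (t + 1) S k U (cellDiagram (t + 1) S k U) := isCell_cellDiagram (t + 1) S k U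
  have h2 : IsCell (t + 1) S k' U (cellDiagram (t + 1) S k U) :=
    (show cellDiagram (t + 1) S k U = cellDiagram (t + 1) S k' U from hk) ▸
      isCell_cellDiagram (t + 1) S k' U
  exact (h1.unique h2).2.1

theorem not_finite_diagramAlgebra : ¬ Module.Finite ℤ[T;T⁻¹] (DiagramAlgebra n) := by
  intro h
  have := finite_affineDiagram_of_finite (n := n)
  exact not_finite_iff_infinite.2 infinite_affineDiagram this

end

end

open AffineDiagram in
/-- For `n ≥ 3`: stacking two affine `n`-diagrams gives a well-defined diagram, the triples
`[S₁, S₂, w]` name well-defined diagrams, and the diagram algebra, with its table datum and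
its torus trace, is a tabular algebra with trace that is not finitely generated as a module. -/
theorem theorem6p4p8 (n : ℕ) (hn : 3 ≤ n) :
    (∀ A B : AffineDiagram n, ∃! E : AffineDiagram n, IsComposite A B E) ∧
    (∀ t : ℕ, 0 < t → ∀ (S₁ S₂ : AnnularInvolution n t) (w : ℤ),
      ∃! D : AffineDiagram n, IsTriple S₁ S₂ w D) ∧
    (∀ (S₁ S₂ : AffineInvolution n) (k : ℕ), ∃! D : AffineDiagram n, IsTripleZero S₁ S₂ k D) ∧
    (diagramTableDatum n).IsTabularWithTrace (torusTrace n) ∧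
    ¬ Module.Finite ℤ[T;T⁻¹] (DiagramAlgebra n) := by
  have : NeZero n := ⟨by omega⟩
  exact ⟨existsUnique_isComposite (by omega), fun _ ht => existsUnique_isTriple ht,
    existsUnique_isTripleZero, diagramTableDatum_isTabularWithTrace, not_finite_diagramAlgebra⟩
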